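/- Let $N\ge 0$ be an even integer and let $L=\mathbb{Z}^N$ be an even positive definite lattice: its bilinear form is $(x,y)=x^{t}Sy$, where the Gram matrix $S\in\mathbb{Z}^{N\times N}$ is symmetric and positive definite with even diagonal entries. Extend $(\cdot,\cdot)$ bilinearly to $L\otimes\mathbb{Q}$ and $L\otimes\mathbb{C}=\mathbb{C}^N$, let $L^\vee=S^{-1}\mathbb{Z}^N$ be the dual lattice, $\operatorname{vol}(L)=\sqrt{\det S}$ the covolume of $L$, and $\mathcal{H}$ the upper half plane. The Jacobi group $\Gamma^J=\mathrm{SL}(2,\mathbb{Z})\ltimes(L\times L)$, in which $A[x,y]A^{-1}=[dx-cy,\,-bx+ay]$ for $A=\begin{pmatrix}a&b\\c&d\end{pmatrix}$, acts from the right on functions $\phi:\mathcal{H}\times(L\otimes\mathbb{C})\to\mathbb{C}$ (for fixed $k,m\in\mathbb{N}$) by $$(\phi|_{k,m}A)(\tau,\mathfrak z)=(c\tau+d)^{-k}e^{-\pi i m\frac{c(\mathfrak z,\mathfrak z)}{c\tau+d}}\,\phi\Big(\frac{a\tau+b}{c\tau+d},\frac{\mathfrak z}{c\tau+d}\Big),\qquad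 (\phi|_{k,m}[x,y])(\tau,\mathfrak z)=e^{\pi i m((x,x)\tau+2(x,\mathfrak z))}\,\phi(\tau,\mathfrak z+x\tau+y).$$ A holomorphic Jacobi form of weight $k$ and index $m$ is a holomorphic function $\phi$ on $\mathcal{H}\times(L\otimes\mathbb{C})$ with $\phi|_{k,m}g=\phi$ for all $g\in\Gamma^J$ that has a Fourier expansion $\phi(\tau,\mathfrak z)=\sum f(n,\lambda)e^{2\pi i n\tau+2\pi i(\lambda,\mathfrak z)}$ over $n\in\mathbb{Z}$, $\lambda\in L^\vee$ with $2nm-(\lambda,\lambda)\ge 0$. Let $\Gamma^J_\infty=\{g\in\Gamma^J : 1|_{k,m}g=1\}$ and let $E_{k,m}=\sum_{g\in\Gamma^J_\infty\backslash\Gamma^J}1|_{k,m}g$ be the Jacobi-Eisenstein series. Let $\Theta_{S,0,0}(\tau,\mathfrak z)=\sum_{\lambda\in\mathbb{Z}^N}e^{\pi i((\lambda,\lambda)\tau+2(\lambda,\mathfrak z))}$. **Theorem.** Let $k>N+2$ be even. Then the series $E_{k,1}$ converges absolutely at every point and is a holomorphic Jacobi form of weight $k$ and index $1$ on $\mathcal{H}\times(L\otimes\mathbb{C})$.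 For all $(\tau,\mathfrak z)\in\mathcal H\times(L\otimes\mathbb C)$, $$E_{k,1}(\tau,\mathfrak z)=\Theta_{S,0,0}(\tau,\mathfrak z)+\sum_{n=1}^{\infty}\ \sum_{\substack{\lambda\in L^\vee\\ n>\frac12(\lambda,\lambda)}}\beta_{k,1}(n,\lambda)\,e^{2\pi i n\tau}e^{2\pi i(\lambda,\mathfrak z)},$$ where, with $\Delta=n-\frac12(\lambda,\lambda)$, $$\beta_{k,1}(n,\lambda)=\frac{\Delta^{k-N/2-1}}{\operatorname{vol}(L)}\cdot\frac{i^{k-N}(-2\pi)^{k-N/2}}{\zeta(k-N)\,(k-N/2-1)!}\sum_{a=1}^{\infty}\frac{N_a(Q^\vee)}{a^{k-1}},$$ $Q^\vee(x)=\frac12\big((x,x)-2(\lambda,x)+2n\big)$ and $N_a(Q^\vee)=\#\{x\in L/aL : Q^\vee(x)\equiv 0 \bmod a\}$. All the series occurring here, including the double sum over $(n,\lambda)$, converge absolutely. -/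

import Mathlib

open scoped Matrix MatrixGroups UpperHalfPlane

noncomputable section

/-- An even positive definite lattice of rank `N`: the group `L = ℤ^N` with the bilinear form
whose Gram matrix with respect to the standard basis is `gram`. -/
structure EvenLattice (N : ℕ) where
  /-- the Gram matrix `S` -/
  gram : Matrix (Fin N) (Fin N) ℤ
  symm : gram.IsSymm
  even_diag : ∀ i, Even (gram i i)
  posDef : (gram.map (Int.cast : ℤ → ℝ)).PosDef

namespace EvenLattice

variable {N : ℕ} (L : EvenLattice N)

/-- The bilinear form `(x, y) = xᵗ S y` on `L ⊗ R = R^N`. -/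
def form {R : Type*} [CommRing R] (x y : Fin N → R) : R :=
  x ⬝ᵥ (L.gram.map (Int.cast : ℤ → R)) *ᵥ y

/-- The dual lattice `L^∨`, the vectors of `L ⊗ ℚ` pairing integrally with `L`. -/
def dual : AddSubgroup (Fin N → ℚ) where
  carrier := {l | ∀ x : Fin N → ℤ, ∃ t : ℤ, L.form l (fun i => (x i : ℚ)) = t}
  zero_mem' := fun x => ⟨0, by simp [form]⟩
  add_mem' := by
    intro a b ha hb x
    obtain ⟨s, hs⟩ := ha x
    obtain ⟨t, ht⟩ := hb x
    refine ⟨s + t, ?_⟩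
    simp only [form] at hs ht
    simp [form, hs, ht]
  neg_mem' := by
    intro a ha x
    obtain ⟨s, hs⟩ := ha x
    refine ⟨-s, ?_⟩
    simp only [form] at hs
    simp [form, hs]

/-- The covolume `vol(L) = √(det S)` of `L` in the Euclidean space `L ⊗ ℝ`. -/
def vol : ℝ := Real.sqrt (L.gram.det : ℝ)

end EvenLattice

/-- The action `A.[x, y] = [d x - c y, - b x + a y]` of `A = (a, b; c, d) ∈ SL(2, ℤ)` on `L × L`,
for `L = ℤ^N`. -/
def slActPair (N : ℕ) (A : SL(2, ℤ)) (h : (Fin N → ℤ) × (Fin N → ℤ)) :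
    (Fin N → ℤ) × (Fin N → ℤ) :=
  (A 1 1 • h.1 - A 1 0 • h.2, -(A 0 1 • h.1) + A 0 0 • h.2)

theorem slActPair_mul (N : ℕ) (A B : SL(2, ℤ)) (h : (Fin N → ℤ) × (Fin N → ℤ)) :
    slActPair N (A * B) h = slActPair N A (slActPair N B h) := by
  ext i <;>
  simp [slActPair, Matrix.SpecialLinearGroup.coe_mul, Matrix.mul_apply, Fin.sum_univ_two] <;> ring

theorem slActPair_one (N : ℕ) (h : (Fin N → ℤ) × (Fin N → ℤ)) : slActPair N 1 h = h := by
  ext i <;> simp [slActPair]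

/-- The action `slActPair` as a homomorphism into the automorphisms of `L × L` (written
multiplicatively). -/
def slAct (N : ℕ) : SL(2, ℤ) →* MulAut (Multiplicative ((Fin N → ℤ) × (Fin N → ℤ))) :=
  MonoidHom.mk'
    (fun A =>
      { toFun := fun h => Multiplicative.ofAdd (slActPair N A h.toAdd)
        invFun := fun h => Multiplicative.ofAdd (slActPair N A⁻¹ h.toAdd)
        left_inv := fun h => by
          simp [← slActPair_mul, slActPair_one]
        right_inv := fun h => by
          simp [← slActPair_mul, slActPair_one]
        map_mul' := fun h h' => by
          rw [← ofAdd_add]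
          congr 1
          ext i <;> simp [slActPair] <;> ring })
    (fun A B => by
      ext1 h
      exact congrArg Multiplicative.ofAdd (slActPair_mul N A B h.toAdd))

/-- The Jacobi group `Γ^J = SL(2, ℤ) ⋉ (L × L)`. The element `⟨[x, y], A⟩` is the product
`[x, y] · A`. -/
abbrev JacobiGroup (N : ℕ) : Type :=
  Multiplicative ((Fin N → ℤ) × (Fin N → ℤ)) ⋊[slAct N] SL(2, ℤ)

namespace EvenLattice

variable {N : ℕ} (L : EvenLattice N)

/-- The operator `φ ↦ φ|_{k,m} A` for `A ∈ SL(2, ℤ)`. -/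
def slashSL (k m : ℕ) (φ : ℍ → (Fin N → ℂ) → ℂ) (A : SL(2, ℤ)) : ℍ → (Fin N → ℂ) → ℂ :=
  fun τ z =>
    let j : ℂ := (A 1 0 : ℂ) * τ + (A 1 1 : ℂ)
    j ^ (-(k : ℤ)) * Complex.exp (-(Real.pi * Complex.I * m * ((A 1 0 : ℂ) * L.form z z / j))) *
      φ (A • τ) (j⁻¹ • z)

/-- The operator `φ ↦ φ|_m [x, y]` for `x, y ∈ L`. -/
def slashPair (m : ℕ) (φ : ℍ → (Fin N → ℂ) → ℂ) (h : (Fin N → ℤ) × (Fin N → ℤ)) :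
    ℍ → (Fin N → ℂ) → ℂ :=
  fun τ z =>
    let x : Fin N → ℂ := fun i => (h.1 i : ℂ)
    let y : Fin N → ℂ := fun i => (h.2 i : ℂ)
    Complex.exp (Real.pi * Complex.I * m * (L.form x x * τ + 2 * L.form x z)) *
      φ τ (z + (τ : ℂ) • x + y)

/-- The action `φ|_{k,m} g` of the Jacobi group. -/
def slash (k m : ℕ) (φ : ℍ → (Fin N → ℂ) → ℂ) (g : JacobiGroup N) : ℍ → (Fin N → ℂ) → ℂ :=
  L.slashSL k m (L.slashPair m φ g.left.toAdd) g.right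

/-! Bilinearity of the form and the fact that `slash` is a right action. -/

theorem form_add_left {R : Type*} [CommRing R] (x y z : Fin N → R) :
    L.form (x + y) z = L.form x z + L.form y z := by simp [form]

theorem form_add_right {R : Type*} [CommRing R] (x y z : Fin N → R) :
    L.form x (y + z) = L.form x y + L.form x z := by simp [form, Matrix.mulVec_add]

theorem form_smul_left {R : Type*} [CommRing R] (r : R) (x y : Fin N → R) :
    L.form (r • x) y = r * L.form x y := by simp [form]

theorem form_smul_right {R : Type*} [CommRing R] (r : R) (x y : Fin N → R) :
    L.form x (r • y) = r * L.form x y := by simp [form, Matrix.mulVec_smul]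

theorem form_comm {R : Type*} [CommRing R] (x y : Fin N → R) : L.form x y = L.form y x := by
  have hS : (L.gram.map (Int.cast : ℤ → R))ᵀ = L.gram.map (Int.cast : ℤ → R) := by
    rw [← Matrix.transpose_map, L.symm]
  rw [form, form, Matrix.dotProduct_mulVec, dotProduct_comm, ← Matrix.mulVec_transpose, hS]

theorem form_intCast (x y : Fin N → ℤ) :
    L.form (fun i => (x i : ℂ)) (fun i => (y i : ℂ)) = (L.form x y : ℤ) := by
  simp [form, dotProduct, Matrix.mulVec]

theorem even_form_self (x : Fin N → ℤ) : Even (L.form x x) := by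
  have hx : x = ∑ i, Pi.single i (x i) := (Finset.univ_sum_single x).symm
  rw [hx]
  refine Finset.sum_induction _ (fun v => Even (L.form v v)) ?_ (by simp [form]) ?_
  · intro a b ha hb
    have : L.form (a + b) (a + b) = L.form a a + L.form b b + 2 * L.form a b := by
      rw [form_add_left, form_add_right, form_add_right, L.form_comm b a]
      ring
    rw [this]
    exact (ha.add hb).add (even_two_mul _)
  · intro i _
    have : L.form (Pi.single i (x i)) (Pi.single i (x i)) = L.gram i i * (x i * x i) := by
      simp [form]
      ring
    rw [this]
    exact (L.even_diag i).mul_right _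

theorem slashPair_add (m : ℕ) (φ : ℍ → (Fin N → ℂ) → ℂ) (h h' : (Fin N → ℤ) × (Fin N → ℤ)) :
    L.slashPair m (L.slashPair m φ h) h' = L.slashPair m φ (h + h') := by
  obtain ⟨x, y⟩ := h
  obtain ⟨x', y'⟩ := h'
  funext τ z
  have e1 : (fun i => (((x + x') i : ℤ) : ℂ)) = (fun i => (x i : ℂ)) + fun i => (x' i : ℂ) := by
    funext i; simp
  have e2 : (fun i => (((y + y') i : ℤ) : ℂ)) = (fun i => (y i : ℂ)) + fun i => (y' i : ℂ) := by
    funext i; simp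
  have hint := L.form_intCast x y'
  have hcomm := L.form_comm (fun i => (x' i : ℂ)) (fun i => (x i : ℂ))
  simp only [slashPair, Prod.mk_add_mk, e1, e2, form_add_left, form_add_right, form_smul_right,
    smul_add]
  rw [← mul_assoc, ← Complex.exp_add]
  congr 1
  · rw [Complex.exp_eq_exp_iff_exists_int]
    refine ⟨m * L.form x y', ?_⟩
    push_cast
    rw [← hint, hcomm]
    ring
  · congr 1
    abel

theorem autFactor_ne_zero (A : SL(2, ℤ)) (τ : ℍ) :
    (A 1 0 : ℂ) * τ + (A 1 1 : ℂ) ≠ 0 := by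
  have h := UpperHalfPlane.denom_ne_zero (A : GL (Fin 2) ℝ) τ
  simpa [UpperHalfPlane.denom] using h

theorem coe_smul_mul (A : SL(2, ℤ)) (τ : ℍ) :
    ((A • τ : ℍ) : ℂ) * ((A 1 0 : ℂ) * τ + (A 1 1 : ℂ)) = (A 0 0 : ℂ) * τ + (A 0 1 : ℂ) := by
  have h := UpperHalfPlane.coe_specialLinearGroup_apply A τ
  simp only [eq_intCast, Complex.ofReal_intCast] at h
  rw [h, div_mul_cancel₀ _ (autFactor_ne_zero A τ)]

theorem det_cast (A : SL(2, ℤ)) : (A 0 0 : ℂ) * A 1 1 - A 0 1 * A 1 0 = 1 := by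
  have h := A.det_coe
  rw [Matrix.det_fin_two] at h
  exact_mod_cast h

theorem slashSL_mul (k m : ℕ) (φ : ℍ → (Fin N → ℂ) → ℂ) (A B : SL(2, ℤ)) :
    L.slashSL k m (L.slashSL k m φ A) B = L.slashSL k m φ (A * B) := by
  funext τ z
  have hB := autFactor_ne_zero B τ
  have hA := autFactor_ne_zero A (B • τ)
  have hBτ := coe_smul_mul B τ
  have hdet := det_cast B
  have e0 : (((A * B) 1 0 : ℤ) : ℂ) = A 1 0 * B 0 0 + A 1 1 * B 1 0 := by
    simp [Matrix.SpecialLinearGroup.coe_mul, Matrix.mul_apply, Fin.sum_univ_two]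
  have e1 : (((A * B) 1 1 : ℤ) : ℂ) = A 1 0 * B 0 1 + A 1 1 * B 1 1 := by
    simp [Matrix.SpecialLinearGroup.coe_mul, Matrix.mul_apply, Fin.sum_univ_two]
  have hj : (((A * B) 1 0 : ℤ) : ℂ) * τ + (((A * B) 1 1 : ℤ) : ℂ) =
      ((A 1 0 : ℂ) * (B • τ : ℍ) + (A 1 1 : ℂ)) * ((B 1 0 : ℂ) * τ + (B 1 1 : ℂ)) := by
    rw [e0, e1]
    linear_combination -(A 1 0 : ℂ) * hBτ
  simp only [slashSL, hj, form_smul_left, form_smul_right, mul_smul, mul_zpow, mul_inv]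
  generalize hjB : (B 1 0 : ℂ) * τ + (B 1 1 : ℂ) = jB at *
  generalize hjA : (A 1 0 : ℂ) * (B • τ : ℍ) + (A 1 1 : ℂ) = jA at *
  have hexp : -(Real.pi * Complex.I * m * ((((A * B) 1 0 : ℤ) : ℂ) * L.form z z / (jA * jB))) =
      -(Real.pi * Complex.I * m * ((B 1 0 : ℂ) * L.form z z / jB)) +
      -(Real.pi * Complex.I * m * ((A 1 0 : ℂ) * (jB⁻¹ * (jB⁻¹ * L.form z z)) / jA)) := by
    have key : (((A * B) 1 0 : ℤ) : ℂ) * jB = (B 1 0 : ℂ) * jA * jB + A 1 0 := by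
      rw [e0, ← hjA]
      linear_combination -(A 1 0 : ℂ) * (B 1 0 : ℂ) * hBτ +
        (A 1 0 : ℂ) * hdet - (A 1 0 : ℂ) * (B 0 0 : ℂ) * hjB
    have key' : (((A * B) 1 0 : ℤ) : ℂ) / (jA * jB) = B 1 0 / jB + A 1 0 / (jA * jB * jB) := by
      field_simp
      linear_combination key
    have : (((A * B) 1 0 : ℤ) : ℂ) * L.form z z / (jA * jB) =
        (B 1 0 : ℂ) * L.form z z / jB + (A 1 0 : ℂ) * (jB⁻¹ * (jB⁻¹ * L.form z z)) / jA := by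
      rw [mul_div_right_comm, key']
      field_simp
    rw [this]
    ring
  rw [hexp, Complex.exp_add]
  ring

theorem slashSL_slashPair (k m : ℕ) (φ : ℍ → (Fin N → ℂ) → ℂ) (A : SL(2, ℤ))
    (h : (Fin N → ℤ) × (Fin N → ℤ)) :
    L.slashPair m (L.slashSL k m φ A) h = L.slashSL k m (L.slashPair m φ (slActPair N A h)) A := by
  obtain ⟨x, y⟩ := h
  funext τ z
  have hA := autFactor_ne_zero A τ
  have hAτ := coe_smul_mul A τ
  have hdet := det_cast A
  have e1 : (fun i => (((A 1 1 • x - A 1 0 • y) i : ℤ) : ℂ)) =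
      (A 1 1 : ℂ) • (fun i => (x i : ℂ)) + (-(A 1 0 : ℂ)) • fun i => (y i : ℂ) := by
    funext i; simp; ring
  have e2 : (fun i => (((-(A 0 1 • x) + A 0 0 • y) i : ℤ) : ℂ)) =
      (-(A 0 1 : ℂ)) • (fun i => (x i : ℂ)) + (A 0 0 : ℂ) • fun i => (y i : ℂ) := by
    funext i; simp
  obtain ⟨p, hp⟩ := L.even_form_self x
  obtain ⟨q, hq⟩ := L.even_form_self y
  have hxx := L.form_intCast x x
  have hyy := L.form_intCast y y
  have hxy := L.form_intCast x y
  rw [hp] at hxx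
  rw [hq] at hyy
  push_cast at hxx hyy
  simp only [slashSL, slashPair, slActPair, e1, e2, form_add_left, form_add_right,
    form_smul_left, form_smul_right]
  generalize (fun i => (x i : ℂ)) = X at *
  generalize (fun i => (y i : ℂ)) = Y at *
  have c1 := L.form_comm X z
  have c2 := L.form_comm Y z
  have c3 := L.form_comm Y X
  generalize hj : (A 1 0 : ℂ) * τ + (A 1 1 : ℂ) = j at *
  generalize ((A • τ : ℍ) : ℂ) = σ at *
  generalize ha : ((A 0 0 : ℤ) : ℂ) = a at *
  generalize hb : ((A 0 1 : ℤ) : ℂ) = b at *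
  generalize hc : ((A 1 0 : ℤ) : ℂ) = c at *
  generalize hd : ((A 1 1 : ℤ) : ℂ) = d at *
  have hσ1 : a - c * σ = j⁻¹ := by
    field_simp
    linear_combination a * hj.symm - c * hAτ + hdet
  have hσ2 : d * σ - b = τ * j⁻¹ := by
    field_simp
    linear_combination d * hAτ - b * hj.symm + (τ : ℂ) * hdet
  have harg : j⁻¹ • z + σ • (d • X + -c • Y) + (-b • X + a • Y) = j⁻¹ • (z + (τ : ℂ) • X + Y) := by
    funext i
    simp only [Pi.add_apply, Pi.smul_apply, smul_eq_mul]
    linear_combination X i * hσ2 + Y i * hσ1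
  have hdj : c * τ * j⁻¹ + d * j⁻¹ = 1 := by
    rw [← add_mul, hj, mul_inv_cancel₀ hA]
  have hcomb : ∀ u₁ u₂ u₃ u₄ v w : ℂ, Complex.exp (u₁ + u₂) = Complex.exp (u₃ + u₄) →
      Complex.exp u₁ * (v * Complex.exp u₂ * w) = v * Complex.exp u₃ * (Complex.exp u₄ * w) := by
    intro u₁ u₂ u₃ u₄ v w he
    rw [Complex.exp_add, Complex.exp_add] at he
    linear_combination v * w * he
  rw [harg]
  apply hcomb
  rw [Complex.exp_eq_exp_iff_exists_int]
  refine ⟨m * (-(A 0 1 * A 1 1 * p) - A 0 0 * A 1 0 * q + A 0 1 * A 1 0 * L.form x y), ?_⟩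
  push_cast
  rw [ha, hb, hc, hd, ← hxy, c1, c2, c3, div_eq_mul_inv, div_eq_mul_inv]
  linear_combination (Real.pi * Complex.I * m : ℂ) * (-2 * L.form z X * hdj
    - L.form X X * τ * hdj - L.form X X * d * hσ2 - b * d * hxx + 2 * c * L.form X Y * hσ2
    + c * L.form Y Y * hσ1 - a * c * hyy)

theorem slash_mul (k m : ℕ) (φ : ℍ → (Fin N → ℂ) → ℂ) (g h : JacobiGroup N) :
    L.slash k m (L.slash k m φ g) h = L.slash k m φ (g * h) := by
  simp only [slash, slashSL_slashPair, slashSL_mul, slashPair_add]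
  rfl

theorem slash_one (k m : ℕ) (φ : ℍ → (Fin N → ℂ) → ℂ) : L.slash k m φ 1 = φ := by
  funext τ z
  have h0 : (fun _ : Fin N => (0 : ℂ)) = 0 := rfl
  simp [slash, slashSL, slashPair, form, h0]

/-- The subgroup `Γ_∞^J = {g ∈ Γ^J | 1|_{k,m} g = 1}`. -/
def stabOne (k m : ℕ) : Subgroup (JacobiGroup N) where
  carrier := {g | L.slash k m (fun _ _ => 1) g = fun _ _ => 1}
  one_mem' := L.slash_one k m _
  mul_mem' := by
    intro g h hg hh
    simp only [Set.mem_ofPred_eq] at hg hh ⊢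
    rw [← slash_mul, hg, hh]
  inv_mem' := by
    intro g hg
    simp only [Set.mem_ofPred_eq] at hg ⊢
    conv_lhs => rw [← hg]
    rw [slash_mul, mul_inv_cancel, slash_one]

/-- The summand `1|_{k,m} g` as a function of the coset `Γ_∞^J g`. -/
def eisensteinTerm (k m : ℕ) (q : Quotient (QuotientGroup.rightRel (L.stabOne k m))) :
    ℍ → (Fin N → ℂ) → ℂ :=
  Quotient.lift (fun g => L.slash k m (fun _ _ => 1) g)
    (by
      intro g h hgh
      have hmem : L.slash k m (fun _ _ => 1) (h * g⁻¹) = fun _ _ => 1 :=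
        QuotientGroup.rightRel_apply.mp hgh
      change L.slash k m (fun _ _ => 1) g = L.slash k m (fun _ _ => 1) h
      conv_lhs => rw [← hmem]
      rw [slash_mul, inv_mul_cancel_right]) q

/-- The Jacobi-Eisenstein series `E_{k,m}`, the sum of `1|_{k,m} g` over `Γ_∞^J \ Γ^J`. -/
def eisenstein (k m : ℕ) : ℍ → (Fin N → ℂ) → ℂ :=
  fun τ z => ∑' q, L.eisensteinTerm k m q τ z

/-- The monomial `e^{2π i n τ} e^{2π i (l, z)}`. -/
def fourierMonomial (n : ℤ) (l : Fin N → ℚ) (τ : ℍ) (z : Fin N → ℂ) : ℂ :=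
  Complex.exp (2 * Real.pi * Complex.I * n * τ) *
    Complex.exp (2 * Real.pi * Complex.I * L.form (fun i => (l i : ℂ)) z)

/-- Holomorphic Jacobi forms of weight `k` and index `m` on `ℍ × (L ⊗ ℂ)`. -/
structure IsJacobiForm (k m : ℕ) (φ : ℍ → (Fin N → ℂ) → ℂ) : Prop where
  holomorphic : DifferentiableOn ℂ
    (fun p : ℂ × (Fin N → ℂ) => φ (UpperHalfPlane.ofComplex p.1) p.2) {p | 0 < p.1.im}
  slash_eq : ∀ g : JacobiGroup N, L.slash k m φ g = φ
  fourier : ∃ f : ℤ → L.dual → ℂ, ∀ (τ : ℍ) (z : Fin N → ℂ),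
    HasSum
      (fun p : {p : ℤ × L.dual // 0 ≤ 2 * (p.1 : ℚ) * m - L.form (p.2 : Fin N → ℚ) p.2} =>
        f p.1.1 p.1.2 * L.fourierMonomial p.1.1 p.1.2 τ z)
      (φ τ z)

/-- The summands of the theta series `Θ_{S,a,b}`. -/
def thetaTerm (a b : Fin N → ℚ) (τ : ℍ) (z : Fin N → ℂ) (l : Fin N → ℤ) : ℂ :=
  let u : Fin N → ℂ := fun i => (l i : ℂ) + (a i : ℂ)
  let w : Fin N → ℂ := fun i => z i + (b i : ℂ)
  Complex.exp (Real.pi * Complex.I * (L.form u u * τ + 2 * L.form u w))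

/-- The theta series `Θ_{S,a,b}` of characteristic `(S, a, b)`. -/
def theta (a b : Fin N → ℚ) (τ : ℍ) (z : Fin N → ℂ) : ℂ :=
  ∑' l : Fin N → ℤ, L.thetaTerm a b τ z l

/-- `Q^∨(x) = ((x, x) - 2 (l, x) + 2 n) / 2` for `x ∈ L`. -/
def dualQuad (n : ℤ) (l : Fin N → ℚ) (x : Fin N → ℤ) : ℚ :=
  (L.form (fun i => (x i : ℚ)) (fun i => (x i : ℚ)) - 2 * L.form l (fun i => (x i : ℚ)) + 2 * n) / 2

/-- `N_a(Q^∨)`, the number of classes `x mod a` with `Q^∨(x) ≡ 0 mod a`. For `l ∈ L^∨` the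
function `Q^∨` is integral, and the congruence depends on `x mod a` only. -/
def repNum (n : ℤ) (l : Fin N → ℚ) (a : ℕ) : ℕ :=
  ((fun (x : Fin N → ℤ) (i : Fin N) => (x i : ZMod a)) ''
    {x | ∃ t : ℤ, L.dualQuad n l x = a * t}).ncard

/-- `Δ(n, l) = n - (l, l) / 2`. -/
def disc (n : ℤ) (l : Fin N → ℚ) : ℚ := n - L.form l l / 2

/-- The coefficient `β_{k,1}(n, l)` (for `N` even and `k > N + 2`). -/
def beta (k : ℕ) (n : ℤ) (l : Fin N → ℚ) : ℂ :=
  (L.disc n l : ℂ) ^ (k - N / 2 - 1) / (L.vol : ℂ) *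
    (Complex.I ^ (k - N) * (-2 * Real.pi : ℂ) ^ (k - N / 2) /
      (riemannZeta ((k : ℂ) - N) * ((k - N / 2 - 1).factorial : ℂ))) *
    ∑' a : ℕ+, (L.repNum n l a : ℂ) / (a : ℂ) ^ (k - 1)

end EvenLattice

end

/-! The stabilizer of 1 consists of the elements with `x = 0` and `c = 0`, so its cosets are indexed
by the bottom row `(c, d)` up to sign and by `x ∈ L`. The cosets with `c = 0` sum to the theta
series. For `c ≥ 1`, completing the square turns `1|g` into `(cτ+d)^{-k} e(a(x,x)/2c)` times a
Gaussian in `z - x/c`, where `e(w) = e^{2πiw}` (`slash_one_apply_of_ne_zero`).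

Write the lower right entry as `d + cr` with `0 ≤ d < c`, and put `σ = τ + d/c + r`. Splitting `x`
modulo `c` leaves full lattice sums of Gaussians. Poisson summation (`tsum_exp_form_add`) turns them
into theta series of `L^∨` and contributes `σ^{N/2}`; the sum over residues becomes a Gauss sum
(`tsum_slash_cosetRep_inr`). The sum over `r` is then evaluated by Lipschitz's formula with shift
`(l,l)/2`, which produces the truncated power `Δ^{k-N/2-1}` and removes every term with `Δ ≤ 0`
(`tsum_tsum_slash_cosetRep_inr`).

What remains for each `(n, l)` is the sum of `c^{-k} G_{c,d}(n,l)` over reduced fractions `d/c`.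
Over all `d` modulo `c` the Gauss sums add up to `c N_c(Q^∨)`, and passing from `d/c` to `gd/gc`
multiplies a Gauss sum by `g^N`. The full sum is therefore `ζ(k-N)` times the reduced one
(`tsum_gaussSum`).

Absolute convergence comes from the same inversion with real parameters: for fixed `(c, d)` the sum
over `x` of absolute values is `O(|cτ+d|^{N-k})`, and `k - N > 2`
(`summable_norm_slash_cosetRep_inr`). Invariance is a permutation of cosets. Holomorphy is read off
the Fourier expansion: a pointwise absolutely convergent series of exponentials of linear forms on
an open set is holomorphic, because the absolute values of its terms are convex
(`differentiableOn_tsum_mul_exp`). -/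

open MeasureTheory Set

/-! ### Poisson summation on `ℝ^N` -/

/-- Poisson summation in several variables. -/
theorem tsum_eq_tsum_integral_pi {N : ℕ} {f : (Fin N → ℝ) → ℂ} (hc : Continuous f)
    (hu : ∀ R : ℝ, ∃ u : (Fin N → ℤ) → ℝ, Summable u ∧
      ∀ v x, ‖v‖ ≤ R → ‖f (v + fun i => (x i : ℝ))‖ ≤ u x)
    (hint : Integrable f)
    (hs : Summable fun m : Fin N → ℤ =>
      ∫ v, Complex.exp (-(2 * Real.pi * Complex.I * ∑ i, (m i : ℂ) * (v i : ℂ))) * f v) :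
    ∑' x : Fin N → ℤ, f (fun i => (x i : ℝ)) =
      ∑' m : Fin N → ℤ,
        ∫ v, Complex.exp (-(2 * Real.pi * Complex.I * ∑ i, (m i : ℂ) * (v i : ℂ))) * f v := by
  -- The periodization of `f`. It descends to a continuous function `G` on the torus, whose Fourier
  -- coefficients are the integrals of the statement and whose Fourier series at 0 is the claim.
  set g : (Fin N → ℝ) → ℂ := fun v => ∑' x : Fin N → ℤ, f (v + fun i => (x i : ℝ)) with hg
  have hgc : Continuous g := by
    rw [continuous_iff_continuousAt]
    intro v₀
    obtain ⟨u, hus, hub⟩ := hu (‖v₀‖ + 1)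
    have : ContinuousOn g (Metric.ball v₀ 1) := by
      refine continuousOn_tsum (fun x => by fun_prop) hus ?_
      intro x v hv
      refine hub v x ?_
      have h1 := norm_le_norm_add_norm_sub' v v₀
      rw [mem_ball_iff_norm] at hv
      linarith
    exact this.continuousAt (Metric.ball_mem_nhds _ one_pos)
  have hper : ∀ (v : Fin N → ℝ) (y : Fin N → ℤ), g (v + fun i => (y i : ℝ)) = g v := by
    intro v y
    simp only [hg]
    rw [← (Equiv.addLeft y).tsum_eq (fun x : Fin N → ℤ => f (v + fun i => (x i : ℝ)))]
    congr 1
    funext x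
    congr 1
    funext i
    simp [add_assoc]
  let p : (Fin N → ℝ) → UnitAddTorus (Fin N) := fun v i => (v i : UnitAddCircle)
  have hp : IsOpenQuotientMap p :=
    IsOpenQuotientMap.piMap (f := fun _ : Fin N => ((↑) : ℝ → UnitAddCircle))
      (fun _ => QuotientAddGroup.isOpenQuotientMap_mk)
  have hfac : ∀ v w, p v = p w → g v = g w := by
    intro v w h
    have h' : ∀ i, ∃ n : ℤ, v i = w i + n := by
      intro i
      have hi : ((v i : ℝ) : UnitAddCircle) = (w i : ℝ) := congrFun h i
      obtain ⟨n, hn⟩ := AddSubgroup.mem_zmultiples_iff.1 (QuotientAddGroup.eq.1 hi)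
      refine ⟨-n, ?_⟩
      simp only [zsmul_eq_mul, mul_one] at hn
      push_cast
      linarith
    choose y hy using h'
    have : v = w + fun i => (y i : ℝ) := funext hy
    rw [this, hper]
  let G : C(UnitAddTorus (Fin N), ℂ) :=
    { toFun := Function.surjInv hp.surjective |> fun s => g ∘ s
      continuous_toFun := by
        rw [hp.isQuotientMap.continuous_iff]
        convert hgc using 1
        funext v
        exact hfac _ _ (Function.surjInv_eq hp.surjective _) }
  have hG : ∀ v, G (p v) = g v := fun v => hfac _ _ (Function.surjInv_eq hp.surjective _)
  have hexp : ∀ (m : Fin N → ℤ) (v : Fin N → ℝ), UnitAddTorus.mFourier (-m) (p v) =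
      Complex.exp (-(2 * Real.pi * Complex.I * ∑ i, (m i : ℂ) * (v i : ℂ))) := by
    intro m v
    simp only [UnitAddTorus.mFourier, ContinuousMap.coe_mk, p, fourier_coe_apply]
    rw [← Complex.exp_sum]
    congr 1
    rw [Finset.mul_sum, ← Finset.sum_neg_distrib]
    refine Finset.sum_congr rfl fun i _ => ?_
    simp
    ring
  have hcoef : ∀ m, UnitAddTorus.mFourierCoeff G m =
      ∫ v, Complex.exp (-(2 * Real.pi * Complex.I * ∑ i, (m i : ℂ) * (v i : ℂ))) * f v := by
    intro m
    rw [UnitAddTorus.mFourierCoeff_eq_integral _ _ 0]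
    -- The half-open unit cube is a fundamental domain for `ℤ^N`; unfolding over its translates
    -- turns the integral of `G` into one over `ℝ^N`.
    set Q : Set (Fin N → ℝ) :=
      {x | ∀ i, x i ∈ Ioc ((0 : Fin N → ℝ) i) ((0 : Fin N → ℝ) i + 1)} with hQ
    set h : (Fin N → ℝ) → ℂ :=
      fun v => Complex.exp (-(2 * Real.pi * Complex.I * ∑ i, (m i : ℂ) * (v i : ℂ))) * f v with hh
    have hQm : MeasurableSet Q := MeasurableSet.univ_pi' fun i => measurableSet_Ioc
    have hhint : Integrable h := by
      refine hint.bdd_mul (c := 1) (Continuous.aestronglyMeasurable (by fun_prop)) (Filter.Eventually.of_forall fun v => ?_)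
      rw [← hexp]
      refine ((UnitAddTorus.mFourier (-m)).norm_coe_le_norm _).trans ?_
      rw [UnitAddTorus.mFourier_norm]
    let s : (Fin N → ℤ) → Set (Fin N → ℝ) :=
      fun x => (fun v => v - fun i => (x i : ℝ)) ⁻¹' Q
    have hsm : ∀ x, MeasurableSet (s x) := fun x => hQm.preimage (by fun_prop)
    have hsd : Pairwise (Function.onFun Disjoint s) := by
      intro x y hxy
      rw [Function.onFun, Set.disjoint_left]
      intro v hx hy
      apply hxy
      funext i
      have h1 := hx i
      have h2 := hy i
      simp only [Pi.zero_apply, Pi.sub_apply, zero_add, mem_Ioc] at h1 h2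
      have h3 : (x i : ℝ) < y i + 1 := by linarith
      have h4 : (y i : ℝ) < x i + 1 := by linarith
      norm_cast at h3 h4
      omega
    have hsU : ⋃ x, s x = univ := by
      rw [eq_univ_iff_forall]
      intro v
      rw [mem_iUnion]
      -- The cube is open on the left and closed on the right, hence the ceiling minus one instead
      -- of the floor.
      refine ⟨fun i => ⌈v i⌉ - 1, fun i => ?_⟩
      simp only [Pi.zero_apply, Pi.sub_apply, zero_add, mem_Ioc]
      push_cast
      constructor <;> linarith [Int.ceil_lt_add_one (v i), Int.le_ceil (v i)]
    have htrans : ∀ {E : Type} [NormedAddCommGroup E] [NormedSpace ℝ E]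
        (F : (Fin N → ℝ) → E) (x : Fin N → ℤ),
        ∫ v in s x, F v = ∫ v in Q, F (v + fun i => (x i : ℝ)) := by
      intro E _ _ F x
      have hmp := measurePreserving_sub_right (volume : Measure (Fin N → ℝ)) (fun i => (x i : ℝ))
      have := hmp.setIntegral_preimage_emb
        (Homeomorph.subRight (fun i => (x i : ℝ)) : (Fin N → ℝ) ≃ₜ _).measurableEmbedding
        (fun v => F (v + fun i => (x i : ℝ))) Q
      simpa using this
    have hhx : ∀ x : Fin N → ℤ, IntegrableOn (fun v => h (v + fun i => (x i : ℝ))) Q :=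
      fun x => (hhint.comp_add_right _).integrableOn
    have hsum : HasSum (fun x => ∫ v in s x, h v) (∫ v, h v) := by
      have := hasSum_integral_iUnion (f := h) hsm hsd hhint.integrableOn
      rwa [hsU, Measure.restrict_univ] at this
    have hsumn : Summable (fun x => ∫ v in s x, ‖h v‖) :=
      (hasSum_integral_iUnion (f := fun v => ‖h v‖) hsm hsd hhint.norm.integrableOn).summable
    have hsum2 := hasSum_integral_of_summable_integral_norm (μ := volume.restrict Q)
      (F := fun (x : Fin N → ℤ) v => h (v + fun i => (x i : ℝ))) hhx
      (by simpa only [htrans] using hsumn)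
    simp only [htrans] at hsum
    rw [hsum.unique hsum2]
    refine setIntegral_congr_fun hQm fun v _ => ?_
    have e1 : UnitAddTorus.mFourier (-m) (fun i => (v i : UnitAddCircle)) = _ := hexp m v
    have e2 : G (fun i => (v i : UnitAddCircle)) = g v := hG v
    simp only [e1, e2, hg, smul_eq_mul]
    rw [← tsum_mul_left]
    refine tsum_congr fun x => ?_
    simp only [hh]
    congr 1
    rw [Complex.exp_eq_exp_iff_exists_int]
    refine ⟨∑ i, m i * x i, ?_⟩
    push_cast [mul_add, Finset.sum_add_distrib, Finset.mul_sum]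
    simp only [Pi.add_apply]
    push_cast [mul_add, Finset.sum_add_distrib]
    rw [Finset.sum_mul]
    rw [neg_add, add_assoc]
    simp only [left_eq_add]
    rw [neg_add_eq_zero]
    refine Finset.sum_congr rfl fun i _ => ?_
    ring
  have hfin := UnitAddTorus.hasSum_mFourier_series_apply_of_summable (f := G)
    (by rw [show UnitAddTorus.mFourierCoeff G = _ from funext hcoef]; exact hs) (p 0)
  rw [hG] at hfin
  have hg0 : g 0 = ∑' x : Fin N → ℤ, f (fun i => (x i : ℝ)) := by simp [hg]
  rw [← hg0, ← hfin.tsum_eq]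
  refine tsum_congr fun m => ?_
  rw [hcoef]
  have : UnitAddTorus.mFourier m (p 0) = 1 := by
    have := hexp (-m) 0
    simpa using this
  rw [this]
  simp

theorem summable_prod_pi {N : ℕ} {f : ℤ → ℝ} (hf : Summable f) (h0 : ∀ n, 0 ≤ f n) :
    Summable fun x : Fin N → ℤ => ∏ i, f (x i) := by
  induction N with
  | zero => exact Summable.of_finite
  | succ N ih =>
    refine ((Fin.consEquiv (fun _ : Fin (N + 1) => ℤ)).summable_iff
      (f := fun x : Fin (N + 1) → ℤ => ∏ i, f (x i))).1 ?_
    refine (hf.mul_of_nonneg ih h0 fun x => Finset.prod_nonneg fun i _ => h0 _).congr fun p => ?_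
    rw [Function.comp_apply, Fin.prod_univ_succ]
    rfl

theorem summable_exp_neg_norm (N : ℕ) {A : ℝ} (hA : 0 < A) :
    Summable fun x : Fin N → ℤ => Real.exp (-(A * ‖fun i => (x i : ℝ)‖)) := by
  -- The sum of the `|x i|` is at most `N` times the sup norm; `N + 1` also covers `N = 0`.
  set b : ℝ := A / (N + 1) with hb
  have hbpos : 0 < b := by positivity
  have h1 : Summable fun n : ℤ => Real.exp (-(b * |(n : ℝ)|)) := by
    have h : Summable fun n : ℕ => Real.exp (-(b * n)) := by
      have := Real.summable_exp_nat_mul_iff.2 (neg_neg_of_pos hbpos)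
      refine this.congr fun n => ?_
      congr 1
      ring
    refine Summable.of_nat_of_neg ?_ ?_ <;> simpa using h
  refine Summable.of_nonneg_of_le (fun x => (Real.exp_pos _).le) (fun x => ?_)
    (summable_prod_pi (N := N) h1 fun n => (Real.exp_pos _).le)
  rw [← Real.exp_sum, Real.exp_le_exp, Finset.sum_neg_distrib, neg_le_neg_iff, ← Finset.mul_sum]
  have h2 : ∑ i, |(x i : ℝ)| ≤ N * ‖fun i => (x i : ℝ)‖ := by
    calc ∑ i, |(x i : ℝ)| ≤ ∑ _i : Fin N, ‖fun i => (x i : ℝ)‖ :=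
          Finset.sum_le_sum fun i _ => norm_le_pi_norm (fun i => (x i : ℝ)) i
      _ = _ := by simp
  have h3 : 0 ≤ ‖fun i => (x i : ℝ)‖ := norm_nonneg _
  calc b * ∑ i, |(x i : ℝ)| ≤ b * (N * ‖fun i => (x i : ℝ)‖) := by gcongr
    _ ≤ b * ((N + 1) * ‖fun i => (x i : ℝ)‖) := by gcongr; linarith
    _ = _ := by rw [hb]; field_simp

/-! ### Gaussians attached to the lattice -/

namespace EvenLattice

variable {N : ℕ} (L : EvenLattice N)

theorem exists_gram_eq : ∃ B : Matrix (Fin N) (Fin N) ℝ, B.det ≠ 0 ∧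
    L.gram.map (Int.cast : ℤ → ℝ) = Bᵀ * B := by
  obtain ⟨B, hB⟩ : ∃ B : Matrix (Fin N) (Fin N) ℝ, L.gram.map (Int.cast : ℤ → ℝ) = Bᵀ * B := by
    open scoped MatrixOrder in
    obtain ⟨B, hB⟩ := CStarAlgebra.nonneg_iff_eq_star_mul_self.mp L.posDef.posSemidef.nonneg
    exact ⟨B, by simpa [Matrix.star_eq_conjTranspose] using hB⟩
  refine ⟨B, ?_, hB⟩
  have h := L.posDef.det_pos
  rw [hB, Matrix.det_mul, Matrix.det_transpose] at h
  exact fun h0 => by simp [h0] at h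

theorem vol_pos : 0 < L.vol := by
  have h := L.posDef.det_pos
  have e : (L.gram.map (Int.cast : ℤ → ℝ)).det = (L.gram.det : ℝ) :=
    ((Int.castRingHom ℝ).map_det L.gram).symm
  rw [e] at h
  exact Real.sqrt_pos.2 h

theorem form_ofReal (x y : Fin N → ℝ) :
    L.form (fun i => (x i : ℂ)) (fun i => (y i : ℂ)) = (L.form x y : ℝ) := by
  simp [form, dotProduct, Matrix.mulVec]

theorem form_intCast_real (x y : Fin N → ℤ) :
    L.form (fun i => (x i : ℝ)) (fun i => (y i : ℝ)) = (L.form x y : ℤ) := by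
  simp [form, dotProduct, Matrix.mulVec]

theorem form_ratCast (x y : Fin N → ℚ) :
    L.form (fun i => (x i : ℂ)) (fun i => (y i : ℂ)) = (L.form x y : ℚ) := by
  simp [form, dotProduct, Matrix.mulVec]

theorem form_ratCast_real (x y : Fin N → ℚ) :
    L.form (fun i => (x i : ℝ)) (fun i => (y i : ℝ)) = (L.form x y : ℚ) := by
  simp [form, dotProduct, Matrix.mulVec]

theorem form_eq_of_gram_eq {B : Matrix (Fin N) (Fin N) ℝ}
    (hB : L.gram.map (Int.cast : ℤ → ℝ) = Bᵀ * B) (x y : Fin N → ℝ) :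
    L.form x y = (B *ᵥ x) ⬝ᵥ (B *ᵥ y) := by
  rw [form, hB, ← Matrix.mulVec_mulVec, Matrix.dotProduct_mulVec, Matrix.vecMul_transpose]

theorem form_eq_of_gram_eq_complex {B : Matrix (Fin N) (Fin N) ℝ}
    (hB : L.gram.map (Int.cast : ℤ → ℝ) = Bᵀ * B) (x y : Fin N → ℂ) :
    L.form x y = (B.map Complex.ofReal *ᵥ x) ⬝ᵥ (B.map Complex.ofReal *ᵥ y) := by
  have hB' : L.gram.map (Int.cast : ℤ → ℂ) = (B.map Complex.ofReal)ᵀ * B.map Complex.ofReal := by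
    have := congrArg (fun M : Matrix (Fin N) (Fin N) ℝ => M.map Complex.ofRealHom) hB
    simp only [Matrix.map_mul, Matrix.map_map] at this
    convert this using 1
    · ext i j; simp
    · rfl
  rw [form, hB', ← Matrix.mulVec_mulVec, Matrix.dotProduct_mulVec, Matrix.vecMul_transpose]

theorem exists_form_ge : ∃ δ : ℝ, 0 < δ ∧ ∀ x : Fin N → ℝ, δ * ‖x‖ ^ 2 ≤ L.form x x := by
  obtain ⟨B, hdet, hB⟩ := L.exists_gram_eq
  set T := Matrix.toLin' (B⁻¹) |>.toContinuousLinearMap with hT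
  have hTB : ∀ x, T (B *ᵥ x) = x := by
    intro x
    simp [hT, Matrix.mulVec_mulVec, Matrix.nonsing_inv_mul B (isUnit_iff_ne_zero.2 hdet)]
  refine ⟨((‖T‖ + 1) ^ 2)⁻¹, by positivity, fun x => ?_⟩
  rw [L.form_eq_of_gram_eq hB]
  have h1 : ‖x‖ ≤ (‖T‖ + 1) * ‖B *ᵥ x‖ := by
    calc ‖x‖ = ‖T (B *ᵥ x)‖ := by rw [hTB]
      _ ≤ ‖T‖ * ‖B *ᵥ x‖ := T.le_opNorm _
      _ ≤ _ := by gcongr; linarith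
  have h2 : ∀ u : Fin N → ℝ, ‖u‖ ^ 2 ≤ u ⬝ᵥ u := by
    intro u
    have h3 : ‖u‖ ≤ Real.sqrt (u ⬝ᵥ u) := by
      refine (pi_norm_le_iff_of_nonneg (Real.sqrt_nonneg _)).2 fun i => ?_
      rw [Real.norm_eq_abs, ← Real.sqrt_sq_eq_abs]
      refine Real.sqrt_le_sqrt ?_
      rw [pow_two]
      exact Finset.single_le_sum (f := fun i => u i * u i) (fun j _ => mul_self_nonneg (u j))
        (Finset.mem_univ i)
    calc ‖u‖ ^ 2 ≤ (Real.sqrt (u ⬝ᵥ u)) ^ 2 := by gcongr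
      _ = _ := Real.sq_sqrt (Finset.sum_nonneg fun j _ => mul_self_nonneg (u j))
  refine le_trans ?_ (h2 _)
  rw [inv_mul_le_iff₀ (by positivity), ← mul_pow]
  gcongr

theorem exists_norm_form_le (w : Fin N → ℂ) :
    ∃ K : ℝ, 0 ≤ K ∧ ∀ x : Fin N → ℝ, ‖L.form (fun i => (x i : ℂ)) w‖ ≤ K * ‖x‖ := by
  refine ⟨∑ i, ‖(L.gram.map (Int.cast : ℤ → ℂ) *ᵥ w) i‖, by positivity, fun x => ?_⟩
  rw [form, dotProduct, Finset.sum_mul]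
  refine (norm_sum_le _ _).trans (Finset.sum_le_sum fun i _ => ?_)
  rw [norm_mul, mul_comm]
  gcongr
  simpa using norm_le_pi_norm x i

/-- The Gaussian on `L ⊗ ℝ` with complex parameters. -/
noncomputable def gaussian (t : ℂ) (w : Fin N → ℂ) (v : Fin N → ℝ) : ℂ :=
  Complex.exp (-(Real.pi * t * L.form v v) - 2 * Real.pi * L.form (fun i => (v i : ℂ)) w)

/-- The positive definite quadratic term beats every linear exponent, so the decay rate `A` is at
our disposal. This one bound gives the convergence of the theta series of both `L` and `L^∨`, as
well as the majorant in Poisson summation. -/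
theorem exists_norm_gaussian_le {t : ℂ} (ht : 0 < t.re) (w : Fin N → ℂ) (A : ℝ) :
    ∃ C : ℝ, ∀ v, ‖L.gaussian t w v‖ ≤ Real.exp (C - A * ‖v‖) := by
  obtain ⟨δ, hδ, hform⟩ := L.exists_form_ge
  obtain ⟨K, hK, hKw⟩ := L.exists_norm_form_le w
  set a := Real.pi * t.re * δ with ha
  have hapos : 0 < a := by positivity
  -- The maximum of `(A + 2πK) s - a s²` over real `s`.
  refine ⟨(A + 2 * Real.pi * K) ^ 2 / (4 * a), fun v => ?_⟩
  rw [gaussian, Complex.norm_exp, Real.exp_le_exp]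
  have h1 : (-(Real.pi * t * L.form v v) -
      2 * Real.pi * L.form (fun i => (v i : ℂ)) w : ℂ).re = -(Real.pi * t.re * L.form v v) -
      2 * Real.pi * (L.form (fun i => (v i : ℂ)) w).re := by
    simp
  rw [h1]
  have h2 := (Complex.abs_re_le_norm _).trans (hKw v)
  have h3 := neg_le_of_abs_le h2
  have h4 := mul_le_mul_of_nonneg_left (hform v) (by positivity : 0 ≤ Real.pi * t.re)
  have h5 : a * ‖v‖ ^ 2 ≤ Real.pi * t.re * L.form v v := by rw [ha]; linarith
  have h6 : 0 ≤ (A + 2 * Real.pi * K) ^ 2 / (4 * a) - (A + 2 * Real.pi * K) * ‖v‖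
      + a * ‖v‖ ^ 2 := by
    have : (A + 2 * Real.pi * K) ^ 2 / (4 * a) - (A + 2 * Real.pi * K) * ‖v‖ + a * ‖v‖ ^ 2 =
      ((A + 2 * Real.pi * K) - 2 * a * ‖v‖) ^ 2 / (4 * a) := by field_simp; ring
    rw [this]; positivity
  have h7 := mul_le_mul_of_nonneg_left h3 (by positivity : 0 ≤ 2 * Real.pi)
  linarith

theorem gaussian_mulVec {B : Matrix (Fin N) (Fin N) ℝ}
    (hB : L.gram.map (Int.cast : ℤ → ℝ) = Bᵀ * B) (t : ℂ) (w : Fin N → ℂ) (v : Fin N → ℝ) :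
    L.gaussian t w v = Complex.exp (-(Real.pi * t) * ∑ i, ((B *ᵥ v) i : ℂ) ^ 2 +
      ∑ i, (-(2 * Real.pi) * (B.map Complex.ofReal *ᵥ w) i) * ((B *ᵥ v) i : ℂ)) := by
  have e : ∀ i, (((B *ᵥ v) i : ℝ) : ℂ) = (B.map Complex.ofReal *ᵥ fun i => (v i : ℂ)) i := by
    intro i
    simp [Matrix.mulVec, dotProduct]
  rw [gaussian, ← form_ofReal, L.form_eq_of_gram_eq_complex hB, L.form_eq_of_gram_eq_complex hB]
  simp only [dotProduct, ← e]
  congr 1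
  rw [sub_eq_add_neg, Finset.mul_sum, Finset.mul_sum, Finset.mul_sum, ← Finset.sum_neg_distrib,
    ← Finset.sum_neg_distrib]
  congr 1
  · exact Finset.sum_congr rfl fun i _ => by ring
  · exact Finset.sum_congr rfl fun i _ => by ring

theorem vol_eq_abs_det {B : Matrix (Fin N) (Fin N) ℝ}
    (hB : L.gram.map (Int.cast : ℤ → ℝ) = Bᵀ * B) : L.vol = |B.det| := by
  have e : (L.gram.map (Int.cast : ℤ → ℝ)).det = (L.gram.det : ℝ) :=
    ((Int.castRingHom ℝ).map_det L.gram).symm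
  rw [vol, ← e, hB, Matrix.det_mul, Matrix.det_transpose, Real.sqrt_mul_self_eq_abs]

theorem continuous_gaussian (t : ℂ) (w : Fin N → ℂ) : Continuous (L.gaussian t w) := by
  unfold gaussian form dotProduct Matrix.mulVec dotProduct
  fun_prop

theorem integrable_gaussian {t : ℂ} (ht : 0 < t.re) (w : Fin N → ℂ) :
    Integrable (L.gaussian t w) := by
  obtain ⟨B, hdet, hB⟩ := L.exists_gram_eq
  have ht' : 0 < ((Real.pi : ℂ) * t).re := by simp; positivity
  have h := GaussianFourier.integrable_cexp_neg_mul_sum_add ht'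
    (fun i => -(2 * Real.pi : ℂ) * (B.map Complex.ofReal *ᵥ w) i)
  have hmap := Real.map_matrix_volume_pi_eq_smul_volume_pi hdet
  have h2 : Integrable (fun v : Fin N → ℝ => Complex.exp (-(Real.pi * t) * ∑ i, (v i : ℂ) ^ 2 +
      ∑ i, (-(2 * Real.pi : ℂ) * (B.map Complex.ofReal *ᵥ w) i) * v i))
      (Measure.map (Matrix.toLin' B) volume) := by
    rw [hmap]
    exact h.smul_measure (by simp)
  have h3 := h2.comp_measurable (Matrix.toLin' B).continuous_of_finiteDimensional.measurable
  refine h3.congr (Filter.Eventually.of_forall fun v => ?_)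
  simp only [Function.comp, L.gaussian_mulVec hB, Matrix.toLin'_apply]

/-- With `S = BᵗB`, the substitution `v ↦ Bv` reduces to the standard Gaussian and costs `|det B| =
vol(L)`. Since `N` is even, the half-integral power of `t` is an honest integral power and no branch
has to be chosen. -/
theorem integral_gaussian (hN : Even N) {t : ℂ} (ht : 0 < t.re) (w : Fin N → ℂ) :
    ∫ v, L.gaussian t w v =
      (L.vol : ℂ)⁻¹ * t⁻¹ ^ (N / 2) * Complex.exp (Real.pi * L.form w w / t) := by
  obtain ⟨B, hdet, hB⟩ := L.exists_gram_eq
  have ht' : 0 < ((Real.pi : ℂ) * t).re := by simp; positivity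
  have ht0 : t ≠ 0 := by rintro rfl; simp at ht
  have hpi : (Real.pi : ℂ) ≠ 0 := by exact_mod_cast Real.pi_ne_zero
  have h := GaussianFourier.integral_cexp_neg_mul_sum_add ht'
    (fun i => -(2 * Real.pi : ℂ) * (B.map Complex.ofReal *ᵥ w) i)
  have hmap := Real.map_matrix_volume_pi_eq_smul_volume_pi hdet
  have hemb : MeasurableEmbedding (Matrix.toLin' B) := by
    have := (Matrix.toLinearEquiv' B (Matrix.invertibleOfIsUnitDet B
      (isUnit_iff_ne_zero.2 hdet))).toContinuousLinearEquiv.toHomeomorph.measurableEmbedding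
    exact this
  have h3 := hemb.integral_map (μ := volume)
    (fun v : Fin N → ℝ => Complex.exp (-(Real.pi * t) * ∑ i, (v i : ℂ) ^ 2 +
      ∑ i, (-(2 * Real.pi : ℂ) * (B.map Complex.ofReal *ᵥ w) i) * v i))
  rw [hmap, integral_smul_measure, h] at h3
  simp only [Matrix.toLin'_apply, ← L.gaussian_mulVec hB] at h3
  rw [← h3, L.vol_eq_abs_det hB, ENNReal.toReal_ofReal (abs_nonneg _), abs_inv, Complex.real_smul,
    Complex.ofReal_inv, mul_assoc]
  congr 2
  · obtain ⟨m, rfl⟩ := hN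
    have e1 : (Fintype.card (Fin (m + m)) : ℂ) / 2 = (m : ℕ) := by
      rw [Fintype.card_fin]; push_cast; ring
    have e2 : (m + m) / 2 = m := by omega
    rw [e1, Complex.cpow_natCast, e2]
    congr 1
    field_simp
  · rw [L.form_eq_of_gram_eq_complex hB, dotProduct, Finset.mul_sum, Finset.sum_div, Finset.sum_div]
    congr 1
    refine Finset.sum_congr rfl fun i _ => ?_
    field_simp
    ring

end EvenLattice

/-! ### The dual lattice and theta inversion -/

namespace EvenLattice

variable {N : ℕ} (L : EvenLattice N)

theorem form_eq_mulVec_dotProduct {R : Type*} [CommRing R] (x y : Fin N → R) :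
    L.form x y = (L.gram.map (Int.cast : ℤ → R) *ᵥ x) ⬝ᵥ y := by
  rw [form_comm, form, dotProduct_comm]

theorem isUnit_det_gram_rat : IsUnit (L.gram.map (Int.cast : ℤ → ℚ)).det := by
  have h := L.posDef.det_pos
  have e : (L.gram.map (Int.cast : ℤ → ℝ)).det = (L.gram.det : ℝ) :=
    ((Int.castRingHom ℝ).map_det L.gram).symm
  have e' : (L.gram.map (Int.cast : ℤ → ℚ)).det = (L.gram.det : ℚ) :=
    ((Int.castRingHom ℚ).map_det L.gram).symm
  rw [e] at h
  rw [e', isUnit_iff_ne_zero]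
  have h' : 0 < L.gram.det := by exact_mod_cast h
  exact_mod_cast h'.ne'

/-- The vector of `L^∨` whose pairings with the standard basis of `L` are given by `m`. -/
noncomputable def dualOfInt (m : Fin N → ℤ) : L.dual :=
  ⟨(L.gram.map (Int.cast : ℤ → ℚ))⁻¹ *ᵥ fun i => (m i : ℚ), fun x => by
    refine ⟨∑ i, m i * x i, ?_⟩
    rw [form_eq_mulVec_dotProduct, Matrix.mulVec_mulVec,
      Matrix.mul_nonsing_inv _ L.isUnit_det_gram_rat, Matrix.one_mulVec]
    simp [dotProduct]⟩

theorem gram_mulVec_dualOfInt (m : Fin N → ℤ) :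
    L.gram.map (Int.cast : ℤ → ℚ) *ᵥ (L.dualOfInt m : Fin N → ℚ) = fun i => (m i : ℚ) := by
  rw [dualOfInt, Matrix.mulVec_mulVec, Matrix.mul_nonsing_inv _ L.isUnit_det_gram_rat,
    Matrix.one_mulVec]

theorem gram_mulVec_dualOfInt_complex (m : Fin N → ℤ) (i : Fin N) :
    (L.gram.map (Int.cast : ℤ → ℂ) *ᵥ fun i => ((L.dualOfInt m : Fin N → ℚ) i : ℂ)) i = m i := by
  have h := congrFun (L.gram_mulVec_dualOfInt m) i
  simp only [Matrix.mulVec, dotProduct, Matrix.map_apply] at h ⊢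
  exact_mod_cast h

theorem form_dualOfInt (m : Fin N → ℤ) (z : Fin N → ℂ) :
    L.form (fun i => ((L.dualOfInt m : Fin N → ℚ) i : ℂ)) z = ∑ i, (m i : ℂ) * z i := by
  rw [form_eq_mulVec_dotProduct, dotProduct]
  exact Finset.sum_congr rfl fun i _ => by rw [gram_mulVec_dualOfInt_complex]

theorem bijective_dualOfInt : Function.Bijective L.dualOfInt := by
  constructor
  · intro m m' h
    have h1 := L.gram_mulVec_dualOfInt m
    rw [h, gram_mulVec_dualOfInt] at h1
    funext i
    exact_mod_cast (congrFun h1 i).symm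
  · rintro ⟨l, hl⟩
    choose m hm using fun i => hl (Pi.single i 1)
    refine ⟨m, Subtype.ext ?_⟩
    have h : L.gram.map (Int.cast : ℤ → ℚ) *ᵥ l = fun i => (m i : ℚ) := by
      funext i
      rw [← hm i, form_eq_mulVec_dotProduct]
      have : (fun j => (((Pi.single i 1 : Fin N → ℤ) j : ℤ) : ℚ)) = Pi.single i 1 := by
        funext j
        rcases eq_or_ne j i with rfl | hj
        · simp
        · simp [hj]
      rw [this, dotProduct_single_one]
    change (L.gram.map (Int.cast : ℤ → ℚ))⁻¹ *ᵥ _ = l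
    rw [← h, Matrix.mulVec_mulVec, Matrix.nonsing_inv_mul _ L.isUnit_det_gram_rat,
      Matrix.one_mulVec]

/-- The dual lattice is isomorphic to `ℤ^N` by the pairings with the standard basis of `L`. -/
noncomputable def dualEquiv : (Fin N → ℤ) ≃ L.dual :=
  Equiv.ofBijective L.dualOfInt L.bijective_dualOfInt

theorem exists_summable_exp_dual : ∃ A : ℝ, 0 < A ∧
    Summable fun l : L.dual => Real.exp (-(A * ‖fun i => ((l : Fin N → ℚ) i : ℝ)‖)) := by
  set S := (L.gram.map (Int.cast : ℤ → ℝ)) with hS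
  set T := (Matrix.toLin' S).toContinuousLinearMap with hT
  refine ⟨‖T‖ + 1, by positivity, ?_⟩
  rw [← L.dualEquiv.summable_iff]
  refine Summable.of_nonneg_of_le (fun _ => (Real.exp_pos _).le) (fun m => ?_)
    (summable_exp_neg_norm N one_pos)
  rw [Function.comp_apply, Real.exp_le_exp, neg_le_neg_iff, one_mul]
  have h : (fun i => (m i : ℝ)) = T (fun i => ((L.dualEquiv m : Fin N → ℚ) i : ℝ)) := by
    funext i
    have h := congrFun (L.gram_mulVec_dualOfInt m) i
    simp only [hT, hS, Matrix.mulVec, dotProduct, Matrix.map_apply, LinearMap.coe_toContinuousLinearMap',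
      Matrix.toLin'_apply] at h ⊢
    exact_mod_cast h.symm
  rw [h]
  refine (T.le_opNorm _).trans ?_
  gcongr
  linarith

/-- A general term of the theta series of the dual lattice. -/
noncomputable def dualThetaTerm (t : ℂ) (z : Fin N → ℂ) (l : L.dual) : ℂ :=
  Complex.exp (2 * Real.pi * Complex.I * L.form (fun i => ((l : Fin N → ℚ) i : ℂ)) z -
    Real.pi * t * (L.form (l : Fin N → ℚ) l : ℚ))

/-- Puts the dual theta series within reach of the bound for the Gaussian. -/
theorem dualThetaTerm_eq (t : ℂ) (z : Fin N → ℂ) (l : L.dual) :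
    L.dualThetaTerm t z l =
      L.gaussian t (-Complex.I • z) (fun i => ((l : Fin N → ℚ) i : ℝ)) := by
  rw [dualThetaTerm, gaussian, form_smul_right, form_ratCast_real]
  congr 1
  push_cast
  ring

theorem summable_dualThetaTerm {t : ℂ} (ht : 0 < t.re) (z : Fin N → ℂ) :
    Summable (L.dualThetaTerm t z) := by
  obtain ⟨A, hA, hs⟩ := L.exists_summable_exp_dual
  obtain ⟨C, hC⟩ := L.exists_norm_gaussian_le ht (-Complex.I • z) A
  refine Summable.of_norm_bounded (hs.mul_left (Real.exp C)) fun l => ?_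
  rw [dualThetaTerm_eq, ← Real.exp_add, ← sub_eq_add_neg]
  exact hC _

theorem summable_gaussian {t : ℂ} (ht : 0 < t.re) (w : Fin N → ℂ) :
    Summable fun x : Fin N → ℤ => L.gaussian t w (fun i => (x i : ℝ)) := by
  obtain ⟨C, hC⟩ := L.exists_norm_gaussian_le ht w 1
  refine Summable.of_norm_bounded ((summable_exp_neg_norm N one_pos).mul_left (Real.exp C))
    fun x => ?_
  rw [← Real.exp_add, ← sub_eq_add_neg]
  exact hC _

/-- Multiplying by the character of frequency `m` shifts the linear parameter from `tz` to `tz +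
il`, where `l ∈ L^∨` corresponds to `m`. The Gaussian integral then contains `(tz + il, tz + il)/t =
t(z,z) + 2i(l,z) - (l,l)/t`, whose last two terms form the dual theta term. -/
theorem tsum_gaussian (hN : Even N) {t : ℂ} (ht : 0 < t.re) (z : Fin N → ℂ) :
    ∑' x : Fin N → ℤ, L.gaussian t (t • z) (fun i => (x i : ℝ)) =
      (L.vol : ℂ)⁻¹ * t⁻¹ ^ (N / 2) * Complex.exp (Real.pi * t * L.form z z) *
        ∑' l : L.dual, L.dualThetaTerm t⁻¹ z l := by
  have ht0 : t ≠ 0 := by rintro rfl; simp at ht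
  have ht' : 0 < t⁻¹.re := by
    rw [Complex.inv_re]
    exact div_pos ht (Complex.normSq_pos.2 ht0)
  have hint : ∀ m : Fin N → ℤ,
      ∫ v, Complex.exp (-(2 * Real.pi * Complex.I * ∑ i, (m i : ℂ) * (v i : ℂ))) *
        L.gaussian t (t • z) v =
      (L.vol : ℂ)⁻¹ * t⁻¹ ^ (N / 2) * Complex.exp (Real.pi * t * L.form z z) *
        L.dualThetaTerm t⁻¹ z (L.dualEquiv m) := by
    intro m
    set l : Fin N → ℂ := fun i => ((L.dualOfInt m : Fin N → ℚ) i : ℂ) with hl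
    have e : ∀ v : Fin N → ℝ,
        Complex.exp (-(2 * Real.pi * Complex.I * ∑ i, (m i : ℂ) * (v i : ℂ))) *
        L.gaussian t (t • z) v = L.gaussian t (t • z + Complex.I • l) v := by
      intro v
      rw [gaussian, gaussian, ← Complex.exp_add, form_add_right, L.form_smul_right Complex.I,
        L.form_comm _ l, hl, form_dualOfInt]
      congr 1
      ring
    simp_rw [e]
    rw [L.integral_gaussian hN ht, mul_assoc _ (Complex.exp _), dualThetaTerm, ← Complex.exp_add]
    congr 2
    rw [← form_ratCast, dualEquiv, Equiv.ofBijective_apply, ← hl]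
    simp only [form_add_left, form_add_right, form_smul_left, form_smul_right]
    rw [L.form_comm z l]
    field_simp
    linear_combination (L.form l l) * Complex.I_sq
  have hs := (L.summable_dualThetaTerm ht' z).mul_left
    ((L.vol : ℂ)⁻¹ * t⁻¹ ^ (N / 2) * Complex.exp (Real.pi * t * L.form z z))
  rw [tsum_eq_tsum_integral_pi (L.continuous_gaussian _ _) ?_ (L.integrable_gaussian ht _) ?_]
  · simp_rw [hint]
    rw [L.dualEquiv.tsum_eq (fun l => (L.vol : ℂ)⁻¹ * t⁻¹ ^ (N / 2) *
      Complex.exp (Real.pi * t * L.form z z) * L.dualThetaTerm t⁻¹ z l), tsum_mul_left]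
  · intro R
    obtain ⟨C, hC⟩ := L.exists_norm_gaussian_le ht (t • z) 1
    refine ⟨_, (summable_exp_neg_norm N one_pos).mul_left (Real.exp (C + R)), fun v x hv => ?_⟩
    refine (hC _).trans ?_
    rw [← Real.exp_add, Real.exp_le_exp]
    have := norm_le_add_norm_add (fun i => (x i : ℝ)) v
    rw [add_comm (fun i => (x i : ℝ)) v] at this
    linarith
  · simp_rw [hint]
    exact L.dualEquiv.summable_iff.2 hs

theorem gaussian_shift (t : ℂ) (z : Fin N → ℂ) (v : Fin N → ℝ) :
    Complex.exp (-(Real.pi * t * L.form (z + fun i => (v i : ℂ)) (z + fun i => (v i : ℂ)))) =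
      Complex.exp (-(Real.pi * t * L.form z z)) * L.gaussian t (t • z) v := by
  rw [gaussian, ← Complex.exp_add, ← form_ofReal, form_smul_right, form_add_right, form_add_left,
    form_add_left, L.form_comm z (fun i => (v i : ℂ))]
  congr 1
  ring

/-- The inversion formula of the theta series of an even lattice of even rank. -/
theorem tsum_exp_form_add (hN : Even N) {t : ℂ} (ht : 0 < t.re) (z : Fin N → ℂ) :
    ∑' x : Fin N → ℤ,
      Complex.exp (-(Real.pi * t * L.form (z + fun i => (x i : ℂ)) (z + fun i => (x i : ℂ)))) =
      (L.vol : ℂ)⁻¹ * t⁻¹ ^ (N / 2) * ∑' l : L.dual, L.dualThetaTerm t⁻¹ z l := by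
  have := fun x : Fin N → ℤ => L.gaussian_shift t z (fun i => (x i : ℝ))
  simp only [Complex.ofReal_intCast] at this
  simp_rw [this]
  rw [tsum_mul_left, L.tsum_gaussian hN ht, Complex.exp_neg]
  field_simp [Complex.exp_ne_zero]

theorem summable_exp_form_add {t : ℂ} (ht : 0 < t.re) (z : Fin N → ℂ) :
    Summable fun x : Fin N → ℤ =>
      Complex.exp (-(Real.pi * t * L.form (z + fun i => (x i : ℂ)) (z + fun i => (x i : ℂ)))) := by
  have := fun x : Fin N → ℤ => L.gaussian_shift t z (fun i => (x i : ℝ))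
  simp only [Complex.ofReal_intCast] at this
  simp_rw [this]
  exact (L.summable_gaussian ht _).mul_left _

end EvenLattice

/-! ### Lipschitz's formula with a shift -/

theorem integrableOn_pow_mul_cexp_neg_mul {s : ℂ} (hs : 0 < s.re) (n : ℕ) :
    IntegrableOn (fun x : ℝ => (x : ℂ) ^ n * Complex.exp (-(s * x))) (Ioi 0) := by
  have h := integrableOn_rpow_mul_exp_neg_mul_rpow (s := n) (p := 1) (b := s.re)
    (by have : (0 : ℝ) ≤ n := n.cast_nonneg
        linarith) one_pos hs
  refine Integrable.mono' h (Continuous.aestronglyMeasurable (by fun_prop)) ?_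
  filter_upwards [ae_restrict_mem measurableSet_Ioi] with x hx
  have hx' : (0 : ℝ) < x := hx
  rw [norm_mul, norm_pow, Complex.norm_real, Complex.norm_exp, Real.norm_of_nonneg hx'.le]
  simp

theorem integral_pow_mul_cexp_neg_mul {s : ℂ} (hs : 0 < s.re) (n : ℕ) :
    ∫ x : ℝ in Ioi 0, (x : ℂ) ^ n * Complex.exp (-(s * x)) = n.factorial / s ^ (n + 1) := by
  have hs0 : s ≠ 0 := by rintro rfl; simp at hs
  induction n with
  | zero =>
    have := integral_exp_mul_complex_Ioi (a := -s) (by simpa using hs) 0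
    simpa using this
  | succ n ih =>
    have hd : ∀ x ∈ Ici (0 : ℝ), HasDerivAt
        (fun x : ℝ => (x : ℂ) ^ (n + 1) * Complex.exp (-(s * x)))
        ((n + 1 : ℂ) * ((x : ℂ) ^ n * Complex.exp (-(s * x))) -
          s * ((x : ℂ) ^ (n + 1) * Complex.exp (-(s * x)))) x := by
      intro x _
      have h1 : HasDerivAt (fun x : ℝ => (x : ℂ)) 1 x := Complex.ofRealCLM.hasDerivAt
      have h2 := (h1.pow (n + 1)).mul ((h1.const_mul s).neg.cexp)
      refine HasDerivAt.congr_deriv h2 ?_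
      simp
      ring
    have ht : Filter.Tendsto (fun x : ℝ => (x : ℂ) ^ (n + 1) * Complex.exp (-(s * x)))
        Filter.atTop (nhds 0) := by
      rw [tendsto_zero_iff_norm_tendsto_zero]
      refine (tendsto_rpow_mul_exp_neg_mul_atTop_nhds_zero (n + 1) s.re hs).congr' ?_
      filter_upwards [Filter.eventually_gt_atTop 0] with x hx
      rw [norm_mul, norm_pow, Complex.norm_real, Complex.norm_exp, Real.norm_of_nonneg hx.le]
      simp [← Real.rpow_natCast]
    have hi0 := (integrableOn_pow_mul_cexp_neg_mul hs n).const_mul (n + 1 : ℂ)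
    have hi1 := (integrableOn_pow_mul_cexp_neg_mul hs (n + 1)).const_mul s
    have h := integral_Ioi_of_hasDerivAt_of_tendsto' hd (hi0.sub hi1) ht
    rw [integral_sub hi0 hi1, integral_const_mul, integral_const_mul, ih] at h
    simp only [Complex.ofReal_zero, ne_eq, Nat.add_eq_zero_iff, one_ne_zero, and_false,
      not_false_eq_true, zero_pow, zero_mul, sub_self] at h
    rw [eq_div_iff (pow_ne_zero _ hs0)]
    rw [sub_eq_zero] at h
    rw [pow_succ', ← mul_assoc, mul_comm _ s, ← h, Nat.factorial_succ]
    push_cast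
    field_simp

/-- Half of the exponential decay absorbs the power; the other half is kept for summation. -/
theorem max_pow_mul_exp_le {n : ℕ} (hn : n ≠ 0) {b : ℝ} (hb : 0 < b) (x : ℝ) :
    (max x 0) ^ n * Real.exp (-(2 * b * x)) ≤ n.factorial / b ^ n * Real.exp (-(b * |x|)) := by
  rcases le_total x 0 with hx | hx
  · rw [max_eq_right hx, zero_pow hn, zero_mul]
    positivity
  · rw [max_eq_left hx, abs_of_nonneg hx]
    have h := Real.pow_div_factorial_le_exp (b * x) (by positivity) n
    have e : Real.exp (-(b * x)) = Real.exp (b * x) * Real.exp (-(2 * b * x)) := by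
      rw [← Real.exp_add]; congr 1; ring
    rw [e, ← mul_assoc]
    gcongr
    rw [div_le_iff₀ (by positivity), mul_pow] at h
    rw [div_mul_eq_mul_div, le_div_iff₀ (by positivity)]
    linarith

/-- The terms of the right hand side of Lipschitz's formula. -/
noncomputable def lipschitzTerm (n : ℕ) (μ : ℝ) (σ : ℂ) (x : ℝ) : ℂ :=
  ((max (x - μ) 0 : ℝ) : ℂ) ^ n * Complex.exp (2 * Real.pi * Complex.I * x * σ)

/-- The dependence on `μ` is kept explicit because `μ = (l,l)/2` will vary over `L^∨`: the first
factor is the decay of the dual theta term, and the rest depends only on the distance to `μ`. -/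
theorem norm_lipschitzTerm_le {n : ℕ} (hn : n ≠ 0) (μ : ℝ) {σ : ℂ} (hσ : 0 < σ.im) (x : ℝ) :
    ‖lipschitzTerm n μ σ x‖ ≤ Real.exp (-(2 * Real.pi * σ.im * μ)) *
      (n.factorial / (Real.pi * σ.im) ^ n * Real.exp (-(Real.pi * σ.im * |x - μ|))) := by
  have h := max_pow_mul_exp_le hn (b := Real.pi * σ.im) (by positivity) (x - μ)
  have e : ‖lipschitzTerm n μ σ x‖ = Real.exp (-(2 * Real.pi * σ.im * μ)) *
      ((max (x - μ) 0) ^ n * Real.exp (-(2 * (Real.pi * σ.im) * (x - μ)))) := by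
    rw [lipschitzTerm, norm_mul, norm_pow, Complex.norm_real, Complex.norm_exp,
      Real.norm_of_nonneg (le_max_right _ _), mul_left_comm, ← Real.exp_add]
    congr 2
    simp
    ring
  rw [e]
  gcongr

theorem continuous_lipschitzTerm (n : ℕ) (μ : ℝ) (σ : ℂ) : Continuous (lipschitzTerm n μ σ) := by
  unfold lipschitzTerm
  fun_prop

theorem lipschitzTerm_isBigO {n : ℕ} (hn : n ≠ 0) (μ : ℝ) {σ : ℂ} (hσ : 0 < σ.im) :
    lipschitzTerm n μ σ =O[Filter.cocompact ℝ] fun x : ℝ => |x| ^ (-2 : ℝ) := by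
  set b := Real.pi * σ.im with hb
  have hbp : 0 < b := by positivity
  refine Asymptotics.IsBigO.of_bound (Real.exp (-(2 * Real.pi * σ.im * μ)) *
    (n.factorial / b ^ n) * Real.exp (b * |μ|) * (2 / b ^ 2)) ?_
  filter_upwards [(tendsto_norm_cocompact_atTop (E := ℝ)).eventually
    (Filter.eventually_gt_atTop 0)] with x hx
  rw [Real.norm_eq_abs] at hx
  refine (norm_lipschitzTerm_le hn μ hσ x).trans ?_
  rw [Real.norm_of_nonneg (by positivity), ← hb]
  simp only [mul_assoc]
  gcongr
  have h1 : Real.exp (-(b * |x - μ|)) ≤ Real.exp (b * |μ|) * Real.exp (-(b * |x|)) := by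
    rw [← Real.exp_add, Real.exp_le_exp]
    have := abs_sub_abs_le_abs_sub x μ
    nlinarith
  refine h1.trans ?_
  gcongr
  have h2 := Real.pow_div_factorial_le_exp (b * |x|) (by positivity) 2
  rw [Real.exp_neg, Real.rpow_neg hx.le]
  have h3 : (0 : ℝ) < (b * |x|) ^ 2 / (Nat.factorial 2) := by positivity
  refine (inv_anti₀ h3 h2).trans (le_of_eq ?_)
  have hx0 : x ≠ 0 := abs_pos.1 hx
  norm_num
  field_simp
  rw [sq_abs]

/-- After translation by `μ` this is the Gamma integral with `s = -2πi(σ - r)`. The condition `n ≠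
0` is what makes the truncated power vanish to the left of `μ`, since `0 ^ 0 = 1`. -/
theorem fourier_lipschitzTerm {n : ℕ} (hn : n ≠ 0) (μ : ℝ) {σ : ℂ} (hσ : 0 < σ.im) (r : ℝ) :
    FourierTransform.fourier (lipschitzTerm n μ σ) r =
      Complex.exp (2 * Real.pi * Complex.I * μ * (σ - r)) *
        (n.factorial / (-2 * Real.pi * Complex.I * (σ - r)) ^ (n + 1)) := by
  have hs : 0 < (-2 * Real.pi * Complex.I * (σ - r)).re := by
    simp
    positivity
  rw [Real.fourier_real_eq_integral_exp_smul, ← integral_pow_mul_cexp_neg_mul hs,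
    ← integral_const_mul, ← integral_add_right_eq_self _ μ, ← integral_indicator measurableSet_Ioi]
  congr 1
  funext x
  by_cases hx : x ∈ Ioi (0 : ℝ)
  · have hx' : (0 : ℝ) < x := hx
    rw [indicator_of_mem hx, lipschitzTerm, add_sub_cancel_right, max_eq_left hx'.le, smul_eq_mul,
      mul_left_comm, mul_left_comm (Complex.exp _) _ (Complex.exp _), ← Complex.exp_add,
      ← Complex.exp_add]
    congr 2
    push_cast
    ring
  · have hx' : x ≤ 0 := not_lt.1 hx
    rw [indicator_of_notMem hx, lipschitzTerm, add_sub_cancel_right, max_eq_right hx']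
    simp [hn]

theorem summable_norm_add_intCast_zpow (σ : ℂ) {κ : ℕ} (hκ : 2 ≤ κ) :
    Summable fun r : ℤ => ‖(σ + r) ^ (-(κ : ℤ))‖ := by
  have h := (EisensteinSeries.linear_right_summable σ 1 (k := κ) (by exact_mod_cast hκ)).norm
  refine h.congr fun r => ?_
  simp

/-- Lipschitz's formula with a shift. -/
theorem tsum_add_intCast_zpow_mul_exp {n : ℕ} (hn : n ≠ 0) (μ : ℝ) {σ : ℂ} (hσ : 0 < σ.im) :
    ∑' r : ℤ, (σ + r) ^ (-((n + 1 : ℕ) : ℤ)) *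
        Complex.exp (2 * Real.pi * Complex.I * μ * (σ + r)) =
      (-2 * Real.pi * Complex.I) ^ (n + 1) / n.factorial *
        ∑' m : ℤ, lipschitzTerm n μ σ m := by
  have hpi : (-2 * Real.pi * Complex.I : ℂ) ≠ 0 := by
    simp [Real.pi_ne_zero]
  have hf : (n.factorial : ℂ) ≠ 0 := by exact_mod_cast n.factorial_ne_zero
  -- The transform at frequency `r` is the summand at `-r`; the sign is undone at the end by
  -- reindexing. The exponential of `2πiμ(σ + r)` is the phase caused by the shift.
  have e : ∀ r : ℤ, FourierTransform.fourier (lipschitzTerm n μ σ) (r : ℝ) =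
      n.factorial / (-2 * Real.pi * Complex.I) ^ (n + 1) *
      ((σ + (-r : ℤ)) ^ (-((n + 1 : ℕ) : ℤ)) *
        Complex.exp (2 * Real.pi * Complex.I * μ * (σ + (-r : ℤ)))) := by
    intro r
    rw [fourier_lipschitzTerm hn μ hσ, mul_pow, zpow_neg, zpow_natCast]
    push_cast
    rw [← sub_eq_add_neg]
    field_simp
  have hs0 : Summable fun r : ℤ => (σ + r) ^ (-((n + 1 : ℕ) : ℤ)) *
      Complex.exp (2 * Real.pi * Complex.I * μ * (σ + r)) := by
    refine Summable.of_norm_bounded ((summable_norm_add_intCast_zpow σ (κ := n + 1)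
      (by omega)).mul_right (Real.exp (-(2 * Real.pi * μ * σ.im)))) fun r => ?_
    rw [norm_mul, Complex.norm_exp]
    refine le_of_eq ?_
    congr 2
    simp
  have hs : Summable fun r : ℤ => FourierTransform.fourier (lipschitzTerm n μ σ) (r : ℝ) := by
    simp_rw [e]
    exact (((Equiv.neg ℤ).summable_iff).2 hs0).mul_left _
  have h := Real.tsum_eq_tsum_fourier_of_rpow_decay_of_summable (continuous_lipschitzTerm n μ σ)
    one_lt_two (lipschitzTerm_isBigO hn μ hσ) hs 0
  simp only [zero_add, QuotientAddGroup.mk_zero, fourier_eval_zero, mul_one] at h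
  rw [h]
  simp_rw [e]
  rw [tsum_mul_left, ← mul_assoc, div_mul_div_cancel₀ hf, div_self (pow_ne_zero _ hpi), one_mul]
  exact ((Equiv.neg ℤ).tsum_eq (fun r : ℤ => (σ + r) ^ (-((n + 1 : ℕ) : ℤ)) *
      Complex.exp (2 * Real.pi * Complex.I * μ * (σ + r)))).symm

/-- A family of two-sided exponential series is summable if it is bounded by a summable family of
constants. -/
theorem summable_prod_exp_neg_abs_sub {ι : Type*} {A : ι → ℝ} (hA : Summable A) (h0 : ∀ i, 0 ≤ A i)
    (μ : ι → ℝ) {b : ℝ} (hb : 0 < b) :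
    Summable fun p : ι × ℤ => A p.1 * Real.exp (-(b * |(p.2 : ℝ) - μ p.1|)) := by
  have h1 : Summable fun n : ℤ => Real.exp (-(b * |(n : ℝ)|)) := by
    have h : Summable fun n : ℕ => Real.exp (-(b * n)) := by
      have := Real.summable_exp_nat_mul_iff.2 (neg_neg_of_pos hb)
      refine this.congr fun n => ?_
      congr 1
      ring
    refine Summable.of_nat_of_neg ?_ ?_ <;> simpa using h
  -- Translating the integers by `⌊μ i⌋` moves the centre into `[0, 1)`, at the cost of a factor at
  -- most `exp b` uniform in `i`.
  have h2 := (hA.mul_of_nonneg h1 h0 fun n => (Real.exp_pos _).le).mul_left (Real.exp b)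
  have h3 := (Equiv.prodShear (Equiv.refl ι) fun i => Equiv.subRight ⌊μ i⌋).summable_iff.2 h2
  refine Summable.of_nonneg_of_le (fun p => mul_nonneg (h0 _) (Real.exp_pos _).le) (fun p => ?_) h3
  simp only [Function.comp_apply, Equiv.prodShear_apply, Equiv.refl_apply, Equiv.subRight_apply]
  rw [mul_left_comm]
  refine mul_le_mul_of_nonneg_left ?_ (h0 _)
  rw [← Real.exp_add, Real.exp_le_exp]
  have h4 : |((p.2 - ⌊μ p.1⌋ : ℤ) : ℝ)| ≤ |(p.2 : ℝ) - μ p.1| + 1 := by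
    push_cast
    have h5 : |μ p.1 - ⌊μ p.1⌋| ≤ 1 := by
      rw [abs_of_nonneg (by linarith [Int.floor_le (μ p.1)])]
      linarith [Int.lt_floor_add_one (μ p.1)]
    calc |(p.2 : ℝ) - ⌊μ p.1⌋| = |((p.2 : ℝ) - μ p.1) + (μ p.1 - ⌊μ p.1⌋)| := by ring_nf
      _ ≤ _ := (abs_add_le _ _).trans (by gcongr)
  nlinarith

/-! ### The stabilizer of 1 and its cosets -/

namespace EvenLattice

variable {N : ℕ} (L : EvenLattice N)

theorem slash_one_apply (k : ℕ) (g : JacobiGroup N) (τ : ℍ) (z : Fin N → ℂ) :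
    L.slash k 1 (fun _ _ => 1) g τ z =
      ((g.right 1 0 : ℂ) * τ + (g.right 1 1 : ℂ)) ^ (-(k : ℤ)) *
      Complex.exp (Real.pi * Complex.I *
        (-((g.right 1 0 : ℂ) * L.form z z / ((g.right 1 0 : ℂ) * τ + (g.right 1 1 : ℂ))) +
        ((L.form g.left.toAdd.1 g.left.toAdd.1 : ℤ) * ((g.right • τ : ℍ) : ℂ) +
          2 * (((g.right 1 0 : ℂ) * τ + (g.right 1 1 : ℂ))⁻¹ *
            L.form (fun i => (g.left.toAdd.1 i : ℂ)) z)))) := by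
  simp only [slash, slashSL, slashPair, mul_one, form_smul_right, form_intCast, Nat.cast_one]
  rw [mul_assoc, ← Complex.exp_add]
  congr 2
  ring

/-- Completing the square, by means of `Aτ = a/c - 1/(c(cτ+d))`. The dependence on `z` now sits in a
Gaussian centred at `x/c`, beside a phase of modulus one. -/
theorem slash_one_apply_of_ne_zero (k : ℕ) (g : JacobiGroup N) (hc : g.right 1 0 ≠ 0) (τ : ℍ)
    (z : Fin N → ℂ) :
    L.slash k 1 (fun _ _ => 1) g τ z =
      ((g.right 1 0 : ℂ) * τ + (g.right 1 1 : ℂ)) ^ (-(k : ℤ)) *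
      Complex.exp (Real.pi * Complex.I * ((g.right 0 0 : ℂ) *
        (L.form g.left.toAdd.1 g.left.toAdd.1 : ℤ) / (g.right 1 0 : ℂ))) *
      Complex.exp (-(Real.pi * (Complex.I * ((g.right 1 0 : ℂ) /
        ((g.right 1 0 : ℂ) * τ + (g.right 1 1 : ℂ)))) *
        L.form (z - (g.right 1 0 : ℂ)⁻¹ • fun i => (g.left.toAdd.1 i : ℂ))
          (z - (g.right 1 0 : ℂ)⁻¹ • fun i => (g.left.toAdd.1 i : ℂ)))) := by
  have hj := autFactor_ne_zero g.right τ
  have h1 := coe_smul_mul g.right τ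
  have hdet := det_cast g.right
  have hc' : (g.right 1 0 : ℂ) ≠ 0 := by exact_mod_cast hc
  rw [slash_one_apply, mul_assoc (_ ^ (-(k : ℤ))), ← Complex.exp_add]
  congr 2
  rw [← form_intCast, sub_eq_add_neg]
  simp only [form_add_left, form_add_right, ← neg_smul, form_smul_left, form_smul_right]
  generalize (fun i => (g.left.toAdd.1 i : ℂ)) = X at *
  rw [L.form_comm z X]
  generalize ((g.right • τ : ℍ) : ℂ) = σ at *
  generalize ((g.right 0 0 : ℤ) : ℂ) = a at *
  generalize ((g.right 0 1 : ℤ) : ℂ) = b at *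
  generalize ((g.right 1 0 : ℤ) : ℂ) = c at *
  generalize ((g.right 1 1 : ℤ) : ℂ) = d at *
  generalize hjj : c * (τ : ℂ) + d = j at *
  have h2 : σ = a / c - 1 / (c * j) := by
    field_simp
    linear_combination c * h1 - a * hjj.symm - hdet
  rw [h2]
  field_simp
  ring

/-- If `c ≠ 0`, then at `z = x/c` only a phase times `(cτ+d)^{-k}` survives, which is not of modulus
one for suitable `τ`. If `c = 0`, the modulus at `z = 0` forces `(x,x) = 0`. Conversely `d = ±1`,
and the sign disappears because `k` is even. -/
theorem mem_stabOne_iff {k : ℕ} (hk : Even k) (hk0 : k ≠ 0) (g : JacobiGroup N) :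
    g ∈ L.stabOne k 1 ↔ g.left.toAdd.1 = 0 ∧ g.right 1 0 = 0 := by
  have hdef : g ∈ L.stabOne k 1 ↔ L.slash k 1 (fun _ _ => 1) g = fun _ _ => 1 := Iff.rfl
  rw [hdef]
  constructor
  · intro h
    have hc : g.right 1 0 = 0 := by
      by_contra hc
      have hc' : (g.right 1 0 : ℂ) ≠ 0 := by exact_mod_cast hc
      -- At `2i` the imaginary part alone gives `|cτ + d| ≥ 2|c| > 1`.
      let τ : ℍ := ⟨2 * Complex.I, by simp⟩
      have hτ : (τ : ℂ) = 2 * Complex.I := rfl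
      have h1 := congrFun (congrFun h τ) ((g.right 1 0 : ℂ)⁻¹ • fun i => (g.left.toAdd.1 i : ℂ))
      rw [L.slash_one_apply_of_ne_zero k g hc, sub_self] at h1
      have h0 : L.form (0 : Fin N → ℂ) 0 = 0 := by simp [form]
      rw [h0, mul_zero, neg_zero, Complex.exp_zero, mul_one] at h1
      have h2 := congrArg norm h1
      have h3 : (Real.pi * Complex.I * ((g.right 0 0 : ℂ) *
          (L.form g.left.toAdd.1 g.left.toAdd.1 : ℤ) / (g.right 1 0 : ℂ))) =
          ((Real.pi * ((g.right 0 0 : ℝ) *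
          (L.form g.left.toAdd.1 g.left.toAdd.1 : ℤ) / (g.right 1 0 : ℝ)) : ℝ) : ℂ) *
            Complex.I := by
        push_cast; ring
      rw [norm_mul, h3, Complex.norm_exp_ofReal_mul_I, mul_one, norm_one, norm_zpow, zpow_neg,
        zpow_natCast, inv_eq_one] at h2
      have h4 : 1 < ‖(g.right 1 0 : ℂ) * (τ : ℂ) + (g.right 1 1 : ℂ)‖ := by
        refine lt_of_lt_of_le ?_ (Complex.abs_im_le_norm _)
        have h5 : ((g.right 1 0 : ℂ) * (τ : ℂ) + (g.right 1 1 : ℂ)).im = g.right 1 0 * 2 := by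
          rw [hτ]; simp
        rw [h5, abs_mul]
        have h6 : (1 : ℝ) ≤ |(g.right 1 0 : ℝ)| := by exact_mod_cast Int.one_le_abs hc
        norm_num
        linarith
      exact (one_lt_pow₀ h4 hk0).ne' h2
    refine ⟨?_, hc⟩
    have h1 := congrFun (congrFun h UpperHalfPlane.I) 0
    rw [slash_one_apply] at h1
    have h0 : ∀ x, L.form x (0 : Fin N → ℂ) = 0 := by simp [form]
    have hdet := g.right.det_coe
    rw [Matrix.det_fin_two, hc, mul_zero, sub_zero] at hdet
    have hd : |g.right 1 1| = 1 := by
      rcases Int.eq_one_or_neg_one_of_mul_eq_one (by rwa [mul_comm] at hdet) with h | h <;>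
        simp [h]
    have hd' : ‖(g.right 1 1 : ℂ)‖ = 1 := by
      rw [Complex.norm_intCast]; exact_mod_cast hd
    rw [h0, h0, hc] at h1
    have h2 := congrArg norm h1
    simp only [Int.cast_zero, mul_zero, zero_mul, zero_add, zero_div, neg_zero, add_zero, norm_mul,
      norm_zpow, hd', one_zpow, one_mul, norm_one, Complex.norm_exp] at h2
    rw [Real.exp_eq_one_iff] at h2
    have h3 : (Real.pi * Complex.I * ((L.form g.left.toAdd.1 g.left.toAdd.1 : ℤ) *
        ((g.right • UpperHalfPlane.I : ℍ) : ℂ))).re =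
        -(Real.pi * ((L.form g.left.toAdd.1 g.left.toAdd.1 : ℤ) *
          (g.right • UpperHalfPlane.I : ℍ).im)) := by
      simp
    rw [h3] at h2
    have h4 : L.form g.left.toAdd.1 g.left.toAdd.1 = 0 := by
      have him := (g.right • UpperHalfPlane.I : ℍ).im_pos.ne'
      rw [neg_eq_zero, mul_eq_zero_iff_left Real.pi_ne_zero, mul_eq_zero_iff_right him] at h2
      exact_mod_cast h2
    obtain ⟨δ, hδ, hform⟩ := L.exists_form_ge
    have h5 := hform (fun i => (g.left.toAdd.1 i : ℝ))
    rw [form_intCast_real, h4, Int.cast_zero] at h5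
    have h6 : ‖fun i => (g.left.toAdd.1 i : ℝ)‖ = 0 := by
      by_contra hne
      have : 0 < ‖fun i => (g.left.toAdd.1 i : ℝ)‖ ^ 2 := by positivity
      nlinarith
    rw [norm_eq_zero] at h6
    funext i
    have h7 := congrFun h6 i
    simp only [Pi.zero_apply] at h7 ⊢
    exact_mod_cast h7
  · rintro ⟨hx, hc⟩
    funext τ z
    have hdet := g.right.det_coe
    rw [Matrix.det_fin_two, hc, mul_zero, sub_zero] at hdet
    have h1 : ((g.right 1 1 : ℤ) : ℂ) ^ (-(k : ℤ)) = 1 := by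
      rcases Int.eq_one_or_neg_one_of_mul_eq_one (by rwa [mul_comm] at hdet) with h | h
      · simp [h]
      · rw [h, zpow_neg, zpow_natCast]
        push_cast
        rw [hk.neg_one_pow, inv_one]
    rw [slash_one_apply, hx, hc]
    simp [form, h1]

/-- The bottom row of the matrix of `h g⁻¹` is `(c_h d_g - d_h c_g, d_h a_g - c_h b_g)`. When its
first entry vanishes, the second is the sign relating the two bottom rows, and the same sign must
relate the vectors `x`. The vectors `y` do not matter. -/
theorem rightRel_iff {k : ℕ} (hk : Even k) (hk0 : k ≠ 0) (g h : JacobiGroup N) :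
    QuotientGroup.rightRel (L.stabOne k 1) g h ↔
      h.right 1 0 * g.right 1 1 = h.right 1 1 * g.right 1 0 ∧
      h.left.toAdd.1 = (h.right 1 1 * g.right 0 0 - h.right 1 0 * g.right 0 1) •
        g.left.toAdd.1 := by
  rw [QuotientGroup.rightRel_apply, L.mem_stabOne_iff hk hk0]
  have e1 : (h * g⁻¹).right 1 0 = h.right 1 0 * g.right 1 1 - h.right 1 1 * g.right 1 0 := by
    rw [SemidirectProduct.mul_right, SemidirectProduct.inv_right,
      Matrix.SpecialLinearGroup.coe_mul, Matrix.SpecialLinearGroup.coe_inv, Matrix.adjugate_fin_two]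
    simp [Matrix.mul_apply, Fin.sum_univ_two]
    ring
  have e2 : (h * g⁻¹).right 1 1 = h.right 1 1 * g.right 0 0 - h.right 1 0 * g.right 0 1 := by
    rw [SemidirectProduct.mul_right, SemidirectProduct.inv_right,
      Matrix.SpecialLinearGroup.coe_mul, Matrix.SpecialLinearGroup.coe_inv, Matrix.adjugate_fin_two]
    simp [Matrix.mul_apply, Fin.sum_univ_two]
    ring
  have e3 : (h * g⁻¹).left.toAdd = h.left.toAdd - slActPair N (h * g⁻¹).right g.left.toAdd := by
    have : (h * g⁻¹).left = h.left * slAct N (h * g⁻¹).right g.left⁻¹ := by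
      rw [SemidirectProduct.mul_left, SemidirectProduct.inv_left, SemidirectProduct.mul_right,
        SemidirectProduct.inv_right, map_mul, MulAut.mul_apply]
    rw [this, map_inv]
    rfl
  rw [e1, sub_eq_zero, e3]
  refine ⟨fun ⟨h1, h2⟩ => ⟨h2, ?_⟩, fun ⟨h1, h2⟩ => ⟨?_, h1⟩⟩
  · rw [Prod.fst_sub, sub_eq_zero] at h1
    rw [h1, ← e2]
    simp only [slActPair]
    rw [e1, h2, sub_self, zero_smul, sub_zero]
  · rw [Prod.fst_sub, sub_eq_zero, h2, ← e2]
    simp only [slActPair]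
    rw [e1, h1, sub_self, zero_smul, sub_zero]

end EvenLattice

/-- Pairs `(c, d)` with `c ≥ 1` and `0 ≤ d < c` coprime to `c`. -/
abbrev ReducedFraction : Type := {p : ℕ+ × ℕ // p.2 < p.1 ∧ Nat.Coprime p.1 p.2}

namespace ReducedFraction

theorem isCoprime (p : ReducedFraction) (r : ℤ) :
    IsCoprime ((p.1.1 : ℕ) : ℤ) ((p.1.2 : ℤ) + (p.1.1 : ℕ) * r) :=
  (Nat.isCoprime_iff_coprime.2 p.2.2).add_mul_left_right r

/-- A matrix in `SL(2, ℤ)` with bottom row `(c, d + c r)`. -/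
noncomputable def toSL (p : ReducedFraction) (r : ℤ) : SL(2, ℤ) :=
  ((isCoprime p r).exists_SL2_row 1).choose

theorem toSL_one_zero (p : ReducedFraction) (r : ℤ) : toSL p r 1 0 = (p.1.1 : ℕ) :=
  ((isCoprime p r).exists_SL2_row 1).choose_spec.1

theorem toSL_one_one (p : ReducedFraction) (r : ℤ) :
    toSL p r 1 1 = (p.1.2 : ℤ) + (p.1.1 : ℕ) * r :=
  ((isCoprime p r).exists_SL2_row 1).choose_spec.2

end ReducedFraction

/-- Representatives of the cosets of the stabilizer of `1` in the Jacobi group. -/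
noncomputable def cosetRep {N : ℕ} : (Fin N → ℤ) ⊕ (ReducedFraction × ℤ) × (Fin N → ℤ) → JacobiGroup N
  | Sum.inl x => ⟨Multiplicative.ofAdd (x, 0), 1⟩
  | Sum.inr (p, x) => ⟨Multiplicative.ofAdd (x, 0), ReducedFraction.toSL p.1 p.2⟩

theorem eq_of_mul_eq_mul_of_isCoprime {a b c d : ℤ} (ha : 0 < a) (hc : 0 < c)
    (hab : IsCoprime a b) (hcd : IsCoprime c d) (h : c * b = d * a) : a = c ∧ b = d := by
  have h1 : a ∣ c := hab.dvd_of_dvd_mul_right ⟨d, by rw [h, mul_comm]⟩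
  have h2 : c ∣ a := hcd.dvd_of_dvd_mul_left ⟨b, h.symm⟩
  have h3 : a = c := Int.dvd_antisymm ha.le hc.le h1 h2
  subst h3
  exact ⟨rfl, mul_left_cancel₀ ha.ne' (by rw [h, mul_comm])⟩

theorem ReducedFraction.ext_of_eq {p q : ReducedFraction} {r s : ℤ}
    (hc : ((p.1.1 : ℕ) : ℤ) = (q.1.1 : ℕ))
    (hd : (p.1.2 : ℤ) + (p.1.1 : ℕ) * r = (q.1.2 : ℤ) + (q.1.1 : ℕ) * s) : (p, r) = (q, s) := by
  obtain ⟨⟨⟨c, d⟩, hp⟩, ⟨⟨c', d'⟩, hq⟩⟩ := p, q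
  have hcc : c = c' := PNat.coe_injective (by exact_mod_cast hc)
  subst hcc
  dsimp only at hp hq hd
  have h1 : ((d : ℤ) + (c : ℕ) * r) % (c : ℕ) = d := by
    rw [Int.add_mul_emod_self_left]
    exact Int.emod_eq_of_lt (by positivity) (by exact_mod_cast hp.1)
  have h2 : ((d' : ℤ) + (c : ℕ) * s) % (c : ℕ) = d' := by
    rw [Int.add_mul_emod_self_left]
    exact Int.emod_eq_of_lt (by positivity) (by exact_mod_cast hq.1)
  have h3 : d = d' := by
    rw [hd, h2] at h1
    exact_mod_cast h1.symm
  subst h3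
  have h4 : r = s := by
    have hc0 : ((c : ℕ) : ℤ) ≠ 0 := by exact_mod_cast c.ne_zero
    exact mul_left_cancel₀ hc0 (by linarith)
  rw [h4]

theorem ReducedFraction.exists_eq {c d : ℤ} (hc : 0 < c) (h : IsCoprime c d) :
    ∃ (p : ReducedFraction) (r : ℤ), ((p.1.1 : ℕ) : ℤ) = c ∧
      (p.1.2 : ℤ) + (p.1.1 : ℕ) * r = d := by
  lift c to ℕ using hc.le
  have hc' : 0 < c := by exact_mod_cast hc
  have h0 : 0 ≤ d % c := Int.emod_nonneg _ hc.ne'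
  have hd : ((d % c).toNat : ℤ) = d % c := Int.toNat_of_nonneg h0
  refine ⟨⟨(⟨c, hc'⟩, (d % c).toNat), ?_, ?_⟩, d / c, rfl, ?_⟩
  · have := Int.emod_lt_of_pos d hc
    rw [← hd] at this
    exact_mod_cast this
  · rw [← Nat.isCoprime_iff_coprime, hd]
    have := h.add_mul_left_right (-(d / c))
    have e : d + c * (-(d / c)) = d % c := by rw [Int.emod_def]; ring
    rwa [e] at this
  · change (((d % c).toNat : ℕ) : ℤ) + (c : ℤ) * (d / c) = d
    rw [hd]
    exact Int.emod_add_mul_ediv d c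

namespace EvenLattice

variable {N : ℕ} (L : EvenLattice N)

/-- The element `-1` of the stabilizer normalizes the bottom row to `c ≥ 1`, or to `(0, 1)`, while
negating `x`. The entry `d` of a row with `c ≥ 1` is then divided by `c` with remainder, which
separates the translations `r` needed for Lipschitz's formula. -/
theorem bijective_cosetRep {k : ℕ} (hk : Even k) (hk0 : k ≠ 0) :
    Function.Bijective fun i : (Fin N → ℤ) ⊕ (ReducedFraction × ℤ) × (Fin N → ℤ) =>
      (Quotient.mk (QuotientGroup.rightRel (L.stabOne k 1)) (cosetRep i)) := by
  have hdet : ∀ A : SL(2, ℤ), A 1 1 * A 0 0 - A 1 0 * A 0 1 = 1 := by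
    intro A
    have := A.det_coe
    rw [Matrix.det_fin_two] at this
    linarith
  constructor
  · intro i i' h
    have h' := (L.rightRel_iff hk hk0 _ _).1 (Quotient.exact h)
    rcases i with x | ⟨⟨p, r⟩, x⟩ <;> rcases i' with x' | ⟨⟨p', r'⟩, x'⟩
    · have h2 := h'.2
      simp [cosetRep] at h2
      rw [h2]
    · have h1 := h'.1
      simp [cosetRep, ReducedFraction.toSL_one_zero] at h1
    · have h1 := h'.1
      simp [cosetRep, ReducedFraction.toSL_one_zero] at h1
      exact (p.1.1.ne_zero (by exact_mod_cast h1.symm)).elim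
    · obtain ⟨h1, h2⟩ := h'
      simp only [cosetRep, ReducedFraction.toSL_one_zero, ReducedFraction.toSL_one_one] at h1
      obtain ⟨h3, h4⟩ := eq_of_mul_eq_mul_of_isCoprime (by exact_mod_cast p.1.1.pos)
        (by exact_mod_cast p'.1.1.pos) (p.isCoprime r) (p'.isCoprime r') h1
      have h5 := ReducedFraction.ext_of_eq h3 h4
      rw [Prod.mk.injEq] at h5
      obtain ⟨rfl, rfl⟩ := h5
      simp only [cosetRep] at h2
      rw [hdet, one_smul] at h2
      have h6 : x' = x := h2
      rw [h6]
  · intro q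
    induction q using Quotient.inductionOn with
    | h g =>
    suffices ∃ i, QuotientGroup.rightRel (L.stabOne k 1) (cosetRep i) g by
      obtain ⟨i, hi⟩ := this
      exact ⟨i, Quotient.sound hi⟩
    simp_rw [L.rightRel_iff hk hk0]
    have hd := hdet g.right
    have hcop : IsCoprime (g.right 1 0) (g.right 1 1) :=
      ⟨-g.right 0 1, g.right 0 0, by linarith⟩
    rcases lt_trichotomy (g.right 1 0) 0 with hc | hc | hc
    · obtain ⟨p, r, h1, h2⟩ := ReducedFraction.exists_eq (neg_pos.2 hc) hcop.neg_neg
      refine ⟨Sum.inr ((p, r), -g.left.toAdd.1), ?_, ?_⟩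
      · simp only [cosetRep, ReducedFraction.toSL_one_zero, ReducedFraction.toSL_one_one]
        rw [h2, h1]
        ring
      · have h3 := hdet (p.toSL r)
        rw [ReducedFraction.toSL_one_zero, ReducedFraction.toSL_one_one, h2, h1] at h3
        have h4 : g.right 1 1 * p.toSL r 0 0 - g.right 1 0 * p.toSL r 0 1 = -1 := by linarith
        simp only [cosetRep, h4]
        simp
    · have h1 : g.right 1 1 * g.right 1 1 = 1 := by
        rw [hc, zero_mul, sub_zero] at hd
        rcases Int.eq_one_or_neg_one_of_mul_eq_one hd with h | h <;> simp [h]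
      refine ⟨Sum.inl (g.right 1 1 • g.left.toAdd.1), ?_, ?_⟩
      · simp [cosetRep, hc]
      · simp [cosetRep, hc]
        rw [← mul_assoc, ← Int.cast_mul, h1, Int.cast_one, one_mul]
    · obtain ⟨p, r, h1, h2⟩ := ReducedFraction.exists_eq hc hcop
      refine ⟨Sum.inr ((p, r), g.left.toAdd.1), ?_, ?_⟩
      · simp only [cosetRep, ReducedFraction.toSL_one_zero, ReducedFraction.toSL_one_one]
        rw [h2, h1]
        ring
      · have h3 := hdet (p.toSL r)
        rw [ReducedFraction.toSL_one_zero, ReducedFraction.toSL_one_one, h2, h1] at h3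
        simp only [cosetRep, h3]
        simp

/-- The cosets of the stabilizer of `1` in the Jacobi group. -/
noncomputable def cosetEquiv {k : ℕ} (hk : Even k) (hk0 : k ≠ 0) :
    (Fin N → ℤ) ⊕ (ReducedFraction × ℤ) × (Fin N → ℤ) ≃
      Quotient (QuotientGroup.rightRel (L.stabOne k 1)) :=
  Equiv.ofBijective _ (L.bijective_cosetRep hk hk0)

end EvenLattice

/-! ### Absolute convergence -/

/-- The automorphy factor `c τ + d + c r`. -/
noncomputable def ReducedFraction.autFactor (q : ReducedFraction × ℤ) (τ : ℂ) : ℂ :=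
  ((q.1.1.1 : ℕ) : ℂ) * τ + ((q.1.1.2 : ℂ) + ((q.1.1.1 : ℕ) : ℂ) * q.2)

theorem ReducedFraction.autFactor_im (q : ReducedFraction × ℤ) (τ : ℂ) :
    (autFactor q τ).im = (q.1.1.1 : ℕ) * τ.im := by
  simp [autFactor]

theorem ReducedFraction.mul_im_le_norm_autFactor (q : ReducedFraction × ℤ) (τ : ℍ) :
    (q.1.1.1 : ℕ) * τ.im ≤ ‖autFactor q τ‖ := by
  have h := Complex.abs_im_le_norm (autFactor q τ)
  rw [autFactor_im] at h
  exact (le_abs_self _).trans h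

theorem ReducedFraction.norm_autFactor_pos (q : ReducedFraction × ℤ) (τ : ℍ) :
    0 < ‖autFactor q τ‖ := by
  refine lt_of_lt_of_le ?_ (mul_im_le_norm_autFactor q τ)
  have := q.1.1.1.pos
  have := τ.im_pos
  positivity

theorem ReducedFraction.summable_norm_autFactor {m : ℕ} (hm : 2 < m) (τ : ℍ) :
    Summable fun q : ReducedFraction × ℤ => (‖autFactor q τ‖ ^ m)⁻¹ := by
  let ι : ReducedFraction × ℤ → (Fin 2 → ℤ) :=
    fun q => ![((q.1.1.1 : ℕ) : ℤ), (q.1.1.2 : ℤ) + (q.1.1.1 : ℕ) * q.2]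
  have hι : Function.Injective ι := by
    rintro ⟨p, r⟩ ⟨p', r'⟩ h
    exact ReducedFraction.ext_of_eq (congrFun h 0) (congrFun h 1)
  have hm' : (2 : ℝ) < m := by exact_mod_cast hm
  have h := ((EisensteinSeries.summable_one_div_norm_rpow hm').comp_injective hι).mul_left
    ((EisensteinSeries.r τ) ^ (-(m : ℝ)))
  refine Summable.of_nonneg_of_le (fun _ => by positivity) (fun q => ?_) h
  have h1 := EisensteinSeries.summand_bound τ (k := m) (by positivity) (ι q)
  refine le_trans (le_of_eq ?_) h1
  rw [Real.rpow_neg (norm_nonneg _), Real.rpow_natCast]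
  simp [ι, autFactor]

namespace EvenLattice

variable {N : ℕ} (L : EvenLattice N)

theorem slash_cosetRep_inr (k : ℕ) (q : ReducedFraction × ℤ) (x : Fin N → ℤ) (τ : ℍ)
    (z : Fin N → ℂ) :
    L.slash k 1 (fun _ _ => 1) (cosetRep (Sum.inr (q, x))) τ z =
      ReducedFraction.autFactor q τ ^ (-(k : ℤ)) *
      Complex.exp (Real.pi * Complex.I * ((q.1.toSL q.2 0 0 : ℂ) * (L.form x x : ℤ) /
        ((q.1.1.1 : ℕ) : ℂ))) *
      Complex.exp (-(Real.pi * (Complex.I * (((q.1.1.1 : ℕ) : ℂ) / ReducedFraction.autFactor q τ)) *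
        L.form (z - ((q.1.1.1 : ℕ) : ℂ)⁻¹ • fun i => (x i : ℂ))
          (z - ((q.1.1.1 : ℕ) : ℂ)⁻¹ • fun i => (x i : ℂ)))) := by
  have hc : (cosetRep (Sum.inr (q, x))).right 1 0 ≠ 0 := by
    simp [cosetRep, ReducedFraction.toSL_one_zero]
  rw [L.slash_one_apply_of_ne_zero k _ hc]
  simp [cosetRep, ReducedFraction.toSL_one_zero, ReducedFraction.toSL_one_one,
    ReducedFraction.autFactor]

/-- The real part of the exponent is a real quadratic form in `Re z` and `Im z`; the square is
completed in `Re z`, so that only the last factor changes under real translations. -/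
theorem norm_exp_form {t : ℂ} (ht : t.re ≠ 0) (z : Fin N → ℂ) :
    ‖Complex.exp (-(Real.pi * t * L.form z z))‖ =
      Real.exp (Real.pi * (Complex.normSq t / t.re) *
        L.form (fun i => (z i).im) (fun i => (z i).im)) *
      Real.exp (-(Real.pi * t.re * L.form (fun i => (z i).re - t.im / t.re * (z i).im)
        (fun i => (z i).re - t.im / t.re * (z i).im))) := by
  rw [Complex.norm_exp, ← Real.exp_add]
  congr 1
  have hz : z = (fun i => ((z i).re : ℂ)) + Complex.I • fun i => ((z i).im : ℂ) := by
    funext i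
    simp [mul_comm Complex.I, Complex.re_add_im]
  have hq : (fun i => (z i).re - t.im / t.re * (z i).im) =
      (fun i => (z i).re) + (-(t.im / t.re)) • fun i => (z i).im := by
    funext i
    simp
    ring
  rw [hq]
  have hzz : L.form z z = (L.form (fun i => (z i).re) (fun i => (z i).re) -
      L.form (fun i => (z i).im) (fun i => (z i).im) : ℝ) +
      (2 * L.form (fun i => (z i).re) (fun i => (z i).im) : ℝ) * Complex.I := by
    conv_lhs => rw [hz]
    simp only [form_add_left, form_add_right, form_smul_left, form_smul_right]
    rw [L.form_comm (fun i => ((z i).im : ℂ)) (fun i => ((z i).re : ℂ))]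
    simp only [form_ofReal]
    push_cast
    linear_combination ((L.form (fun i => (z i).im) (fun i => (z i).im) : ℝ) : ℂ) * Complex.I_sq
  rw [hzz]
  simp only [form_add_left, form_add_right, form_smul_left, form_smul_right]
  rw [L.form_comm (fun i => (z i).im) (fun i => (z i).re), Complex.normSq_apply]
  simp
  field_simp
  ring

/-- By inversion the sum is `s^{-N/2}/vol(L)` times a dual theta series. Real translations `w` only
produce phases there, and `s⁻¹ ≥ Y⁻¹` makes its terms at most those at `Y⁻¹`; hence a constant
uniform in `s` and `w`. -/
theorem exists_tsum_exp_form_le (hN : Even N) {Y : ℝ} (hY : 0 < Y) :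
    ∃ C : ℝ, 0 ≤ C ∧ ∀ s : ℝ, 0 < s → s ≤ Y → ∀ w : Fin N → ℝ,
      (Summable fun x : Fin N → ℤ => Real.exp (-(Real.pi * s *
        L.form (w + fun i => (x i : ℝ)) (w + fun i => (x i : ℝ))))) ∧
      ∑' x : Fin N → ℤ, Real.exp (-(Real.pi * s *
        L.form (w + fun i => (x i : ℝ)) (w + fun i => (x i : ℝ)))) ≤ C * s⁻¹ ^ (N / 2) := by
  have hYinv : 0 < ((Y⁻¹ : ℝ) : ℂ).re := by simpa using hY
  have hsY := (L.summable_dualThetaTerm hYinv 0).norm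
  refine ⟨L.vol⁻¹ * ∑' l, ‖L.dualThetaTerm ((Y⁻¹ : ℝ) : ℂ) 0 l‖,
    mul_nonneg (inv_nonneg.2 L.vol_pos.le) (tsum_nonneg fun _ => norm_nonneg _), ?_⟩
  intro s hs hsYle w
  have hsre : 0 < ((s : ℝ) : ℂ).re := by simpa using hs
  have hnorm : ∀ (u : ℝ) (v : Fin N → ℝ) (l : L.dual),
      ‖L.dualThetaTerm (u : ℂ) (fun i => (v i : ℂ)) l‖ =
        Real.exp (-(Real.pi * u * (L.form (l : Fin N → ℚ) l : ℚ))) := by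
    intro u v l
    have e := L.form_ofReal (fun i => ((l : Fin N → ℚ) i : ℝ)) v
    simp only [Complex.ofReal_ratCast] at e
    rw [dualThetaTerm, Complex.norm_exp, e]
    congr 1
    simp
  have hterm : ∀ x : Fin N → ℤ, Complex.exp (-(Real.pi * (s : ℂ) *
      L.form ((fun i => (w i : ℂ)) + fun i => (x i : ℂ))
        ((fun i => (w i : ℂ)) + fun i => (x i : ℂ)))) =
      ((Real.exp (-(Real.pi * s * L.form (w + fun i => (x i : ℝ)) (w + fun i => (x i : ℝ)))) : ℝ) :
        ℂ) := by
    intro x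
    have e := L.form_ofReal (w + fun i => (x i : ℝ)) (w + fun i => (x i : ℝ))
    have e2 : (fun i => (((w + fun i => (x i : ℝ)) i : ℝ) : ℂ)) =
        (fun i => (w i : ℂ)) + fun i => (x i : ℂ) := by
      funext i; simp
    rw [e2] at e
    rw [e]
    push_cast
    rfl
  have h1 := L.tsum_exp_form_add hN hsre (fun i => (w i : ℂ))
  have h2 := L.summable_exp_form_add hsre (fun i => (w i : ℂ))
  simp_rw [hterm] at h1 h2
  have h3 := Complex.summable_ofReal.1 h2
  refine ⟨h3, ?_⟩
  rw [← Complex.ofReal_tsum] at h1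
  have h4 := congrArg norm h1
  rw [Complex.norm_real, Real.norm_of_nonneg (tsum_nonneg fun _ => (Real.exp_pos _).le)] at h4
  rw [h4, norm_mul, norm_mul, norm_inv, norm_pow, norm_inv, Complex.norm_real, Complex.norm_real,
    Real.norm_of_nonneg L.vol_pos.le, Real.norm_of_nonneg hs.le, mul_right_comm]
  gcongr
  · exact inv_nonneg.2 L.vol_pos.le
  rw [← Complex.ofReal_inv]
  have hsinv : 0 < ((s⁻¹ : ℝ) : ℂ).re := by simpa using hs
  refine (norm_tsum_le_tsum_norm (L.summable_dualThetaTerm hsinv _).norm).trans ?_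
  refine Summable.tsum_le_tsum (fun l => ?_) (L.summable_dualThetaTerm hsinv _).norm hsY
  have e0 : (0 : Fin N → ℂ) = fun i => (((0 : Fin N → ℝ) i : ℝ) : ℂ) := by funext i; simp
  rw [hnorm, e0, hnorm, Real.exp_le_exp, neg_le_neg_iff]
  have hnn : (0 : ℝ) ≤ (L.form (l : Fin N → ℚ) l : ℚ) := by
    obtain ⟨δ, hδ, hform⟩ := L.exists_form_ge
    have := hform (fun i => ((l : Fin N → ℚ) i : ℝ))
    rw [form_ratCast_real] at this
    exact le_trans (by positivity) this
  gcongr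

/-- For fixed `(c, d)` the absolute values form `|j|^{-k}` times a real theta sum with parameter `s
= Im τ/|j|²`, where `j = cτ + d`. This is `O(|j|^{N-k})`, and the sum over `(c, d)` converges as an
ordinary Eisenstein series of weight `k - N > 2`. -/
theorem summable_norm_slash_cosetRep_inr (hN : Even N) {k : ℕ} (hkN : N + 2 < k) (τ : ℍ)
    (z : Fin N → ℂ) :
    Summable fun i : (ReducedFraction × ℤ) × (Fin N → ℤ) =>
      ‖L.slash k 1 (fun _ _ => 1) (cosetRep (Sum.inr i)) τ z‖ := by
  have hy := τ.im_pos
  -- The parameter `s` never exceeds `1/Im τ`, because `|j| ≥ Im τ`.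
  obtain ⟨C, hC0, hC⟩ := L.exists_tsum_exp_form_le hN (inv_pos.2 hy)
  set V := Real.exp (Real.pi * τ.im⁻¹ * L.form (fun i => (z i).im) (fun i => (z i).im)) with hV
  have key : ∀ q : ReducedFraction × ℤ,
      ∃ w : Fin N → ℝ, ∀ x : Fin N → ℤ,
        ‖L.slash k 1 (fun _ _ => 1) (cosetRep (Sum.inr (q, x))) τ z‖ =
        (‖ReducedFraction.autFactor q τ‖ ^ k)⁻¹ * V * Real.exp (-(Real.pi * (τ.im / ‖ReducedFraction.autFactor q τ‖ ^ 2) *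
          L.form (w + fun i => (x i : ℝ)) (w + fun i => (x i : ℝ)))) := by
    intro q
    have hj := ReducedFraction.norm_autFactor_pos q τ
    have hj0 : ReducedFraction.autFactor q τ ≠ 0 := norm_pos_iff.1 hj
    have hc : (0 : ℝ) < (q.1.1.1 : ℕ) := by exact_mod_cast q.1.1.1.pos
    set c : ℝ := ((q.1.1.1 : ℕ) : ℝ) with hcdef
    have hcc : ((q.1.1.1 : ℕ) : ℂ) = (c : ℂ) := by simp [hcdef]
    set j := ReducedFraction.autFactor q τ with hjdef
    set t : ℂ := Complex.I * ((c : ℂ) / j) with ht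
    have htre : t.re = c ^ 2 * (τ.im / ‖j‖ ^ 2) := by
      have him : j.im = c * τ.im := ReducedFraction.autFactor_im q τ
      rw [ht, Complex.I_mul_re, Complex.div_im, Complex.ofReal_im, Complex.ofReal_re, him,
        Complex.normSq_eq_norm_sq]
      ring
    have htre0 : t.re ≠ 0 := by
      rw [htre]; positivity
    -- Independence of `(c, d)` makes the growth in `Im z` the common factor `V`.
    have htn : Complex.normSq t / t.re = τ.im⁻¹ := by
      rw [htre, ht, map_mul, Complex.normSq_I, one_mul, map_div₀, Complex.normSq_ofReal,
        Complex.normSq_eq_norm_sq]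
      have := hj.ne'
      field_simp
    -- Scaling by `-c` moves the lattice `c⁻¹ℤ^N` to `ℤ^N`; the resulting `c⁻²` cancels the `c²` in
    -- `Re t`.
    refine ⟨fun i => -c * ((z i).re - t.im / t.re * (z i).im), fun x => ?_⟩
    rw [slash_cosetRep_inr, norm_mul, norm_mul, hcc, ← hjdef, ← ht, L.norm_exp_form htre0, htn]
    have e1 : (Real.pi * Complex.I * ((q.1.toSL q.2 0 0 : ℂ) * (L.form x x : ℤ) / (c : ℂ))) =
        ((Real.pi * ((q.1.toSL q.2 0 0 : ℝ) * (L.form x x : ℤ) / c) : ℝ) : ℂ) * Complex.I := by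
      push_cast; ring
    rw [e1, Complex.norm_exp_ofReal_mul_I, mul_one, norm_zpow, zpow_neg, zpow_natCast]
    have e2 : (fun i => ((z - (c : ℂ)⁻¹ • fun i => (x i : ℂ)) i).im) = fun i => (z i).im := by
      funext i
      rw [Pi.sub_apply, Pi.smul_apply, Complex.sub_im, smul_eq_mul, ← Complex.ofReal_inv,
        Complex.im_ofReal_mul]
      simp
    have e3 : (fun i => ((z - (c : ℂ)⁻¹ • fun i => (x i : ℂ)) i).re - t.im / t.re *
        ((z - (c : ℂ)⁻¹ • fun i => (x i : ℂ)) i).im) =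
        (-c⁻¹) • ((fun i => -c * ((z i).re - t.im / t.re * (z i).im)) + fun i => (x i : ℝ)) := by
      funext i
      have := congrFun e2 i
      rw [this]
      rw [Pi.sub_apply, Pi.smul_apply, Complex.sub_re, smul_eq_mul, ← Complex.ofReal_inv,
        Complex.re_ofReal_mul]
      simp
      field_simp
      ring
    rw [e2, e3, form_smul_left, form_smul_right, ← hV, ← mul_assoc (‖j‖ ^ k)⁻¹]
    congr 3
    rw [htre]
    field_simp
  have hs : ∀ q : ReducedFraction × ℤ, 0 < τ.im / ‖ReducedFraction.autFactor q τ‖ ^ 2 ∧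
      τ.im / ‖ReducedFraction.autFactor q τ‖ ^ 2 ≤ τ.im⁻¹ := by
    intro q
    have hj := ReducedFraction.norm_autFactor_pos q τ
    refine ⟨by positivity, ?_⟩
    have h1 := ReducedFraction.mul_im_le_norm_autFactor q τ
    have hc : (1 : ℝ) ≤ (q.1.1.1 : ℕ) := by exact_mod_cast q.1.1.1.pos
    have h2 : τ.im ≤ ‖ReducedFraction.autFactor q τ‖ := le_trans (by nlinarith) h1
    rw [div_le_iff₀ (by positivity), ← div_eq_inv_mul, le_div_iff₀ hy]
    nlinarith
  rw [summable_prod_of_nonneg (fun _ => norm_nonneg _)]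
  constructor
  · intro q
    obtain ⟨w, hw⟩ := key q
    simp_rw [hw]
    exact ((hC _ (hs q).1 (hs q).2 w).1).mul_left _
  · refine Summable.of_nonneg_of_le (fun _ => tsum_nonneg fun _ => norm_nonneg _) (fun q => ?_)
      ((ReducedFraction.summable_norm_autFactor (m := k - N) (by omega) τ).mul_left
        (V * C * τ.im⁻¹ ^ (N / 2)))
    obtain ⟨w, hw⟩ := key q
    simp_rw [hw]
    rw [tsum_mul_left]
    have h1 := (hC _ (hs q).1 (hs q).2 w).2
    have hj := ReducedFraction.norm_autFactor_pos q τ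
    set j := ‖ReducedFraction.autFactor q τ‖
    calc _ ≤ (j ^ k)⁻¹ * V * (C * (τ.im / j ^ 2)⁻¹ ^ (N / 2)) := by gcongr
      _ = _ := by
        have h2 : k = (k - N) + 2 * (N / 2) := by
          obtain ⟨m, rfl⟩ := hN
          omega
        have h3 : (j ^ k)⁻¹ = (j ^ (k - N))⁻¹ * (j ^ (2 * (N / 2)))⁻¹ := by
          conv_lhs => rw [h2, pow_add, mul_inv]
        rw [h3, inv_div, div_pow, ← pow_mul, inv_pow]
        field_simp

theorem slash_cosetRep_inl (k : ℕ) (x : Fin N → ℤ) (τ : ℍ) (z : Fin N → ℂ) :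
    L.slash k 1 (fun _ _ => 1) (cosetRep (Sum.inl x)) τ z = L.thetaTerm 0 0 τ z x := by
  rw [slash_one_apply, thetaTerm, ← form_intCast]
  simp [cosetRep]

theorem thetaTerm_eq_gaussian (τ : ℍ) (z : Fin N → ℂ) (x : Fin N → ℤ) :
    L.thetaTerm 0 0 τ z x =
      L.gaussian (-Complex.I * τ) (-Complex.I • z) (fun i => (x i : ℝ)) := by
  rw [gaussian, thetaTerm, ← form_ofReal, form_smul_right]
  simp
  congr 1
  ring

theorem summable_thetaTerm (τ : ℍ) (z : Fin N → ℂ) : Summable (L.thetaTerm 0 0 τ z) := by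
  simp_rw [funext (L.thetaTerm_eq_gaussian τ z)]
  exact L.summable_gaussian (by simpa using τ.im_pos) _

theorem summable_slash_cosetRep (hN : Even N) {k : ℕ} (hkN : N + 2 < k) (τ : ℍ)
    (z : Fin N → ℂ) :
    Summable fun i : (Fin N → ℤ) ⊕ (ReducedFraction × ℤ) × (Fin N → ℤ) =>
      L.slash k 1 (fun _ _ => 1) (cosetRep i) τ z := by
  refine Summable.sum _ ?_ ?_
  · refine (L.summable_thetaTerm τ z).congr fun x => ?_
    rw [Function.comp_apply, slash_cosetRep_inl]
  · exact (L.summable_norm_slash_cosetRep_inr hN hkN τ z).of_norm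

theorem summable_eisensteinTerm (hN : Even N) {k : ℕ} (hk : Even k) (hkN : N + 2 < k) (τ : ℍ)
    (z : Fin N → ℂ) : Summable fun q => L.eisensteinTerm k 1 q τ z := by
  rw [← (L.cosetEquiv hk (by omega : k ≠ 0)).summable_iff]
  exact L.summable_slash_cosetRep hN hkN τ z

theorem eisenstein_eq (hN : Even N) {k : ℕ} (hk : Even k) (hkN : N + 2 < k) (τ : ℍ)
    (z : Fin N → ℂ) :
    L.eisenstein k 1 τ z = L.theta 0 0 τ z + ∑' q : ReducedFraction × ℤ, ∑' x : Fin N → ℤ,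
      L.slash k 1 (fun _ _ => 1) (cosetRep (Sum.inr (q, x))) τ z := by
  have h1 := (L.summable_norm_slash_cosetRep_inr hN hkN τ z).of_norm
  rw [eisenstein, ← (L.cosetEquiv hk (by omega : k ≠ 0)).tsum_eq, theta, ← h1.tsum_prod]
  refine (HasSum.sum ?_ h1.hasSum).tsum_eq
  refine (L.summable_thetaTerm τ z).hasSum.congr_fun fun x => ?_
  exact L.slash_cosetRep_inl k x τ z

end EvenLattice

/-! ### Gauss sums and representation numbers -/

theorem sum_comp_addMonoidHom {A B : Type*} [AddGroup A] [Fintype A] [AddGroup B] [Fintype B]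
    [DecidableEq B] (f : A →+ B) (hf : Function.Surjective f) (F : B → ℂ) :
    (Fintype.card B : ℂ) * ∑ a, F (f a) = Fintype.card A * ∑ b, F b := by
  -- All fibres have the size of the kernel; taking the constant function 1 below gives that size as
  -- a ratio of cardinalities, in a form without division.
  have hfib : ∀ b, Finset.card {a | f a = b} = Finset.card {a | f a = 0} := fun b =>
    AddMonoidHom.card_fiber_eq_of_mem_range f (hf b) (hf 0)
  have h1 : ∀ G : B → ℂ, ∑ a, G (f a) = (Finset.card {a | f a = 0} : ℂ) * ∑ b, G b := by
    intro G
    rw [← Finset.sum_fiberwise Finset.univ f, Finset.mul_sum]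
    refine Finset.sum_congr rfl fun b _ => ?_
    rw [Finset.sum_congr rfl (g := fun _ => G b) (fun a ha => by rw [(Finset.mem_filter.1 ha).2]),
      Finset.sum_const, nsmul_eq_mul, hfib]
  have h2 := h1 1
  simp only [Pi.one_apply, Finset.sum_const, nsmul_eq_mul, mul_one, Finset.card_univ] at h2
  rw [h1 F, h2]
  ring

namespace EvenLattice

variable {N : ℕ} (L : EvenLattice N)

/-- An upper triangular integral matrix whose symmetrization is the Gram matrix. -/
noncomputable def upperGram : Matrix (Fin N) (Fin N) ℤ :=
  fun i j => if i < j then L.gram i j else if i = j then L.gram i i / 2 else 0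

theorem upperGram_add_transpose : L.upperGram + L.upperGramᵀ = L.gram := by
  ext i j
  rw [Matrix.add_apply, Matrix.transpose_apply]
  unfold upperGram
  rcases lt_trichotomy i j with h | h | h
  · simp [h, h.not_gt, h.ne']
  · subst h
    obtain ⟨a, ha⟩ := L.even_diag i
    simp
    omega
  · simp [h, h.not_gt, h.ne']
    exact (L.symm.apply j i).symm ▸ rfl

/-- The quadratic form `(x, x) / 2`. -/
noncomputable def halfNorm {R : Type*} [CommRing R] (x : Fin N → R) : R :=
  x ⬝ᵥ (L.upperGram.map (Int.cast : ℤ → R)) *ᵥ x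

/-- Relates the form to the triangular model of `(x,x)/2`, which makes sense over every ring,
including `ZMod c` with `c` even, where 2 is not invertible. -/
theorem two_mul_halfNorm {R : Type*} [CommRing R] (x : Fin N → R) :
    2 * L.halfNorm x = L.form x x := by
  have h : L.gram.map (Int.cast : ℤ → R) = L.upperGram.map (Int.cast : ℤ → R) +
      (L.upperGram.map (Int.cast : ℤ → R))ᵀ := by
    conv_lhs => rw [← L.upperGram_add_transpose]
    ext i j
    simp
  rw [form, h, Matrix.add_mulVec, dotProduct_add, Matrix.mulVec_transpose, dotProduct_comm x
    (x ᵥ* _), ← Matrix.dotProduct_mulVec, halfNorm, two_mul]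

theorem halfNorm_map {R S : Type*} [CommRing R] [CommRing S] (f : R →+* S) (x : Fin N → R) :
    L.halfNorm (fun i => f (x i)) = f (L.halfNorm x) := by
  simp [halfNorm, dotProduct, Matrix.mulVec]

theorem halfNorm_smul {R : Type*} [CommRing R] (r : R) (x : Fin N → R) :
    L.halfNorm (r • x) = r ^ 2 * L.halfNorm x := by
  simp [halfNorm, Matrix.mulVec_smul]
  ring

/-- The pairing of `l ∈ L^∨` with a vector. -/
noncomputable def dualPairing {R : Type*} [CommRing R] (l : L.dual) (x : Fin N → R) : R :=
  ∑ i, (L.dualEquiv.symm l i : R) * x i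

theorem dualPairing_map {R S : Type*} [CommRing R] [CommRing S] (f : R →+* S) (l : L.dual)
    (x : Fin N → R) : L.dualPairing l (fun i => f (x i)) = f (L.dualPairing l x) := by
  simp [dualPairing]

theorem dualPairing_smul {R : Type*} [CommRing R] (r : R) (l : L.dual) (x : Fin N → R) :
    L.dualPairing l (r • x) = r * L.dualPairing l x := by
  simp only [dualPairing, Pi.smul_apply, smul_eq_mul, Finset.mul_sum]
  exact Finset.sum_congr rfl fun i _ => by ring

theorem form_dual (l : L.dual) (z : Fin N → ℂ) :
    L.form (fun i => ((l : Fin N → ℚ) i : ℂ)) z = L.dualPairing l z := by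
  conv_lhs => rw [← L.dualEquiv.apply_symm_apply l]
  exact L.form_dualOfInt _ z

/-- The integral polynomial `Q^∨`, over an arbitrary ring. -/
noncomputable def dualPoly {R : Type*} [CommRing R] (n : ℤ) (l : L.dual) (x : Fin N → R) : R :=
  L.halfNorm x - L.dualPairing l x + n

theorem dualPoly_map {R S : Type*} [CommRing R] [CommRing S] (f : R →+* S) (n : ℤ) (l : L.dual)
    (x : Fin N → R) : L.dualPoly n l (fun i => f (x i)) = f (L.dualPoly n l x) := by
  simp [dualPoly, halfNorm_map, dualPairing_map]

theorem dualPoly_intCast {R : Type*} [CommRing R] (n : ℤ) (l : L.dual) (x : Fin N → ℤ) :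
    L.dualPoly n l (fun i => (x i : R)) = (L.dualPoly n l x : ℤ) :=
  L.dualPoly_map (Int.castRingHom R) n l x

theorem dualQuad_eq (n : ℤ) (l : L.dual) (x : Fin N → ℤ) :
    L.dualQuad n l x = (L.dualPoly n l x : ℤ) := by
  have h1 := L.two_mul_halfNorm (fun i => (x i : ℚ))
  have h2 := L.form_dual l (fun i => (x i : ℂ))
  have h3 := L.form_ratCast (l : Fin N → ℚ) (fun i => (x i : ℚ))
  have h4 := L.dualPairing_map (Rat.castHom ℂ) l (fun i => (x i : ℚ))
  simp only [Rat.cast_intCast, Rat.coe_castHom] at h3 h4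
  rw [h2, h4] at h3
  have h5 : L.dualPairing l (fun i => (x i : ℚ)) = L.form (l : Fin N → ℚ) (fun i => (x i : ℚ)) := by
    exact_mod_cast h3
  rw [← dualPoly_intCast, dualQuad, ← h1, ← h5, dualPoly]
  ring

theorem repNum_eq (n : ℤ) (l : L.dual) (a : ℕ) [NeZero a] :
    L.repNum n l a = Finset.card {x : Fin N → ZMod a | L.dualPoly n l x = 0} := by
  rw [repNum, ← Set.ncard_coe_finset]
  congr 1
  ext y
  simp only [Set.mem_image, Set.mem_ofPred_eq, Finset.coe_filter, Finset.mem_univ, true_and]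
  have key : ∀ x : Fin N → ℤ, (∃ t : ℤ, L.dualQuad n l x = a * t) ↔
      L.dualPoly n l (fun i => (x i : ZMod a)) = 0 := by
    intro x
    rw [dualPoly_intCast, ZMod.intCast_zmod_eq_zero_iff_dvd, dualQuad_eq]
    constructor
    · rintro ⟨t, ht⟩
      exact ⟨t, by exact_mod_cast ht⟩
    · rintro ⟨t, ht⟩
      exact ⟨t, by rw [ht]; push_cast; ring⟩
  constructor
  · rintro ⟨x, hx, rfl⟩
    exact (key x).1 hx
  · intro hy
    have e : (fun i => (((y i).val : ℤ) : ZMod a)) = y := by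
      funext i
      simp
    refine ⟨fun i => ((y i).val : ℤ), (key _).2 ?_, e⟩
    rw [e]
    exact hy

theorem repNum_le (n : ℤ) (l : L.dual) (a : ℕ) [NeZero a] : L.repNum n l a ≤ a ^ N := by
  rw [repNum_eq]
  refine (Finset.card_le_univ _).trans (le_of_eq ?_)
  simp [ZMod.card]

/-- The Gauss sum `∑ e(d Q^∨(x) / c)` over `x ∈ L / cL`. -/
noncomputable def gaussSum (c : ℕ) [NeZero c] (d : ℕ) (n : ℤ) (l : L.dual) : ℂ :=
  ∑ x : Fin N → ZMod c, ZMod.stdAddChar ((d : ZMod c) * L.dualPoly n l x)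

theorem norm_gaussSum_le (c : ℕ) [NeZero c] (d : ℕ) (n : ℤ) (l : L.dual) :
    ‖L.gaussSum c d n l‖ ≤ (c : ℝ) ^ N := by
  refine (norm_sum_le _ _).trans (le_of_eq ?_)
  simp [ZMod.card]

/-- Orthogonality of the characters `d ↦ e(d Q^∨(x)/c)` detects `Q^∨(x) ≡ 0 mod c`. -/
theorem sum_gaussSum (c : ℕ) [NeZero c] (n : ℤ) (l : L.dual) :
    ∑ d : Fin c, L.gaussSum c d n l = c * L.repNum n l c := by
  have h1 : ∑ d : Fin c, L.gaussSum c d n l =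
      ∑ d : ZMod c, ∑ x : Fin N → ZMod c, ZMod.stdAddChar (d * L.dualPoly n l x) := by
    refine Fintype.sum_bijective (fun d : Fin c => ((d : ℕ) : ZMod c)) ?_ _ _ fun d => rfl
    rw [Fintype.bijective_iff_injective_and_card]
    refine ⟨fun a b h => ?_, by simp [ZMod.card]⟩
    have := (ZMod.natCast_eq_natCast_iff' _ _ _).1 h
    rw [Nat.mod_eq_of_lt a.2, Nat.mod_eq_of_lt b.2] at this
    exact Fin.ext this
  rw [h1, Finset.sum_comm]
  simp_rw [AddChar.sum_mulShift _ (ZMod.isPrimitive_stdAddChar c)]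
  rw [repNum_eq, Finset.card_filter, ZMod.card]
  push_cast
  rw [Finset.mul_sum]
  exact Finset.sum_congr rfl fun x _ => by split_ifs <;> simp

theorem stdAddChar_mul_natCast (g c : ℕ) [NeZero g] [NeZero c] (y : ZMod (g * c)) :
    ZMod.stdAddChar ((g : ZMod (g * c)) * y) =
      ZMod.stdAddChar (ZMod.castHom (Nat.dvd_mul_left c g) (ZMod c) y) := by
  obtain ⟨Y, rfl⟩ := ZMod.intCast_surjective y
  have hg : (g : ℂ) ≠ 0 := by exact_mod_cast NeZero.ne g
  have h1 : (g : ZMod (g * c)) * (Y : ZMod (g * c)) = ((g * Y : ℤ) : ZMod (g * c)) := by push_cast; rfl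
  have h2 : ZMod.castHom (Nat.dvd_mul_left c g) (ZMod c) (Y : ZMod (g * c)) = (Y : ZMod c) :=
    map_intCast _ Y
  rw [h1, h2, ZMod.stdAddChar_coe, ZMod.stdAddChar_coe]
  congr 1
  push_cast
  field_simp

/-- The fraction is unchanged, so the summand depends only on `x mod c`, and each class has `g^N`
lifts modulo `gc`. -/
theorem gaussSum_mul (g c : ℕ) [NeZero g] [NeZero c] (d : ℕ) (n : ℤ) (l : L.dual) :
    L.gaussSum (g * c) (g * d) n l = (g : ℂ) ^ N * L.gaussSum c d n l := by
  set f := ZMod.castHom (Nat.dvd_mul_left c g) (ZMod c) with hf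
  let φ : (Fin N → ZMod (g * c)) →+ (Fin N → ZMod c) := AddMonoidHom.compLeft f.toAddMonoidHom _
  have hφ : Function.Surjective φ := by
    intro y
    choose x hx using fun i => ZMod.ringHom_surjective f (y i)
    exact ⟨x, funext hx⟩
  have h := sum_comp_addMonoidHom φ hφ
    fun x => ZMod.stdAddChar ((d : ZMod c) * L.dualPoly n l x)
  have h2 : ∀ x : Fin N → ZMod (g * c),
      ZMod.stdAddChar (((g * d : ℕ) : ZMod (g * c)) * L.dualPoly n l x) =
      ZMod.stdAddChar ((d : ZMod c) * L.dualPoly n l (φ x)) := by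
    intro x
    have e : L.dualPoly n l (φ x) = f (L.dualPoly n l x) := L.dualPoly_map f n l x
    rw [e, Nat.cast_mul, mul_assoc, stdAddChar_mul_natCast, map_mul, map_natCast]
  have hc : (c : ℂ) ≠ 0 := by exact_mod_cast NeZero.ne c
  simp only [Fintype.card_pi, ZMod.card, Finset.prod_const, Finset.card_univ, Fintype.card_fin]
    at h
  simp_rw [← h2] at h
  rw [gaussSum, gaussSum]
  push_cast [mul_pow] at h ⊢
  refine mul_left_cancel₀ (pow_ne_zero N hc) ?_
  rw [h]
  ring

/-- The substitution `x = dy`, with `ad = 1`, replaces the inverse `a` occurring in the cosets by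
`d`, so that the sum depends on the bottom row alone. -/
theorem sum_stdAddChar_eq_gaussSum (c : ℕ) [NeZero c] (d : ℕ) (a : ZMod c)
    (ha : a * d = 1) (n : ℤ) (l : L.dual) :
    ∑ x : Fin N → ZMod c, ZMod.stdAddChar (a * L.halfNorm x - L.dualPairing l x +
      (n : ZMod c) * (d : ZMod c)) =
      L.gaussSum c d n l := by
  symm
  have hbij : Function.Bijective fun y : Fin N → ZMod c => (d : ZMod c) • y := by
    refine ⟨fun y y' h => ?_, fun y => ⟨a • y, ?_⟩⟩
    · have := congrArg (fun v => a • v) h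
      simpa only [smul_smul, ha, one_smul] using this
    · simp only [smul_smul]
      rw [mul_comm, ha, one_smul]
  refine Fintype.sum_bijective _ hbij _ _ fun y => ?_
  rw [halfNorm_smul, dualPairing_smul, dualPoly]
  congr 1
  linear_combination (-(d : ZMod c) * L.halfNorm y) * ha

end EvenLattice

theorem Sigma.fin_ext {s t : Σ c : ℕ+, Fin c} (h1 : s.1 = t.1) (h2 : (s.2 : ℕ) = t.2) : s = t := by
  obtain ⟨c, d⟩ := s
  obtain ⟨c', d'⟩ := t
  dsimp only at h1 h2
  subst h1
  rw [Fin.ext h2]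

/-- Every fraction `d / c` with `0 ≤ d < c` is obtained by expanding a unique reduced fraction. -/
noncomputable def ReducedFraction.expand (x : ℕ+ × ReducedFraction) : Σ c : ℕ+, Fin c :=
  ⟨x.1 * x.2.1.1, ⟨x.1 * x.2.1.2, by
    rw [PNat.mul_coe]
    exact Nat.mul_lt_mul_of_pos_left x.2.2.1 x.1.pos⟩⟩

theorem ReducedFraction.bijective_expand : Function.Bijective expand := by
  constructor
  · rintro ⟨g, ⟨⟨c, d⟩, h1, h2⟩⟩ ⟨g', ⟨⟨c', d'⟩, h1', h2'⟩⟩ h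
    have e1 : g * c = g' * c' := congrArg Sigma.fst h
    have e2 : (g : ℕ) * d = g' * d' := congrArg (fun s : Σ c : ℕ+, Fin c => (s.2 : ℕ)) h
    have e1' : (g : ℕ) * c = g' * c' := by exact_mod_cast congrArg PNat.val e1
    dsimp only at h2 h2'
    have hg : (g : ℕ) = g' := by
      have h3 := Nat.gcd_mul_left g c d
      rw [e1', e2, Nat.gcd_mul_left, h2.gcd_eq_one, h2'.gcd_eq_one] at h3
      simpa using h3.symm
    have hg' : g = g' := PNat.coe_injective hg
    subst hg'
    have hc : c = c' := mul_left_cancel e1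
    subst hc
    have hd : d = d' := Nat.eq_of_mul_eq_mul_left g.pos e2
    subst hd
    rfl
  · rintro ⟨c, d, hd⟩
    have hg : 0 < Nat.gcd c d := Nat.gcd_pos_of_pos_left _ c.pos
    have hc' : 0 < (c : ℕ) / Nat.gcd c d :=
      Nat.div_pos (Nat.le_of_dvd c.pos (Nat.gcd_dvd_left _ _)) hg
    refine ⟨(⟨Nat.gcd c d, hg⟩, ⟨(⟨(c : ℕ) / Nat.gcd c d, hc'⟩, d / Nat.gcd c d), ?_, ?_⟩), ?_⟩
    · exact Nat.div_lt_div_of_lt_of_dvd (Nat.gcd_dvd_left _ _) hd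
    · exact Nat.coprime_div_gcd_div_gcd hg
    · refine Sigma.fin_ext (PNat.coe_injective ?_) ?_
      · exact Nat.mul_div_cancel' (Nat.gcd_dvd_left _ _)
      · exact Nat.mul_div_cancel' (Nat.gcd_dvd_right _ _)

theorem summable_pnat_inv_pow {m : ℕ} (hm : 1 < m) : Summable fun c : ℕ+ => ((c : ℝ) ^ m)⁻¹ :=
  (Real.summable_nat_pow_inv.2 hm).comp_injective PNat.coe_injective

theorem riemannZeta_eq_tsum_pnat {m : ℕ} (hm : 1 < m) :
    riemannZeta m = ∑' g : ℕ+, ((g : ℂ) ^ m)⁻¹ := by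
  rw [zeta_nat_eq_tsum_of_gt_one hm]
  have h := PNat.coe_injective.tsum_eq (f := fun n : ℕ => 1 / (n : ℂ) ^ m) (by
    intro n hn
    refine ⟨⟨n, Nat.pos_of_ne_zero fun h0 => hn ?_⟩, rfl⟩
    simp [h0]
    omega)
  rw [← h]
  exact tsum_congr fun g => by simp

namespace EvenLattice

variable {N : ℕ} (L : EvenLattice N)

theorem summable_sigma_fin {m : ℕ} (hm : 2 < m) :
    Summable fun s : Σ c : ℕ+, Fin c => ((s.1 : ℝ) ^ m)⁻¹ := by
  rw [summable_sigma_of_nonneg fun _ => by positivity]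
  refine ⟨fun c => Summable.of_finite, ?_⟩
  refine (summable_pnat_inv_pow (m := m - 1) (by omega)).congr fun c => ?_
  have hc : (c : ℝ) ≠ 0 := by exact_mod_cast c.ne_zero
  rw [tsum_fintype]
  change _ = ∑ _b : Fin (c : ℕ), ((c : ℝ) ^ m)⁻¹
  rw [Finset.sum_const, Finset.card_univ, Fintype.card_fin, nsmul_eq_mul]
  obtain ⟨j, rfl⟩ : ∃ j, m = j + 1 := ⟨m - 1, by omega⟩
  rw [Nat.add_sub_cancel, pow_succ]
  field_simp

theorem summable_reducedFraction {m : ℕ} (hm : 2 < m) :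
    Summable fun p : ReducedFraction => ((p.1.1 : ℝ) ^ m)⁻¹ := by
  have h := (summable_sigma_fin hm).comp_injective (ReducedFraction.bijective_expand.1.comp
    (Prod.mk_right_injective (1 : ℕ+)))
  refine h.congr fun p => ?_
  simp [ReducedFraction.expand]

theorem norm_gaussSum_div_le {k : ℕ} (hkN : N ≤ k) (c : ℕ) [NeZero c] (d : ℕ) (n : ℤ)
    (l : L.dual) : ‖((c : ℂ) ^ k)⁻¹ * L.gaussSum c d n l‖ ≤ ((c : ℝ) ^ (k - N))⁻¹ := by
  have hc : (0 : ℝ) < c := by exact_mod_cast Nat.pos_of_ne_zero (NeZero.ne c)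
  rw [norm_mul, norm_inv, norm_pow, Complex.norm_natCast]
  calc _ ≤ ((c : ℝ) ^ k)⁻¹ * (c : ℝ) ^ N := by
        gcongr
        exact L.norm_gaussSum_le c d n l
    _ = _ := by
        obtain ⟨j, rfl⟩ := Nat.exists_eq_add_of_le hkN
        rw [Nat.add_sub_cancel_left, pow_add]
        field_simp

/-- Every fraction `d/c` is uniquely an expansion by some `g` of a reduced one, and its term is
`g^{-(k-N)}` times the reduced term. Hence the sum over all fractions factors as `ζ(k-N)` times the
sum over reduced ones, while grouping it by denominators gives the representation numbers. -/
theorem tsum_gaussSum {k : ℕ} (hkN : N + 2 < k) (n : ℤ) (l : L.dual) :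
    ∑' p : ReducedFraction, ((p.1.1 : ℂ) ^ k)⁻¹ * L.gaussSum p.1.1 p.1.2 n l =
      (∑' a : ℕ+, (L.repNum n l a : ℂ) / (a : ℂ) ^ (k - 1)) / riemannZeta ((k : ℂ) - N) := by
  have hz : riemannZeta ((k : ℂ) - N) = riemannZeta ((k - N : ℕ) : ℂ) := by
    rw [Nat.cast_sub (by omega)]
  have hz0 : riemannZeta ((k : ℂ) - N) ≠ 0 := by
    rw [hz]
    refine riemannZeta_ne_zero_of_one_lt_re ?_
    rw [Complex.natCast_re]
    exact_mod_cast (by omega : 1 < k - N)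
  rw [eq_div_iff hz0, hz, riemannZeta_eq_tsum_pnat (by omega)]
  set F : (Σ c : ℕ+, Fin c) → ℂ := fun s => ((s.1 : ℂ) ^ k)⁻¹ * L.gaussSum s.1 s.2 n l with hF
  have hFs : Summable F := Summable.of_norm_bounded (summable_sigma_fin (m := k - N) (by omega))
    fun s => L.norm_gaussSum_div_le (by omega) _ _ _ _
  have h1 : ∑' s, F s = ∑' a : ℕ+, (L.repNum n l a : ℂ) / (a : ℂ) ^ (k - 1) := by
    rw [hFs.tsum_sigma]
    refine tsum_congr fun c => ?_
    have hc : (c : ℂ) ≠ 0 := by exact_mod_cast c.ne_zero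
    rw [tsum_fintype, hF]
    simp only
    rw [← Finset.mul_sum]
    refine (congrArg _ (L.sum_gaussSum c n l)).trans ?_
    obtain ⟨j, rfl⟩ : ∃ j, k = j + 1 := ⟨k - 1, by omega⟩
    rw [Nat.add_sub_cancel, pow_succ]
    field_simp
  have h2 : ∀ x : ℕ+ × ReducedFraction, F (ReducedFraction.expand x) =
      ((x.1 : ℂ) ^ (k - N))⁻¹ *
        (((x.2.1.1 : ℂ) ^ k)⁻¹ * L.gaussSum x.2.1.1 x.2.1.2 n l) := by
    rintro ⟨g, p⟩
    have hg : (g : ℂ) ≠ 0 := by exact_mod_cast g.ne_zero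
    have hc : (p.1.1 : ℂ) ≠ 0 := by exact_mod_cast p.1.1.ne_zero
    have e : F (ReducedFraction.expand (g, p)) = (((g * p.1.1 : ℕ) : ℂ) ^ k)⁻¹ *
      L.gaussSum (g * p.1.1) (g * p.1.2) n l := rfl
    rw [e, gaussSum_mul]
    obtain ⟨j, hj⟩ := Nat.exists_eq_add_of_le (by omega : N ≤ k)
    have hj' : k - N = j := by omega
    rw [hj']
    have hgk : (g : ℂ) ^ k = (g : ℂ) ^ N * (g : ℂ) ^ j := by rw [hj, pow_add]
    push_cast
    rw [mul_pow, hgk]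
    field_simp
  have h3 := (Equiv.ofBijective _ ReducedFraction.bijective_expand).tsum_eq F
  rw [← h1, ← h3]
  simp only [Equiv.ofBijective_apply, h2]
  rw [mul_comm]
  refine tsum_mul_tsum_of_summable_norm ?_ ?_
  · refine (summable_pnat_inv_pow (m := k - N) (by omega)).congr fun g => ?_
    simp
  · refine Summable.of_nonneg_of_le (fun _ => norm_nonneg _)
      (fun p => L.norm_gaussSum_div_le (by omega) _ _ _ _)
      (summable_reducedFraction (m := k - N) (by omega))

theorem summable_repNum_div {k : ℕ} (hkN : N + 2 < k) (n : ℤ) (l : L.dual) :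
    Summable fun a : ℕ+ => (L.repNum n l a : ℂ) / (a : ℂ) ^ (k - 1) := by
  refine Summable.of_norm_bounded (summable_pnat_inv_pow (m := k - 1 - N) (by omega)) fun a => ?_
  have ha : (0 : ℝ) < a := by exact_mod_cast a.pos
  rw [norm_div, Complex.norm_natCast, norm_pow, Complex.norm_natCast]
  have h1 : (L.repNum n l a : ℝ) ≤ (a : ℝ) ^ N := by exact_mod_cast L.repNum_le n l a
  rw [div_le_iff₀ (by positivity)]
  refine h1.trans (le_of_eq ?_)
  obtain ⟨j, hj⟩ := Nat.exists_eq_add_of_le (by omega : N ≤ k - 1)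
  rw [hj, Nat.add_sub_cancel_left, pow_add]
  field_simp

end EvenLattice

/-! ### The sum over the lattice for a fixed bottom row -/

/-- Splitting an integral vector into its class modulo `c` and a multiple of `c`. -/
noncomputable def residueEquiv (N c : ℕ) [NeZero c] :
    (Fin N → ZMod c) × (Fin N → ℤ) ≃ (Fin N → ℤ) :=
  -- With the minus sign, `z - x/c` becomes `z - val/c + y`, the shape required by theta inversion.
  Equiv.ofBijective (fun p i => ((p.1 i).val : ℤ) - c * p.2 i) (by
    have hc : (c : ℤ) ≠ 0 := by exact_mod_cast NeZero.ne c
    constructor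
    · rintro ⟨x, y⟩ ⟨x', y'⟩ h
      have hx : x = x' := by
        funext i
        have := congrArg (fun n : ℤ => (n : ZMod c)) (congrFun h i)
        simpa using this
      subst hx
      have hy : y = y' := by
        funext i
        have h1 := congrFun h i
        simp only [sub_right_inj] at h1
        exact mul_left_cancel₀ hc h1
      rw [hy]
    · intro X
      have h : ∀ i, ∃ y : ℤ, (((X i : ZMod c).val : ℤ)) - c * y = X i := by
        intro i
        have h1 : (c : ℤ) ∣ ((X i : ZMod c).val : ℤ) - X i := by
          rw [← ZMod.intCast_zmod_eq_zero_iff_dvd]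
          simp
        obtain ⟨y, hy⟩ := h1
        exact ⟨y, by linarith⟩
      choose y hy using h
      exact ⟨(fun i => (X i : ZMod c), y), funext hy⟩)

theorem residueEquiv_apply {N c : ℕ} [NeZero c] (p : (Fin N → ZMod c) × (Fin N → ℤ)) (i : Fin N) :
    residueEquiv N c p i = ((p.1 i).val : ℤ) - c * p.2 i := rfl

theorem intCast_residueEquiv {N c : ℕ} [NeZero c] (p : (Fin N → ZMod c) × (Fin N → ℤ)) (i : Fin N) :
    ((residueEquiv N c p i : ℤ) : ZMod c) = p.1 i := by
  rw [residueEquiv_apply]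
  simp

namespace EvenLattice

variable {N : ℕ} (L : EvenLattice N)

/-- The character `e^{2π i (l, z)}`. -/
noncomputable def dualExp (z : Fin N → ℂ) (l : L.dual) : ℂ :=
  Complex.exp (2 * Real.pi * Complex.I * L.form (fun i => ((l : Fin N → ℚ) i : ℂ)) z)

/-- Half of the norm of a vector of the dual lattice. -/
noncomputable def dualHalfNorm (l : L.dual) : ℝ := ((L.form (l : Fin N → ℚ) l / 2 : ℚ) : ℝ)

theorem dualThetaTerm_eq_mul (σ : ℂ) (z : Fin N → ℂ) (l : L.dual) :
    L.dualThetaTerm (-Complex.I * σ) z l =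
      L.dualExp z l * Complex.exp (2 * Real.pi * Complex.I * L.dualHalfNorm l * σ) := by
  rw [dualThetaTerm, dualExp, dualHalfNorm, ← Complex.exp_add]
  congr 1
  push_cast
  ring

/-- After inversion a shift by `x/c` is only a character value of `(l, x)` modulo `c`, which
supplies the linear term of the Gauss sum. -/
theorem dualThetaTerm_sub (c : ℕ) [NeZero c] (t : ℂ) (z : Fin N → ℂ) (l : L.dual)
    (x : Fin N → ZMod c) :
    L.dualThetaTerm t (z - (c : ℂ)⁻¹ • fun i => (((x i).val : ℤ) : ℂ)) l =
      L.dualThetaTerm t z l * ZMod.stdAddChar (-L.dualPairing l x) := by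
  have h1 : -L.dualPairing l x =
      ((-L.dualPairing l (fun i => ((x i).val : ℤ)) : ℤ) : ZMod c) := by
    have := L.dualPairing_map (Int.castRingHom (ZMod c)) l (fun i => ((x i).val : ℤ))
    rw [Int.cast_neg]
    simp only [Int.coe_castRingHom] at this
    rw [← this]
    simp
  have h2 : L.form (fun i => ((l : Fin N → ℚ) i : ℂ)) (fun i => (((x i).val : ℤ) : ℂ)) =
      (L.dualPairing l (fun i => ((x i).val : ℤ)) : ℤ) := by
    rw [form_dual]
    exact L.dualPairing_map (Int.castRingHom ℂ) l (fun i => ((x i).val : ℤ))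
  rw [h1, ZMod.stdAddChar_coe, dualThetaTerm, dualThetaTerm, ← Complex.exp_add, sub_eq_add_neg z,
    form_add_right, ← neg_smul, form_smul_right, h2]
  congr 1
  push_cast
  ring

/-- Since `(x,x)` is even, the phase depends only on `x mod c` and is constant in the inner sum over
`y`. -/
theorem exp_form_div_eq_stdAddChar (c : ℕ) [NeZero c] (a : ℤ) (x : Fin N → ℤ) :
    Complex.exp (Real.pi * Complex.I * ((a : ℂ) * (L.form x x : ℤ) / (c : ℂ))) =
      ZMod.stdAddChar ((a : ZMod c) * L.halfNorm fun i => (x i : ZMod c)) := by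
  have h1 : (a : ZMod c) * L.halfNorm (fun i => (x i : ZMod c)) =
      ((a * L.halfNorm x : ℤ) : ZMod c) := by
    have := L.halfNorm_map (Int.castRingHom (ZMod c)) x
    simp only [Int.coe_castRingHom] at this
    rw [this]
    push_cast
    rfl
  rw [h1, ZMod.stdAddChar_coe, ← two_mul_halfNorm]
  congr 1
  push_cast
  ring

/-- Theta inversion yields the Gauss sum with `n = 0`; the missing phase `e(nd/c)` is delivered
later by Lipschitz's formula at `τ + d/c`. -/
theorem gaussSum_eq_zero_mul (c : ℕ) [NeZero c] (d : ℕ) (n : ℤ) (l : L.dual) :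
    L.gaussSum c d n l =
      Complex.exp (2 * Real.pi * Complex.I * n * (d / c)) * L.gaussSum c d 0 l := by
  have h : Complex.exp (2 * Real.pi * Complex.I * n * (d / c)) =
      ZMod.stdAddChar (((n * d : ℤ)) : ZMod c) := by
    rw [ZMod.stdAddChar_coe]
    congr 1
    push_cast
    ring
  rw [gaussSum, gaussSum, h, Finset.mul_sum]
  refine Finset.sum_congr rfl fun x _ => ?_
  rw [← AddChar.map_add_eq_mul]
  congr 1
  simp only [dualPoly]
  push_cast
  ring

/-- Theta inversion is applied for each residue `x mod c` with `t = i/σ`. The phases of the residues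
then assemble into a Gauss sum for each `l`. -/
theorem tsum_slash_cosetRep_inr (hN : Even N) {k : ℕ} (hkN : N + 2 < k)
    (q : ReducedFraction × ℤ) (τ : ℍ) (z : Fin N → ℂ) :
    ∑' x : Fin N → ℤ, L.slash k 1 (fun _ _ => 1) (cosetRep (Sum.inr (q, x))) τ z =
      (L.vol : ℂ)⁻¹ * (-Complex.I) ^ (N / 2) * (((q.1.1.1 : ℕ) : ℂ) ^ k)⁻¹ *
      ∑' l : L.dual, L.dualExp z l * L.gaussSum q.1.1.1 q.1.1.2 0 l *
        (((τ : ℂ) + q.1.1.2 / (q.1.1.1 : ℕ) + q.2) ^ (-((k - N / 2 : ℕ) : ℤ)) *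
          Complex.exp (2 * Real.pi * Complex.I * L.dualHalfNorm l *
            ((τ : ℂ) + q.1.1.2 / (q.1.1.1 : ℕ) + q.2))) := by
  obtain ⟨p, r⟩ := q
  set c : ℕ := ((p.1.1 : ℕ+) : ℕ) with hc
  set d : ℕ := p.1.2 with hd
  set σ : ℂ := (τ : ℂ) + d / c + r with hσ
  set a : ℤ := p.toSL r 0 0 with ha
  have hc0 : (c : ℂ) ≠ 0 := by exact_mod_cast p.1.1.ne_zero
  have hσim : 0 < σ.im := by
    have : σ.im = τ.im := by
      rw [hσ]
      have : ((d : ℂ) / c).im = 0 := by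
        rw [show (d : ℂ) / c = ((d / c : ℝ) : ℂ) by push_cast; rfl, Complex.ofReal_im]
      simp [this]
    rw [this]
    exact τ.im_pos
  have hσ0 : σ ≠ 0 := by
    intro h
    rw [h] at hσim
    simp at hσim
  have hj : ReducedFraction.autFactor (p, r) τ = c * σ := by
    rw [ReducedFraction.autFactor, hσ]
    field_simp
    ring
  set t : ℂ := Complex.I * σ⁻¹ with ht
  have htinv : t⁻¹ = -Complex.I * σ := by
    rw [ht, mul_inv, inv_inv, Complex.inv_I]
  have htre : 0 < t.re := by
    rw [ht, Complex.I_mul_re, Complex.inv_im, neg_div, neg_neg]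
    exact div_pos hσim (Complex.normSq_pos.2 hσ0)
  have htinvre : 0 < (-Complex.I * σ).re := by simpa using hσim
  -- The determinant condition modulo `c`.
  have had : (a : ZMod c) * (d : ZMod c) = 1 := by
    have h1 := (p.toSL r).det_coe
    rw [Matrix.det_fin_two, ReducedFraction.toSL_one_zero, ReducedFraction.toSL_one_one] at h1
    have h2 := congrArg (fun n : ℤ => (n : ZMod c)) h1
    push_cast at h2
    rw [← hc, ← hd, ← ha] at h2
    simpa using h2
  have hterm : ∀ y : (Fin N → ZMod c) × (Fin N → ℤ),
      L.slash k 1 (fun _ _ => 1) (cosetRep (Sum.inr ((p, r), residueEquiv N c y))) τ z =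
      ((c : ℂ) * σ) ^ (-(k : ℤ)) * ZMod.stdAddChar ((a : ZMod c) * L.halfNorm y.1) *
        Complex.exp (-(Real.pi * t *
          L.form ((z - (c : ℂ)⁻¹ • fun i => (((y.1 i).val : ℤ) : ℂ)) + fun i => (y.2 i : ℂ))
            ((z - (c : ℂ)⁻¹ • fun i => (((y.1 i).val : ℤ) : ℂ)) + fun i => (y.2 i : ℂ)))) := by
    intro y
    rw [slash_cosetRep_inr, hj]
    dsimp only
    rw [← hc, ← ha, exp_form_div_eq_stdAddChar]
    simp_rw [intCast_residueEquiv]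
    have e1 : (z - (c : ℂ)⁻¹ • fun i => ((residueEquiv N c y i : ℤ) : ℂ)) =
        (z - (c : ℂ)⁻¹ • fun i => (((y.1 i).val : ℤ) : ℂ)) + fun i => (y.2 i : ℂ) := by
      funext i
      simp only [Pi.sub_apply, Pi.smul_apply, Pi.add_apply, smul_eq_mul, residueEquiv_apply]
      push_cast
      field_simp
      ring
    have e2 : Complex.I * ((c : ℂ) / (c * σ)) = t := by
      rw [ht]
      field_simp
    rw [e1, e2]
  have hsum : Summable fun x : Fin N → ℤ =>
      L.slash k 1 (fun _ _ => 1) (cosetRep (Sum.inr ((p, r), x))) τ z :=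
    ((L.summable_norm_slash_cosetRep_inr hN hkN τ z).prod_factor (p, r)).of_norm
  have hsum' : Summable fun y => L.slash k 1 (fun _ _ => 1)
      (cosetRep (Sum.inr ((p, r), residueEquiv N c y))) τ z :=
    (residueEquiv N c).summable_iff.2 hsum
  rw [← (residueEquiv N c).tsum_eq, hsum'.tsum_prod]
  simp_rw [hterm]
  simp_rw [tsum_mul_left, L.tsum_exp_form_add hN htre, htinv, dualThetaTerm_sub]
  rw [tsum_fintype]
  have hs1 := L.summable_dualThetaTerm htinvre z
  have e3 : ∀ l : L.dual, L.dualThetaTerm (-Complex.I * σ) z l * L.gaussSum c d 0 l =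
      ∑ x : Fin N → ZMod c, ZMod.stdAddChar ((a : ZMod c) * L.halfNorm x) *
        (L.dualThetaTerm (-Complex.I * σ) z l * ZMod.stdAddChar (-L.dualPairing l x)) := by
    intro l
    rw [← L.sum_stdAddChar_eq_gaussSum c d a had 0 l, Finset.mul_sum]
    refine Finset.sum_congr rfl fun x _ => ?_
    rw [mul_left_comm, ← AddChar.map_add_eq_mul]
    congr 2
    push_cast
    ring
  have e4 : ∑' l : L.dual, L.dualThetaTerm (-Complex.I * σ) z l * L.gaussSum c d 0 l =
      ∑ x : Fin N → ZMod c, ZMod.stdAddChar ((a : ZMod c) * L.halfNorm x) *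
        ∑' l : L.dual,
          (L.dualThetaTerm (-Complex.I * σ) z l * ZMod.stdAddChar (-L.dualPairing l x)) := by
    simp_rw [e3]
    rw [Summable.tsum_finsetSum]
    · exact Finset.sum_congr rfl fun x _ => tsum_mul_left
    · intro x _
      refine Summable.mul_left _ ?_
      refine Summable.of_norm_bounded hs1.norm fun l => ?_
      rw [norm_mul, ZMod.stdAddChar_apply, Circle.norm_coe, mul_one]
  -- The weight drops from `k` to `k - N/2`: the automorphy factor gives `σ^{-k}` and theta
  -- inversion gives `σ^{N/2}`.
  have e5 : ((c : ℂ) * σ) ^ (-(k : ℤ)) * (-Complex.I * σ) ^ (N / 2) =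
      (-Complex.I) ^ (N / 2) * ((c : ℂ) ^ k)⁻¹ * σ ^ (-((k - N / 2 : ℕ) : ℤ)) := by
    obtain ⟨m, hm⟩ := Nat.exists_eq_add_of_le (by omega : N / 2 ≤ k)
    have hm' : k - N / 2 = m := by omega
    rw [hm', zpow_neg, zpow_neg, zpow_natCast, zpow_natCast, mul_pow, mul_pow]
    have : σ ^ k = σ ^ (N / 2) * σ ^ m := by rw [hm, pow_add]
    rw [this]
    field_simp
  calc _ = ((c : ℂ) * σ) ^ (-(k : ℤ)) * ((L.vol : ℂ)⁻¹ * (-Complex.I * σ) ^ (N / 2)) *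
        ∑ x : Fin N → ZMod c, ZMod.stdAddChar ((a : ZMod c) * L.halfNorm x) *
        ∑' l : L.dual,
          (L.dualThetaTerm (-Complex.I * σ) z l * ZMod.stdAddChar (-L.dualPairing l x)) := by
        rw [Finset.mul_sum]
        exact Finset.sum_congr rfl fun x _ => by ring
    _ = (L.vol : ℂ)⁻¹ * (-Complex.I) ^ (N / 2) * ((c : ℂ) ^ k)⁻¹ *
        (σ ^ (-((k - N / 2 : ℕ) : ℤ)) *
          ∑' l : L.dual, L.dualThetaTerm (-Complex.I * σ) z l * L.gaussSum c d 0 l) := by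
        rw [← e4]
        linear_combination (L.vol : ℂ)⁻¹ *
          (∑' l : L.dual, L.dualThetaTerm (-Complex.I * σ) z l * L.gaussSum c d 0 l) * e5
    _ = _ := by
        rw [← tsum_mul_left]
        congr 1
        refine tsum_congr fun l => ?_
        rw [dualThetaTerm_eq_mul]
        ring

end EvenLattice

/-! ### The Fourier expansion -/

theorem lipschitzTerm_add_ratio (n : ℕ) (μ : ℝ) (τ : ℂ) (s : ℂ) (m : ℤ) :
    lipschitzTerm n μ (τ + s) m =
      Complex.exp (2 * Real.pi * Complex.I * m * s) * lipschitzTerm n μ τ m := by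
  rw [lipschitzTerm, lipschitzTerm, mul_left_comm, ← Complex.exp_add]
  congr 2
  push_cast
  ring

theorem im_add_natCast_div (τ : ℂ) (c d : ℕ) : (τ + d / c).im = τ.im := by
  rw [Complex.add_im, show (d : ℂ) / c = ((d / c : ℝ) : ℂ) by push_cast; rfl, Complex.ofReal_im,
    add_zero]

namespace EvenLattice

variable {N : ℕ} (L : EvenLattice N)

/-- The terms of the Fourier expansion, up to arithmetic factors. -/
noncomputable def fourierTerm (e : ℕ) (τ : ℂ) (z : Fin N → ℂ) (y : L.dual × ℤ) : ℂ :=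
  L.dualExp z y.1 * lipschitzTerm e (L.dualHalfNorm y.1) τ y.2

theorem norm_dualThetaTerm_of_im (τ : ℂ) (z : Fin N → ℂ) (l : L.dual) :
    ‖L.dualThetaTerm (-Complex.I * τ) z l‖ =
      ‖L.dualExp z l‖ * Real.exp (-(2 * Real.pi * τ.im * L.dualHalfNorm l)) := by
  rw [dualThetaTerm_eq_mul, norm_mul, Complex.norm_exp]
  congr 2
  simp
  ring

/-- For fixed `l` the terms decay exponentially away from `n = (l,l)/2`, uniformly in `l`, with a
constant proportional to the absolute value of a convergent dual theta term. -/
theorem summable_norm_fourierTerm {e : ℕ} (he : e ≠ 0) {τ : ℂ} (hτ : 0 < τ.im) (z : Fin N → ℂ) :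
    Summable fun y => ‖L.fourierTerm e τ z y‖ := by
  have hre : 0 < (-Complex.I * τ).re := by simpa using hτ
  have h1 := (L.summable_dualThetaTerm hre z).norm.mul_right (e.factorial / (Real.pi * τ.im) ^ e)
  have h2 := summable_prod_exp_neg_abs_sub h1 (fun _ => by positivity) L.dualHalfNorm
    (b := Real.pi * τ.im) (by positivity)
  refine Summable.of_nonneg_of_le (fun _ => norm_nonneg _) (fun y => ?_) h2
  rw [fourierTerm, norm_mul, norm_dualThetaTerm_of_im]
  have h3 := norm_lipschitzTerm_le he (L.dualHalfNorm y.1) hτ y.2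
  calc _ ≤ ‖L.dualExp z y.1‖ * _ := mul_le_mul_of_nonneg_left h3 (norm_nonneg _)
    _ = _ := by ring

theorem tsum_tsum_slash_cosetRep_inr (hN : Even N) {k : ℕ} (hkN : N + 2 < k)
    (p : ReducedFraction) (τ : ℍ) (z : Fin N → ℂ) :
    ∑' r : ℤ, ∑' x : Fin N → ℤ, L.slash k 1 (fun _ _ => 1) (cosetRep (Sum.inr ((p, r), x))) τ z =
      (L.vol : ℂ)⁻¹ * (-Complex.I) ^ (N / 2) *
      ((-2 * Real.pi * Complex.I) ^ (k - N / 2) / (k - N / 2 - 1).factorial) *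
      ∑' y : L.dual × ℤ, ((p.1.1 : ℂ) ^ k)⁻¹ * L.gaussSum p.1.1 p.1.2 y.2 y.1 *
        L.fourierTerm (k - N / 2 - 1) τ z y := by
  obtain ⟨e, he⟩ : ∃ e, k - N / 2 = e + 1 := ⟨k - N / 2 - 1, by omega⟩
  have he0 : e ≠ 0 := by omega
  simp_rw [L.tsum_slash_cosetRep_inr hN hkN]
  rw [he, Nat.add_sub_cancel]
  set c : ℕ := ((p.1.1 : ℕ+) : ℕ) with hc
  set d : ℕ := p.1.2 with hd
  set σ : ℂ := (τ : ℂ) + d / c with hσ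
  have hσim : σ.im = τ.im := im_add_natCast_div _ _ _
  have hσpos : 0 < σ.im := hσim ▸ τ.im_pos
  have hσre : 0 < (-Complex.I * σ).re := by simpa using hσpos
  rw [tsum_mul_left]
  have hs : Summable fun y : ℤ × L.dual => L.dualExp z y.2 * L.gaussSum c d 0 y.2 *
      ((σ + y.1) ^ (-((e + 1 : ℕ) : ℤ)) *
        Complex.exp (2 * Real.pi * Complex.I * L.dualHalfNorm y.2 * (σ + y.1))) := by
    have h1 := (summable_norm_add_intCast_zpow σ (κ := e + 1) (by omega)).mul_of_nonneg
      ((L.summable_dualThetaTerm hσre z).norm.mul_right ((c : ℝ) ^ N)) (fun _ => norm_nonneg _)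
      (fun _ => by positivity)
    refine Summable.of_norm_bounded h1 fun y => ?_
    rw [norm_mul, norm_mul, norm_mul, norm_dualThetaTerm_of_im]
    have h2 : ‖Complex.exp (2 * Real.pi * Complex.I * L.dualHalfNorm y.2 * (σ + y.1))‖ =
        Real.exp (-(2 * Real.pi * σ.im * L.dualHalfNorm y.2)) := by
      rw [Complex.norm_exp]
      congr 1
      simp
      ring
    rw [h2]
    have h3 := L.norm_gaussSum_le c d 0 y.2
    calc _ ≤ ‖L.dualExp z y.2‖ * (c : ℝ) ^ N * (‖(σ + y.1) ^ (-((e + 1 : ℕ) : ℤ))‖ *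
        Real.exp (-(2 * Real.pi * σ.im * L.dualHalfNorm y.2))) := by gcongr
      _ = _ := by ring
  -- The sum over `r` goes inside, so that Lipschitz's formula applies for each `l` with `μ =
  -- (l,l)/2`.
  have hswap := hs.tsum_comm' (fun r => hs.prod_factor r) (fun l => hs.prod_symm.prod_factor l)
  refine (congrArg (_ * ·) hswap.symm).trans ?_
  dsimp only
  simp_rw [tsum_mul_left, tsum_add_intCast_zpow_mul_exp he0 _ hσpos]
  have hft : Summable fun y : L.dual × ℤ => ((c : ℂ) ^ k)⁻¹ * L.gaussSum c d y.2 y.1 *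
      L.fourierTerm e τ z y := by
    refine Summable.of_norm_bounded ((L.summable_norm_fourierTerm he0 τ.im_pos z).mul_left
      (((c : ℝ) ^ (k - N))⁻¹)) fun y => ?_
    rw [norm_mul]
    gcongr
    exact L.norm_gaussSum_div_le (by omega) c d y.2 y.1
  rw [hft.tsum_prod, ← tsum_mul_left, ← tsum_mul_left]
  refine tsum_congr fun l => ?_
  rw [← tsum_mul_left, ← tsum_mul_left, ← tsum_mul_left, ← tsum_mul_left]
  refine tsum_congr fun m => ?_
  rw [fourierTerm, L.gaussSum_eq_zero_mul c d m l, hσ, lipschitzTerm_add_ratio]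
  ring

/-- The arithmetic factor of the Fourier coefficients. -/
noncomputable def eulerFactor (k : ℕ) (y : L.dual × ℤ) : ℂ :=
  (∑' a : ℕ+, (L.repNum y.2 y.1 a : ℂ) / (a : ℂ) ^ (k - 1)) / riemannZeta ((k : ℂ) - N)

/-- The trivial bound `c^N` for the Gauss sums makes the double series absolutely convergent; after
exchanging the summations the reduced fractions contribute only the arithmetic factor. -/
theorem tsum_gaussSum_mul_fourierTerm {k : ℕ} (hkN : N + 2 < k) {e : ℕ} (he : e ≠ 0) (τ : ℍ)
    (z : Fin N → ℂ) :
    (Summable fun y => L.eulerFactor k y * L.fourierTerm e τ z y) ∧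
    ∑' p : ReducedFraction, ∑' y : L.dual × ℤ,
      ((p.1.1 : ℂ) ^ k)⁻¹ * L.gaussSum p.1.1 p.1.2 y.2 y.1 * L.fourierTerm e τ z y =
    ∑' y, L.eulerFactor k y * L.fourierTerm e τ z y := by
  have hs : Summable fun x : ReducedFraction × (L.dual × ℤ) =>
      ((x.1.1.1 : ℂ) ^ k)⁻¹ * L.gaussSum x.1.1.1 x.1.1.2 x.2.2 x.2.1 * L.fourierTerm e τ z x.2 := by
    refine Summable.of_norm_bounded ((summable_reducedFraction (m := k - N) (by omega)).mul_of_nonneg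
      (L.summable_norm_fourierTerm he τ.im_pos z) (fun _ => by positivity)
      (fun _ => norm_nonneg _)) fun x => ?_
    rw [norm_mul]
    gcongr
    exact L.norm_gaussSum_div_le (by omega) _ _ x.2.2 x.2.1
  have h1 : ∀ y : L.dual × ℤ, ∑' p : ReducedFraction,
      ((p.1.1 : ℂ) ^ k)⁻¹ * L.gaussSum p.1.1 p.1.2 y.2 y.1 * L.fourierTerm e τ z y =
      L.eulerFactor k y * L.fourierTerm e τ z y := by
    intro y
    rw [tsum_mul_right, L.tsum_gaussSum hkN, eulerFactor]
  constructor
  · have h2 := hs.prod_symm.prod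
    exact h2.congr fun y => h1 y
  · exact (hs.tsum_comm' (fun p => hs.prod_factor p)
      (fun y => hs.prod_symm.prod_factor y)).symm.trans (tsum_congr h1)

/-- The constant factor of the Fourier coefficients. -/
noncomputable def fourierConst (k : ℕ) : ℂ :=
  (L.vol : ℂ)⁻¹ * (-Complex.I) ^ (N / 2) *
    ((-2 * Real.pi * Complex.I) ^ (k - N / 2) / (k - N / 2 - 1).factorial)

theorem eisenstein_eq_theta_add (hN : Even N) {k : ℕ} (hk : Even k) (hkN : N + 2 < k) (τ : ℍ)
    (z : Fin N → ℂ) :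
    L.eisenstein k 1 τ z = L.theta 0 0 τ z + ∑' y, L.fourierConst k *
      (L.eulerFactor k y * L.fourierTerm (k - N / 2 - 1) τ z y) := by
  have hs := (L.summable_norm_slash_cosetRep_inr hN hkN τ z).of_norm
  have hs' := hs.prod
  rw [L.eisenstein_eq hN hk hkN]
  rw [hs'.tsum_prod]
  simp_rw [L.tsum_tsum_slash_cosetRep_inr hN hkN]
  rw [tsum_mul_left, (L.tsum_gaussSum_mul_fourierTerm hkN (by omega) τ z).2, tsum_mul_left,
    fourierConst]

theorem fourierConst_mul_eulerFactor (hN : Even N) {k : ℕ} (hkN : N + 2 < k) (y : L.dual × ℤ)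
    (hy : L.form (y.1 : Fin N → ℚ) y.1 / 2 ≤ y.2) (τ : ℍ) (z : Fin N → ℂ) :
    L.fourierConst k * (L.eulerFactor k y * L.fourierTerm (k - N / 2 - 1) τ z y) =
      L.beta k y.2 y.1 * L.fourierMonomial y.2 y.1 τ z := by
  have h1 : max ((y.2 : ℝ) - L.dualHalfNorm y.1) 0 = (L.disc y.2 y.1 : ℚ) := by
    rw [max_eq_left, disc, dualHalfNorm]
    · push_cast
      rfl
    · rw [dualHalfNorm, sub_nonneg]
      exact_mod_cast hy
  -- The factor `(-i)^{N/2}` from theta inversion cancels `N/2` of the `k - N/2` factors `i` from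
  -- Lipschitz's formula.
  have h2 : (-Complex.I) ^ (N / 2) * (-2 * Real.pi * Complex.I) ^ (k - N / 2) =
      Complex.I ^ (k - N) * (-2 * Real.pi : ℂ) ^ (k - N / 2) := by
    have h3 : k - N / 2 = (k - N) + N / 2 := by
      obtain ⟨m, rfl⟩ := hN
      omega
    rw [mul_pow, h3, pow_add Complex.I]
    have h4 : (-Complex.I) ^ (N / 2) * Complex.I ^ (N / 2) = 1 := by
      rw [← mul_pow, neg_mul, Complex.I_mul_I, neg_neg, one_pow]
    linear_combination (Complex.I ^ (k - N) * (-2 * Real.pi : ℂ) ^ ((k - N) + N / 2)) * h4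
  rw [fourierTerm, lipschitzTerm, h1, fourierConst, eulerFactor, beta, fourierMonomial, dualExp]
  have h5 : (((L.disc y.2 y.1 : ℚ) : ℝ) : ℂ) = ((L.disc y.2 y.1 : ℚ) : ℂ) := by push_cast; rfl
  have h6 : (2 * Real.pi * Complex.I * (y.2 : ℝ) * τ : ℂ) = 2 * Real.pi * Complex.I * y.2 * τ := by
    push_cast; rfl
  rw [h5]
  push_cast
  set S := ∑' a : ℕ+, (L.repNum y.2 y.1 a : ℂ) / (a : ℂ) ^ (k - 1)
  set Z := riemannZeta ((k : ℂ) - N)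
  set D := ((L.disc y.2 y.1 : ℚ) : ℂ) ^ (k - N / 2 - 1)
  set E1 := Complex.exp (2 * Real.pi * Complex.I * y.2 * τ)
  set E2 := Complex.exp (2 * Real.pi * Complex.I *
    L.form (fun i => ((y.1 : Fin N → ℚ) i : ℂ)) z)
  simp only [div_eq_mul_inv, mul_inv]
  linear_combination (L.vol : ℂ)⁻¹ * ((k - N / 2 - 1).factorial : ℂ)⁻¹ * S * Z⁻¹ * D * E1 * E2 * h2

theorem fourierTerm_eq_zero {e : ℕ} (he : e ≠ 0) (τ : ℂ) (z : Fin N → ℂ) (y : L.dual × ℤ)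
    (hy : (y.2 : ℚ) ≤ L.form (y.1 : Fin N → ℚ) y.1 / 2) : L.fourierTerm e τ z y = 0 := by
  have : max ((y.2 : ℝ) - L.dualHalfNorm y.1) 0 = 0 := by
    rw [max_eq_right]
    rw [dualHalfNorm, sub_nonpos]
    exact_mod_cast hy
  rw [fourierTerm, lipschitzTerm, this]
  simp [he]

theorem form_nonneg (l : Fin N → ℚ) : 0 ≤ L.form l l := by
  obtain ⟨δ, hδ, hform⟩ := L.exists_form_ge
  have h := hform (fun i => (l i : ℝ))
  rw [form_ratCast_real] at h
  have h' : (0 : ℝ) ≤ (L.form l l : ℚ) := le_trans (by positivity) h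
  exact_mod_cast h'

theorem hasSum_beta (hN : Even N) {k : ℕ} (hkN : N + 2 < k) (τ : ℍ) (z : Fin N → ℂ) :
    HasSum (fun p : {p : ℕ+ × L.dual // L.form (p.2 : Fin N → ℚ) p.2 / 2 < (p.1 : ℚ)} =>
        L.beta k (p.1.1 : ℕ) p.1.2 * L.fourierMonomial (p.1.1 : ℕ) p.1.2 τ z)
      (∑' y, L.fourierConst k * (L.eulerFactor k y * L.fourierTerm (k - N / 2 - 1) τ z y)) := by
  have he : k - N / 2 - 1 ≠ 0 := by omega
  have hs := ((L.tsum_gaussSum_mul_fourierTerm hkN he τ z).1.mul_left (L.fourierConst k)).hasSum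
  let ι : {p : ℕ+ × L.dual // L.form (p.2 : Fin N → ℚ) p.2 / 2 < (p.1 : ℚ)} → L.dual × ℤ :=
    fun p => (p.1.2, ((p.1.1 : ℕ) : ℤ))
  have hι : Function.Injective ι := by
    rintro ⟨⟨n, l⟩, h⟩ ⟨⟨n', l'⟩, h'⟩ hh
    have h1 : l = l' := congrArg Prod.fst hh
    have h2 : ((n : ℕ) : ℤ) = (n' : ℕ) := congrArg Prod.snd hh
    have h3 : n = n' := PNat.coe_injective (by exact_mod_cast h2)
    subst h1 h3
    rfl
  rw [← hι.hasSum_iff] at hs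
  · refine hs.congr_fun fun p => ?_
    have hp : L.form (p.1.2 : Fin N → ℚ) p.1.2 / 2 ≤ (((p.1.1 : ℕ) : ℤ) : ℚ) := by
      exact_mod_cast p.2.le
    exact (L.fourierConst_mul_eulerFactor hN hkN (p.1.2, ((p.1.1 : ℕ) : ℤ)) hp τ z).symm
  · intro y hy
    rw [L.fourierTerm_eq_zero he τ z y, mul_zero, mul_zero]
    by_contra hlt
    rw [not_le] at hlt
    apply hy
    -- A nonzero term has `n > (l,l)/2 ≥ 0`, so summing over positive `n` loses nothing.
    have hpos : (0 : ℚ) < y.2 := lt_of_le_of_lt (div_nonneg (L.form_nonneg _) two_pos.le) hlt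
    have hpos' : 0 < y.2 := by exact_mod_cast hpos
    have hnat : ((y.2.toNat : ℕ) : ℤ) = y.2 := Int.toNat_of_nonneg hpos'.le
    refine ⟨⟨(⟨y.2.toNat, by omega⟩, y.1), ?_⟩, ?_⟩
    · have : (((y.2.toNat : ℕ) : ℤ) : ℚ) = y.2 := by rw [hnat]
      change L.form (y.1 : Fin N → ℚ) y.1 / 2 < ((y.2.toNat : ℕ) : ℚ)
      rw [← Int.cast_natCast, this]
      exact hlt
    · exact Prod.ext rfl hnat

end EvenLattice

/-! ### Holomorphy of series of exponentials -/

section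

variable {ι E : Type*} [NormedAddCommGroup E] [NormedSpace ℂ E]

theorem convexOn_norm_mul_exp (c : ℂ) (l : E →L[ℂ] ℂ) :
    ConvexOn ℝ univ fun p => ‖c * Complex.exp (l p)‖ := by
  simp_rw [norm_mul, Complex.norm_exp]
  have h := convexOn_exp.comp_linearMap
    ((Complex.reCLM : ℂ →L[ℝ] ℝ).toLinearMap ∘ₗ l.toLinearMap.restrictScalars ℝ)
  exact (h.smul (norm_nonneg c) :)

/-- A Cauchy estimate: along a direction `θv` of norm `r` in which `l` takes the value `r‖l v‖`, the
term grows by `exp (r‖l v‖) ≥ r‖l v‖`. -/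
theorem norm_mul_exp_smul_le {c : ℂ} {l : E →L[ℂ] ℂ} {p : E} {r u : ℝ} (hr : 0 < r)
    (hu : ∀ q, ‖q‖ ≤ r → ‖c * Complex.exp (l (p + q))‖ ≤ u) :
    ‖(c * Complex.exp (l p)) • l‖ ≤ u / r := by
  have hu0 : 0 ≤ u := (norm_nonneg _).trans (hu 0 (by simpa using hr.le))
  refine ContinuousLinearMap.opNorm_le_of_unit_norm (𝕜 := ℂ) (by positivity) fun v hv => ?_
  obtain ⟨θ, hθ, hθv⟩ := RCLike.exists_norm_eq_mul_self (l v)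
  have h1 := hu (((r : ℂ) * θ) • v) (by simp [norm_smul, hθ, hv, abs_of_pos hr])
  have h2 : l (p + ((r : ℂ) * θ) • v) = l p + ((r * ‖l v‖ : ℝ) : ℂ) := by
    rw [map_add, map_smul, smul_eq_mul, mul_assoc, ← hθv]
    simp
  rw [h2, Complex.exp_add, ← mul_assoc, norm_mul, Complex.norm_exp, Complex.ofReal_re] at h1
  rw [smul_apply, norm_smul, le_div_iff₀ hr]
  calc _ = ‖c * Complex.exp (l p)‖ * (r * ‖l v‖) := by ring
    _ ≤ ‖c * Complex.exp (l p)‖ * Real.exp (r * ‖l v‖) := by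
      gcongr
      linarith [Real.add_one_le_exp (r * ‖l v‖)]
    _ ≤ u := h1

/-- On a simplex in `U` a convex function is bounded by its values at the vertices. Pointwise
convergence at finitely many vertices therefore gives a summable majorant near each point, and the
Cauchy estimate one for the derivatives. -/
theorem differentiableOn_tsum_mul_exp [FiniteDimensional ℂ E] {U : Set E} (hU : IsOpen U)
    (c : ι → ℂ) (l : ι → E →L[ℂ] ℂ)
    (h : ∀ p ∈ U, Summable fun i => c i * Complex.exp (l i p)) :
    DifferentiableOn ℂ (fun p => ∑' i, c i * Complex.exp (l i p)) U := by
  intro x hx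
  obtain ⟨b, hxb, hbU⟩ := exists_mem_interior_convexHull_affineBasis (hU.mem_nhds hx)
  obtain ⟨R, hR, hball⟩ := Metric.isOpen_iff.1 isOpen_interior x hxb
  have hbU' : ∀ j, b j ∈ U := fun j => hbU (subset_convexHull ℝ _ (mem_range_self j))
  set u : ι → ℝ := fun i => ∑ j, ‖c i * Complex.exp (l i (b j))‖ with hu
  have hsum : Summable u := summable_sum fun j _ => (h _ (hbU' j)).norm
  have hle : ∀ p ∈ Metric.ball x R, ∀ i, ‖c i * Complex.exp (l i p)‖ ≤ u i := by
    intro p hp i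
    obtain ⟨_, ⟨j, rfl⟩, hj⟩ := (convexOn_norm_mul_exp (c i) (l i)).exists_ge_of_mem_convexHull
      (subset_univ _) (interior_subset (hball hp))
    exact hj.trans (Finset.single_le_sum (f := fun j => ‖c i * Complex.exp (l i (b j))‖)
      (fun _ _ => norm_nonneg _) (Finset.mem_univ j))
  -- Displacements of length `R/3` from the ball of radius `R/2` stay in the ball of radius `R`,
  -- where the majorant holds.
  have hd : ∀ i p, p ∈ Metric.ball x (R / 2) →
      ‖(c i * Complex.exp (l i p)) • l i‖ ≤ u i / (R / 3) := by
    intro i p hp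
    refine norm_mul_exp_smul_le (by positivity) fun q hq => hle _ ?_ i
    rw [Metric.mem_ball, dist_eq_norm] at hp ⊢
    calc ‖p + q - x‖ = ‖(p - x) + q‖ := by congr 1; abel
      _ ≤ ‖p - x‖ + ‖q‖ := norm_add_le _ _
      _ < R := by linarith
  have hxR : x ∈ Metric.ball x (R / 2) := Metric.mem_ball_self (by positivity)
  refine (hasFDerivAt_tsum_of_isPreconnected (𝕜 := ℂ) (hsum.div_const (R / 3)) Metric.isOpen_ball
    ((convex_ball x (R / 2)).isPreconnected) (fun i p _ => ?_) hd hxR (h x hx)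
    hxR).differentiableAt.differentiableWithinAt
  have h1 := ((l i).hasFDerivAt (x := p)).cexp.const_mul (c i)
  rwa [smul_smul] at h1

end

/-! ### The Eisenstein series as a Jacobi form -/

namespace EvenLattice

variable {N : ℕ} (L : EvenLattice N)

/-- At a given point the operator is evaluation at another point times a scalar, so it commutes with
`tsum` without any appeal to convergence. -/
theorem exists_slash_eq_mul (k m : ℕ) (g : JacobiGroup N) (τ : ℍ) (z : Fin N → ℂ) :
    ∃ (C : ℂ) (τ' : ℍ) (z' : Fin N → ℂ), ∀ φ : ℍ → (Fin N → ℂ) → ℂ,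
      L.slash k m φ g τ z = C * φ τ' z' := by
  let j : ℂ := (g.right 1 0 : ℂ) * τ + (g.right 1 1 : ℂ)
  let x : Fin N → ℂ := fun i => (g.left.toAdd.1 i : ℂ)
  let y : Fin N → ℂ := fun i => (g.left.toAdd.2 i : ℂ)
  exact ⟨_, g.right • τ, j⁻¹ • z + ((g.right • τ : ℍ) : ℂ) • x + y,
    fun φ => (mul_assoc _ _ _).symm⟩

/-- Right multiplication by `g` on the cosets `Γ_∞^J \ Γ^J`. -/
noncomputable def cosetMulRight (k m : ℕ) (g : JacobiGroup N) :
    Quotient (QuotientGroup.rightRel (L.stabOne k m)) ≃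
      Quotient (QuotientGroup.rightRel (L.stabOne k m)) :=
  Quotient.congr (Equiv.mulRight g) fun a b => by
    change (QuotientGroup.rightRel (L.stabOne k m)) a b ↔
      (QuotientGroup.rightRel (L.stabOne k m)) (a * g) (b * g)
    rw [QuotientGroup.rightRel_apply, QuotientGroup.rightRel_apply]
    simp [mul_assoc]

theorem slash_eisensteinTerm (k m : ℕ) (g : JacobiGroup N)
    (q : Quotient (QuotientGroup.rightRel (L.stabOne k m))) :
    L.slash k m (L.eisensteinTerm k m q) g = L.eisensteinTerm k m (L.cosetMulRight k m g q) := by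
  induction q using Quotient.inductionOn with
  | h a => exact L.slash_mul k m _ a g

theorem slash_eisenstein (k m : ℕ) (g : JacobiGroup N) :
    L.slash k m (L.eisenstein k m) g = L.eisenstein k m := by
  funext τ z
  obtain ⟨C, τ', z', h⟩ := L.exists_slash_eq_mul k m g τ z
  rw [h, eisenstein, ← tsum_mul_left, eisenstein,
    ← (L.cosetMulRight k m g).tsum_eq fun q => L.eisensteinTerm k m q τ z]
  exact tsum_congr fun q => by rw [← h, slash_eisensteinTerm]

/-- The inclusion of `L` in `L^∨`. -/
def intDual (x : Fin N → ℤ) : L.dual :=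
  ⟨fun i => x i, fun y => ⟨L.form x y, by simp [form, dotProduct, Matrix.mulVec]⟩⟩

theorem form_intDual (x : Fin N → ℤ) :
    L.form (L.intDual x : Fin N → ℚ) (L.intDual x) = 2 * (L.halfNorm x : ℤ) := by
  have h : L.form (L.intDual x : Fin N → ℚ) (L.intDual x) = (L.form x x : ℤ) := by
    simp [intDual, form, dotProduct, Matrix.mulVec]
  rw [h, ← L.two_mul_halfNorm x]
  push_cast
  rfl

theorem intDual_injective : Function.Injective L.intDual := by
  intro x y h
  funext i
  have hi : (x i : ℚ) = y i := congrFun (congrArg Subtype.val h) i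
  exact_mod_cast hi

theorem fourierMonomial_intDual (x : Fin N → ℤ) (τ : ℍ) (z : Fin N → ℂ) :
    L.fourierMonomial (L.halfNorm x) (L.intDual x) τ z = L.thetaTerm 0 0 τ z x := by
  have h : (2 * (L.halfNorm x : ℤ) : ℂ) = L.form (fun i => (x i : ℂ)) (fun i => (x i : ℂ)) := by
    rw [form_intCast, ← L.two_mul_halfNorm x]
    push_cast
    rfl
  rw [fourierMonomial, thetaTerm, ← Complex.exp_add]
  simp only [intDual, Pi.zero_apply, Rat.cast_zero, add_zero, Rat.cast_intCast]
  congr 1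
  linear_combination Real.pi * Complex.I * τ * h

/-- The Fourier coefficients of the Jacobi-Eisenstein series. -/
noncomputable def eisensteinCoeff (k : ℕ) (n : ℤ) (l : L.dual) : ℂ :=
  L.beta k n l + (range fun x => (L.halfNorm x, L.intDual x)).indicator 1 (n, l)

theorem hasSum_eisensteinCoeff (hN : Even N) {k : ℕ} (hk : Even k) (hkN : N + 2 < k) (τ : ℍ)
    (z : Fin N → ℂ) :
    HasSum (fun p : {p : ℤ × L.dual //
        0 ≤ 2 * (p.1 : ℚ) * (1 : ℕ) - L.form (p.2 : Fin N → ℚ) p.2} =>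
      L.eisensteinCoeff k p.1.1 p.1.2 * L.fourierMonomial p.1.1 p.1.2 τ z)
      (L.eisenstein k 1 τ z) := by
  have he : k - N / 2 - 1 ≠ 0 := by omega
  set I := {p : ℤ × L.dual // 0 ≤ 2 * (p.1 : ℚ) * (1 : ℕ) - L.form (p.2 : Fin N → ℚ) p.2}
  have hI : ∀ p : I, L.form (p.1.2 : Fin N → ℚ) p.1.2 / 2 ≤ p.1.1 := by
    intro p
    have := p.2
    push_cast at this
    linarith
  have h1 : HasSum (fun p : I => L.beta k p.1.1 p.1.2 * L.fourierMonomial p.1.1 p.1.2 τ z)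
      (∑' y, L.fourierConst k * (L.eulerFactor k y * L.fourierTerm (k - N / 2 - 1) τ z y)) := by
    have hs := ((L.tsum_gaussSum_mul_fourierTerm hkN he τ z).1.mul_left (L.fourierConst k)).hasSum
    have hι : Function.Injective fun p : I => (p.1.2, p.1.1) := fun p q h =>
      Subtype.ext (Prod.ext (congrArg Prod.snd h) (congrArg Prod.fst h))
    rw [← hι.hasSum_iff] at hs
    · exact hs.congr_fun fun p =>
        (L.fourierConst_mul_eulerFactor hN hkN (p.1.2, p.1.1) (hI p) τ z).symm
    · intro y hy
      rw [L.fourierTerm_eq_zero he τ z y, mul_zero, mul_zero]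
      by_contra hlt
      refine hy ⟨⟨(y.2, y.1), ?_⟩, rfl⟩
      push_cast
      linarith
  -- The theta series occupies pairs with `2n = (l,l)` and `l ∈ L`; extending it by zero allows both
  -- parts to be added over one index set.
  have h2 : HasSum (fun p : I => (range fun x => (L.halfNorm x, L.intDual x)).indicator 1 p.1 *
      L.fourierMonomial p.1.1 p.1.2 τ z) (L.theta 0 0 τ z) := by
    let κ : (Fin N → ℤ) → I := fun x => ⟨(L.halfNorm x, L.intDual x), by
      dsimp only
      rw [form_intDual]
      push_cast
      linarith⟩
    have hκ : Function.Injective κ := fun x y h =>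
      L.intDual_injective (congrArg (fun p : I => p.1.2) h)
    rw [← hκ.hasSum_iff]
    · refine (L.summable_thetaTerm τ z).hasSum.congr_fun fun x => ?_
      rw [Function.comp_apply, indicator_of_mem (mem_range_self x), Pi.one_apply, one_mul]
      exact L.fourierMonomial_intDual x τ z
    · intro p hp
      rw [indicator_of_notMem, zero_mul]
      rintro ⟨x, hx⟩
      exact hp ⟨x, Subtype.ext hx⟩
  rw [L.eisenstein_eq_theta_add hN hk hkN, add_comm]
  exact (h1.add h2).congr_fun fun p => add_mul _ _ _

/-- Each Fourier monomial is the exponential of a linear form in `(τ, z)`, so the expansion is a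
series of the kind treated above. -/
theorem differentiableOn_eisenstein (hN : Even N) {k : ℕ} (hk : Even k) (hkN : N + 2 < k) :
    DifferentiableOn ℂ (fun p : ℂ × (Fin N → ℂ) =>
      L.eisenstein k 1 (UpperHalfPlane.ofComplex p.1) p.2) {p | 0 < p.1.im} := by
  set I := {p : ℤ × L.dual // 0 ≤ 2 * (p.1 : ℚ) * (1 : ℕ) - L.form (p.2 : Fin N → ℚ) p.2}
  let l : I → (ℂ × (Fin N → ℂ)) →L[ℂ] ℂ := fun i => LinearMap.toContinuousLinearMap
    { toFun := fun p => 2 * Real.pi * Complex.I * i.1.1 * p.1 +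
        2 * Real.pi * Complex.I * L.form (fun j => ((i.1.2 : Fin N → ℚ) j : ℂ)) p.2
      map_add' := fun p q => by
        rw [Prod.snd_add, form_add_right, Prod.fst_add]
        ring
      map_smul' := fun r p => by
        rw [Prod.smul_snd, form_smul_right, Prod.smul_fst, RingHom.id_apply, smul_eq_mul,
          smul_eq_mul]
        ring }
  have key : ∀ p : ℂ × (Fin N → ℂ), 0 < p.1.im →
      HasSum (fun i : I => L.eisensteinCoeff k i.1.1 i.1.2 * Complex.exp (l i p))
        (L.eisenstein k 1 (UpperHalfPlane.ofComplex p.1) p.2) := by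
    intro p hp
    refine (L.hasSum_eisensteinCoeff hN hk hkN (UpperHalfPlane.ofComplex p.1) p.2).congr_fun
      fun i => ?_
    rw [fourierMonomial, ← Complex.exp_add, UpperHalfPlane.ofComplex_apply_of_im_pos hp]
    rfl
  have hU : IsOpen {p : ℂ × (Fin N → ℂ) | 0 < p.1.im} :=
    isOpen_lt continuous_const (Complex.continuous_im.comp continuous_fst)
  exact (differentiableOn_tsum_mul_exp hU _ l fun p hp => (key p hp).summable).congr
    fun p hp => (key p hp).tsum_eq.symm

theorem isJacobiForm_eisenstein (hN : Even N) {k : ℕ} (hk : Even k) (hkN : N + 2 < k) :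
    L.IsJacobiForm k 1 (L.eisenstein k 1) where
  holomorphic := L.differentiableOn_eisenstein hN hk hkN
  slash_eq := L.slash_eisenstein k 1
  fourier := ⟨L.eisensteinCoeff k, fun τ z => L.hasSum_eisensteinCoeff hN hk hkN τ z⟩

end EvenLattice

theorem mainTheorem4 {N : ℕ} (L : EvenLattice N) (hN : Even N) (k : ℕ) (hk : Even k)
    (hkN : N + 2 < k) :
    -- the Jacobi-Eisenstein series converges absolutely
    (∀ (τ : UpperHalfPlane) (z : Fin N → ℂ), Summable fun q => L.eisensteinTerm k 1 q τ z) ∧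
    L.IsJacobiForm k 1 (L.eisenstein k 1) ∧
    -- the series in the coefficients converge
    (∀ (n : ℤ) (l : L.dual), Summable fun a : ℕ+ => (L.repNum n l a : ℂ) / (a : ℂ) ^ (k - 1)) ∧
    -- the Fourier expansion, all series being absolutely convergent
    ∀ (τ : UpperHalfPlane) (z : Fin N → ℂ),
      Summable (L.thetaTerm 0 0 τ z) ∧
      Summable (fun p : {p : ℕ+ × L.dual // L.form (p.2 : Fin N → ℚ) p.2 / 2 < (p.1 : ℚ)} =>
        L.beta k (p.1.1 : ℕ) p.1.2 * L.fourierMonomial (p.1.1 : ℕ) p.1.2 τ z) ∧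
      L.eisenstein k 1 τ z = L.theta 0 0 τ z +
        ∑' p : {p : ℕ+ × L.dual // L.form (p.2 : Fin N → ℚ) p.2 / 2 < (p.1 : ℚ)},
          L.beta k (p.1.1 : ℕ) p.1.2 * L.fourierMonomial (p.1.1 : ℕ) p.1.2 τ z := by
  refine ⟨L.summable_eisensteinTerm hN hk hkN, L.isJacobiForm_eisenstein hN hk hkN,
    L.summable_repNum_div hkN, fun τ z => ?_⟩
  have h := L.hasSum_beta hN hkN τ z
  exact ⟨L.summable_thetaTerm τ z, h.summable,
    by rw [h.tsum_eq, L.eisenstein_eq_theta_add hN hk hkN]⟩
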